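/- Let $d\in\mathbb N$, $\delta>0$ and $\gamma<0$ with $1<\frac d\delta<\gamma+2$. Put $V(x)=\|x\|^\delta$ on $\mathbb R^d$ (Euclidean norm) and $\theta_j=j^\gamma$ for $j\ge1$. A spatial partition $\boldsymbol\lambda=(\lambda_x)_{x\in\mathbb Z^d}$ of $n$ is a family of integer partitions whose parts, taken over all sites, add up to $n$. Let $r_{xj}$ be the number of parts of $\lambda_x$ equal to $j$, and for $L>0$ let $$\mathbb P_{L,n}(\boldsymbol\lambda)=\frac1{Z_{L,n}}\prod_{x\in\mathbb Z^d}\prod_{j\ge1}\frac1{r_{xj}!}\Bigl(\frac{\theta_j}{j}e^{-jV(x/L)}\Bigr)^{r_{xj}},$$ where $Z_{L,n}$ is the normalisation. Let $H_0=\sum_j j\,r_{0j}$ be the occupation number of the origin. Let $\rho(z)=\sum_{j\ge1}\theta_jz^j\int_{\mathbb R^d}e^{-jV(x)}\,dx$, let $z_{\rm c}$ be the radius of convergence of this power series, and let $\rho_{\rm c}=\rho(z_{\rm c})\in[0,\infty]$. Let $\rho$ be a real number with $\rho>\rho_{\rm c}$. Let $\mathbb E_L^{z}$ be the expectation for independent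 Poisson variables $R_{xj}$ ($x\in\mathbb Z^d$, $j\ge1$) with parameters $\frac{\theta_j}{j}z^je^{-jV(x/L)}$, and let $\rho_{\rm c}^L=L^{-d}\,\mathbb E_L^{z_{\rm c}}\bigl[\sum_{x\ne0}\sum_{j\ge1}jR_{xj}\bigr]$. Finally let $$b_{\gamma,\delta,d}=-\frac{\Gamma(1+\gamma)}{|\gamma|}\int_{\mathbb R^d}\Bigl((1+\|x\|^\delta)^{|\gamma|}-\|x\|^{\delta|\gamma|}-|\gamma|\,\|x\|^{-\delta(1+\gamma)}\Bigr)dx .$$ Then the integral converges absolutely and $b_{\gamma,\delta,d}>0$; there is a real random variable $Z$ with $$\mathbb E\,e^{tZ}=\exp\bigl(b_{\gamma,\delta,d}\,t^{|\gamma|+d/\delta}\bigr)\qquad\text{for all }t\ge0,$$ and every such $Z$ has a stable law. Moreover, for every such $Z$, as $n,L\to\infty$ with $n=\rho L^d$, the variable $$\frac{H_0-(\rho-\rho_{\rm c}^L)L^d}{L^\alpha},\qquad \alpha=\frac{\delta}{1-\delta\gamma/d},$$ under $\mathbb P_{L,n}$ (a well-defined probability measure) converges in distribution to $Z$. -/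

import Mathlib

open MeasureTheory ProbabilityTheory Filter Topology
open scoped ENNReal NNReal Nat

noncomputable section

namespace RandomPartition

/-- The rescaled lattice site `x / L`, as a point of Euclidean space. -/
def scaledSite {d : ℕ} (L : ℝ) (x : Fin d → ℤ) : EuclideanSpace ℝ (Fin d) :=
  WithLp.toLp 2 (fun i => (x i : ℝ) / L)

/-- A spatial partition of `n`: at every site `x ∈ ℤ^d` an integer partition `lam x`, that is, a
finite multiset of positive integers, empty at all but finitely many sites, such that all the
parts at all the sites add up to `n`. -/
def SpatialPartition (d n : ℕ) : Type :=
  {lam : (Fin d → ℤ) →₀ Multiset ℕ+ //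
    (lam.sum fun _ s => (s.map fun j : ℕ+ => (j : ℕ)).sum) = n}

/-- The set of spatial partitions is discrete: every subset is an event. -/
instance (d n : ℕ) : MeasurableSpace (SpatialPartition d n) := ⊤

/-- The site occupation number `η_x = ∑ i, lam_{x i}`. For `x = 0` this is `H_0`. -/
def occupation {d n : ℕ} (x : Fin d → ℤ) (lam : SpatialPartition d n) : ℕ :=
  ((lam.1 x).map fun j : ℕ+ => (j : ℕ)).sum

/-- The unnormalised weight
`∏ x, ∏ j, (1 / r_{xj}!) * ((θ_j / j) * exp (-j V(x/L))) ^ r_{xj}`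
of a spatial partition, where `r_{xj}` is the multiplicity of `j` in the partition at `x`
(factors with `r_{xj} = 0` equal `1`). -/
def weight {d n : ℕ} (V : EuclideanSpace ℝ (Fin d) → ℝ) (θ : ℕ+ → ℝ) (L : ℝ)
    (lam : SpatialPartition d n) : ℝ :=
  lam.1.prod fun x s => ∏ j ∈ s.toFinset,
    (1 / ((s.count j)! : ℝ)) *
      (θ j / (j : ℕ) * Real.exp (-((j : ℕ) : ℝ) * V (scaledSite L x))) ^ s.count j

/-- The normalisation `Z_{L,n}`. -/
def partitionFunction {d : ℕ} (V : EuclideanSpace ℝ (Fin d) → ℝ) (θ : ℕ+ → ℝ) (L : ℝ) (n : ℕ) :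
    ℝ≥0∞ :=
  ∑' lam : SpatialPartition d n, ENNReal.ofReal (weight V θ L lam)

/-- The canonical measure `ℙ_{L,n}` on the spatial partitions of `n`. -/
def canonicalMeasure {d : ℕ} (V : EuclideanSpace ℝ (Fin d) → ℝ) (θ : ℕ+ → ℝ) (L : ℝ) (n : ℕ) :
    Measure (SpatialPartition d n) :=
  (partitionFunction V θ L n)⁻¹ •
    Measure.sum fun lam : SpatialPartition d n =>
      ENNReal.ofReal (weight V θ L lam) • Measure.dirac lam

/-- The density series `ρ(z) = ∑_{j ≥ 1} θ_j z^j ∫ exp (-j V(x)) dx`, with values in `[0,∞]`. -/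
def density {d : ℕ} (V : EuclideanSpace ℝ (Fin d) → ℝ) (θ : ℕ+ → ℝ) (z : ℝ≥0∞) : ℝ≥0∞ :=
  ∑' j : ℕ+, ENNReal.ofReal (θ j) * z ^ (j : ℕ) *
    ∫⁻ x : EuclideanSpace ℝ (Fin d), ENNReal.ofReal (Real.exp (-((j : ℕ) : ℝ) * V x))

/-- The radius of convergence `z_c` of the density series (its coefficients are nonnegative, so it
is the supremum of the `z ≥ 0` at which the series converges). -/
def criticalFugacity {d : ℕ} (V : EuclideanSpace ℝ (Fin d) → ℝ) (θ : ℕ+ → ℝ) : ℝ≥0∞ :=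
  sSup {z : ℝ≥0∞ | density V θ z < ∞}

/-- The transition density `ρ_c = ρ(z_c)`. -/
def criticalDensity {d : ℕ} (V : EuclideanSpace ℝ (Fin d) → ℝ) (θ : ℕ+ → ℝ) : ℝ≥0∞ :=
  density V θ (criticalFugacity V θ)

/-- The grand-canonical measure `ℙ_L^z`: the law of a family `(R_{xj})` of independent Poisson
variables with parameters `(θ_j / j) z^j exp (-j V(x/L))`. -/
def grandCanonicalMeasure {d : ℕ} (V : EuclideanSpace ℝ (Fin d) → ℝ) (θ : ℕ+ → ℝ) (L : ℝ)
    (z : ℝ≥0) : Measure ((Fin d → ℤ) × ℕ+ → ℕ) :=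
  Measure.infinitePi fun p =>
    poissonMeasure (Real.toNNReal (θ p.2 / (p.2 : ℕ) * (z : ℝ) ^ (p.2 : ℕ) *
      Real.exp (-((p.2 : ℕ) : ℝ) * V (scaledSite L p.1))))

/-- The number `M = ∑_{x ≠ 0} ∑_{j ≥ 1} j R_{xj}` of particles that are not at the origin. -/
def particlesOffOrigin {d : ℕ} (R : (Fin d → ℤ) × ℕ+ → ℕ) : ℝ≥0∞ :=
  ∑' (x : {x : Fin d → ℤ // x ≠ 0}) (j : ℕ+), ((j : ℕ) : ℝ≥0∞) * (R (x.1, j) : ℝ≥0∞)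

/-- `ρ_c^L`, the expectation of `M / L^d` under the grand-canonical measure at `z = z_c`. -/
def criticalDensityAt {d : ℕ} (V : EuclideanSpace ℝ (Fin d) → ℝ) (θ : ℕ+ → ℝ) (L : ℝ) : ℝ :=
  (1 / L ^ d) *
    (∫⁻ R, particlesOffOrigin R
      ∂(grandCanonicalMeasure V θ L (criticalFugacity V θ).toNNReal)).toReal

/-- The length `L` determined by `n = ρ L^d`. -/
def systemLength (d : ℕ) (ρ : ℝ) (n : ℕ) : ℝ := ((n : ℝ) / ρ) ^ (1 / (d : ℝ))

/-- The integrand in the definition of the constant `b_{γ,δ,d}`. -/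
def fluctuationIntegrand (γ δ : ℝ) (d : ℕ) (x : EuclideanSpace ℝ (Fin d)) : ℝ :=
  (1 + ‖x‖ ^ δ) ^ |γ| - ‖x‖ ^ (δ * |γ|) - |γ| * ‖x‖ ^ (-(δ * (1 + γ)))

/-- The constant `b_{γ,δ,d}`. -/
def fluctuationConstant (γ δ : ℝ) (d : ℕ) : ℝ :=
  -(Real.Gamma (1 + γ) / |γ|) * ∫ x : EuclideanSpace ℝ (Fin d), fluctuationIntegrand γ δ d x

/-- `μ` is the law of a variable `Z` with `E exp (t Z) = exp (b t^p)` for all `t ≥ 0`. -/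
def HasStableLaplace (μ : Measure ℝ) (b p : ℝ) : Prop :=
  ∀ t : ℝ, 0 ≤ t →
    Integrable (fun z : ℝ => Real.exp (t * z)) μ ∧
      ∫ z : ℝ, Real.exp (t * z) ∂μ = Real.exp (b * t ^ p)

/-- Stable laws on the line: `μ` is not a point mass and, for `X₁, X₂, X` independent with law `μ`
and `a₁, a₂ > 0`, the variable `a₁ X₁ + a₂ X₂` has the law of `c X + e` for some `c > 0` and
some real `e`. -/
def IsStableLaw (μ : Measure ℝ) : Prop :=
  (∀ x : ℝ, μ ≠ Measure.dirac x) ∧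
    ∀ a₁ a₂ : ℝ, 0 < a₁ → 0 < a₂ → ∃ c e : ℝ, 0 < c ∧
      Measure.conv (μ.map fun x => a₁ * x) (μ.map fun x => a₂ * x) = μ.map fun x => c * x + e

end RandomPartition

end

open MeasureTheory ProbabilityTheory Filter Topology
open scoped ENNReal NNReal Nat

noncomputable section

namespace RandomPartition

/-! ### Sums over finitely supported families -/

/-! The weight of a spatial partition is a product over sites, so P(H_0 = k) is proportional to a_k
b_(n-k). Here a_k is the coefficient of z^k in exp(∑ j^(γ-1) z^j), which does not involve L because
V vanishes at the origin, and b_m is the total weight of mass m placed off the origin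
(`tsum_weight_fiber`). After normalisation b becomes `massLaw`, whose generating function is that of
M = ∑_{x≠0} ∑_j j R_{xj} at z_c = 1. So H_0 is n - M, with the law of M reweighted by a_(n-M).

Put p = |γ| + d/δ. The hypotheses give γ > -1, δ < d and 1 < p < 2, and α = d/p. Three facts carry
the proof.

Reweighting is harmless. From the recursion k a_k = ∑_j j^γ a_(k-j) one gets a_k ~ H k^(γ-1) with H
= ∑ a_k (`tendsto_clusterCoeff`). The mean of M is asymptotic to ρ_c L^d, so n - M is close to κ L^d
with κ = ρ - ρ_c > 0, where a is regularly varying. The normalised weights a_(n-M) / (H (κ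
L^d)^(γ-1)) tend to 1 in mean (`tendsto_integral_abs_ratio`). Chernoff bounds control the two tails
of M; on the upper tail the weight may be polynomially large in L, but the probability is of order
exp(-c L^(d-δ)).

The fluctuations of M. The logarithm of E exp(t (E M - M) / L^α) is ∑_j I_j (exp(-u_j) - 1 + u_j)
with u_j = t j / L^α and I_j = j^(γ-1) ∑_{x≠0} exp(-j ‖x/L‖^δ). For j much smaller than L^δ the
lattice sum is close to an integral, and I_j is close to c L^d j^(-p-1). Since α < δ only this
regime matters, and the sum is a Riemann sum converging to c t^p ∫ u^(-p-1) (exp(-u) - 1 + u) du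
(`tendsto_offIntensity_expDefect`). Fubini and an integration by parts identify the factor of t^p
with b (`fluctuation_aux`), which also shows b > 0.

From transforms to laws. Moment generating functions are available only for t ≥ 0. Those of centred
variables are at least 1, which together with an upper bound at t = 2 gives tightness
(`isTight_of_mgf`); a finite measure is determined by its transform on (0, ∞)
(`measure_ext_of_mgf_pos`). This yields existence of Z, convergence, and stability. -/

/-- Splitting off one coordinate of a finitely supported family. -/
theorem tsum_finsupp_erase {ι α : Type*} [Zero α] (i : ι)
    (F : α → (ι →₀ α) → ℝ≥0∞) :
    ∑' r : ι →₀ α, F (r i) (r.erase i) =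
      ∑' a, ∑' r : ι →₀ α, {r : ι →₀ α | r i = 0}.indicator (F a) r := by
  classical
  let e : (ι →₀ α) ≃ α × {r : ι →₀ α // r i = 0} :=
    { toFun := fun r => (r i, ⟨r.erase i, Finsupp.erase_same⟩)
      invFun := fun p => p.2.1.update i p.1
      left_inv := fun r => by
        ext j
        by_cases h : j = i
        · subst h; simp
        · simp
      right_inv := fun ⟨a, r, hr⟩ => by
        refine Prod.ext (by simp) (Subtype.ext ?_)
        ext j
        by_cases h : j = i
        · subst h; simp [hr]
        · simp [h] }
  have h1 : ∑' r : ι →₀ α, F (r i) (r.erase i) =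
      ∑' p : α × {r : ι →₀ α // r i = 0}, F p.1 p.2.1 := by
    rw [← e.tsum_eq]
    rfl
  rw [h1, ENNReal.tsum_prod']
  refine tsum_congr fun a => ?_
  exact tsum_subtype {r : ι →₀ α | r i = 0} (F a)

/-- Distributivity: choosing one term from each factor is choosing a family supported in `s`, since
the coordinates outside `s` sit at 0 and contribute the factor 1. -/
theorem prod_tsum_eq_tsum_finsupp {ι α : Type*} [Zero α] (f : ι → α → ℝ≥0∞)
    (hf : ∀ i, f i 0 = 1) (s : Finset ι) :
    ∏ i ∈ s, ∑' a, f i a =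
      ∑' r : ι →₀ α, {r : ι →₀ α | r.support ⊆ s}.indicator (fun r => r.prod f) r := by
  classical
  induction s using Finset.induction_on with
  | empty =>
    rw [tsum_eq_single 0]
    · simp
    · intro r hr
      simp [hr]
  | insert i s his ih =>
    rw [Finset.prod_insert his, ih]
    have h1 : ∀ r : ι →₀ α,
        {r : ι →₀ α | r.support ⊆ insert i s}.indicator (fun r => r.prod f) r =
        f i (r i) * {r : ι →₀ α | r.support ⊆ s}.indicator (fun r => r.prod f) (r.erase i) := by
      intro r
      have h2 : r ∈ {r : ι →₀ α | r.support ⊆ insert i s} ↔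
          r.erase i ∈ {r : ι →₀ α | r.support ⊆ s} := by
        simp only [Set.mem_ofPred_eq, Finsupp.support_erase, Finset.subset_insert_iff]
      by_cases h : r ∈ {r : ι →₀ α | r.support ⊆ insert i s}
      · rw [Set.indicator_of_mem h, Set.indicator_of_mem (h2.1 h), Finsupp.mul_prod_erase' _ _ _ hf]
      · rw [Set.indicator_of_notMem h, Set.indicator_of_notMem (fun h' => h (h2.2 h')), mul_zero]
    rw [tsum_congr h1, tsum_finsupp_erase i (fun a r =>
      f i a * {r : ι →₀ α | r.support ⊆ s}.indicator (fun r => r.prod f) r), ← ENNReal.tsum_mul_right]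
    refine tsum_congr fun a => ?_
    rw [← ENNReal.tsum_mul_left]
    refine tsum_congr fun r => ?_
    by_cases h : r.support ⊆ s
    · have : r i = 0 := by
        by_contra h0
        exact his (h (Finsupp.mem_support_iff.2 h0))
      simp [this]
    · have h' : r ∉ {r : ι →₀ α | r.support ⊆ s} := h
      simp only [Set.indicator_of_notMem h', mul_zero]
      simp [Set.indicator_apply, h]

/-- Terms are nonnegative, so the finite products increase with `s`. Any finite set of families is
supported in a common finite set, so their supremum exhausts the whole sum. -/
theorem tendsto_prod_tsum_finsupp {ι α : Type*} [Zero α] (f : ι → α → ℝ≥0∞)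
    (hf : ∀ i, f i 0 = 1) :
    Tendsto (fun s : Finset ι => ∏ i ∈ s, ∑' a, f i a) atTop
      (𝓝 (∑' r : ι →₀ α, r.prod f)) := by
  classical
  have hmono : Monotone fun s : Finset ι => ∏ i ∈ s, ∑' a, f i a := by
    intro s t hst
    simp only [prod_tsum_eq_tsum_finsupp f hf]
    refine ENNReal.tsum_le_tsum fun r => ?_
    exact Set.indicator_le_indicator_of_subset (fun r hr => hr.trans hst) (fun _ => zero_le) r
  convert tendsto_atTop_iSup hmono using 2
  refine le_antisymm ?_ (iSup_le fun s => ?_)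
  · rw [ENNReal.tsum_eq_iSup_sum]
    refine iSup_le fun t => ?_
    refine le_trans ?_ (le_iSup _ (t.biUnion fun r => r.support))
    rw [prod_tsum_eq_tsum_finsupp f hf]
    refine le_trans (le_of_eq ?_) (ENNReal.sum_le_tsum t)
    refine Finset.sum_congr rfl fun r hr => ?_
    rw [Set.indicator_of_mem]
    exact Finset.subset_biUnion_of_mem (fun r : ι →₀ α => r.support) hr
  · rw [prod_tsum_eq_tsum_finsupp f hf]
    exact ENNReal.tsum_le_tsum fun r => Set.indicator_le_self _ _ r

/-! ### Weights of clusters and of configurations -/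

/-- The weight of a multiset of parts with activities `c`. -/
def clusterWeight (c : ℕ+ → ℝ) (s : Multiset ℕ+) : ℝ :=
  ∏ j ∈ s.toFinset, (1 / ((s.count j)! : ℝ)) * c j ^ s.count j

/-- The sum of the parts of a multiset. -/
def clusterMass (s : Multiset ℕ+) : ℕ := (s.map fun j : ℕ+ => (j : ℕ)).sum

/-- The weight of a family of multisets of parts. -/
def configWeight {X : Type*} (c : X → ℕ+ → ℝ) (r : X →₀ Multiset ℕ+) : ℝ :=
  r.prod fun x s => clusterWeight (c x) s

/-- The sum of all parts of a family of multisets. -/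
def configMass {X : Type*} (r : X →₀ Multiset ℕ+) : ℕ := r.sum fun _ s => clusterMass s

@[simp] theorem clusterWeight_zero (c : ℕ+ → ℝ) : clusterWeight c 0 = 1 := by
  simp [clusterWeight]

@[simp] theorem clusterMass_zero : clusterMass 0 = 0 := by simp [clusterMass]

theorem clusterWeight_nonneg {c : ℕ+ → ℝ} (hc : ∀ j, 0 ≤ c j) (s : Multiset ℕ+) :
    0 ≤ clusterWeight c s :=
  Finset.prod_nonneg fun j _ => mul_nonneg (by positivity) (pow_nonneg (hc j) _)

theorem clusterWeight_pos {c : ℕ+ → ℝ} (hc : ∀ j, 0 < c j) (s : Multiset ℕ+) :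
    0 < clusterWeight c s :=
  Finset.prod_pos fun j _ => mul_pos (by positivity) (pow_pos (hc j) _)

theorem configWeight_pos {X : Type*} {c : X → ℕ+ → ℝ} (hc : ∀ x j, 0 < c x j)
    (r : X →₀ Multiset ℕ+) : 0 < configWeight c r :=
  Finset.prod_pos fun x _ => clusterWeight_pos (hc x) _

theorem clusterWeight_eq_prod_of_subset (c : ℕ+ → ℝ) {s : Multiset ℕ+} {T : Finset ℕ+}
    (h : s.toFinset ⊆ T) :
    clusterWeight c s = ∏ j ∈ T, (1 / ((s.count j)! : ℝ)) * c j ^ s.count j := by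
  refine Finset.prod_subset h fun j _ hj => ?_
  have : s.count j = 0 := by
    rw [Multiset.count_eq_zero]
    simpa using hj
  simp [this]

theorem clusterMass_eq_sum (s : Multiset ℕ+) :
    clusterMass s = ∑ j ∈ s.toFinset, s.count j * (j : ℕ) := by
  rw [clusterMass, Finset.sum_multiset_map_count]
  simp

theorem clusterWeight_pow_mul (c : ℕ+ → ℝ) (z : ℝ) (s : Multiset ℕ+) :
    clusterWeight (fun j => z ^ (j : ℕ) * c j) s = z ^ clusterMass s * clusterWeight c s := by
  rw [clusterMass_eq_sum, ← Finset.prod_pow_eq_pow_sum, clusterWeight, clusterWeight,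
    ← Finset.prod_mul_distrib]
  refine Finset.prod_congr rfl fun j _ => ?_
  rw [mul_pow, ← pow_mul, mul_comm (j : ℕ)]
  ring

theorem configWeight_pow_mul {X : Type*} (c : X → ℕ+ → ℝ) (z : ℝ) (r : X →₀ Multiset ℕ+) :
    configWeight (fun x j => z ^ (j : ℕ) * c x j) r = z ^ configMass r * configWeight c r := by
  simp only [configWeight, configMass, Finsupp.prod, Finsupp.sum, clusterWeight_pow_mul,
    Finset.prod_mul_distrib, Finset.prod_pow_eq_pow_sum]

theorem clusterWeight_of_eq_zero {c : ℕ+ → ℝ} (hc : ∀ j, c j = 0) {s : Multiset ℕ+} (hs : s ≠ 0) :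
    clusterWeight c s = 0 := by
  obtain ⟨j, hj⟩ := Multiset.exists_mem_of_ne_zero hs
  refine Finset.prod_eq_zero (Multiset.mem_toFinset.2 hj) ?_
  rw [hc, zero_pow (Multiset.count_pos.2 hj).ne', mul_zero]

/-- A multiset is its finitely supported multiplicity function, so the sum factors over part sizes
into exponential series. -/
theorem tsum_clusterWeight {c : ℕ+ → ℝ} (hc : ∀ j, 0 ≤ c j) (hs : Summable c) :
    ∑' s, ENNReal.ofReal (clusterWeight c s) = ENNReal.ofReal (Real.exp (∑' j, c j)) := by
  let f : ℕ+ → ℕ → ℝ≥0∞ := fun j k => ENNReal.ofReal ((1 / (k ! : ℝ)) * c j ^ k)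
  have h1 : ∑' s, ENNReal.ofReal (clusterWeight c s) = ∑' r : ℕ+ →₀ ℕ, r.prod f := by
    rw [← (Multiset.toFinsupp (α := ℕ+)).toEquiv.tsum_eq]
    refine tsum_congr fun s => ?_
    rw [clusterWeight, ENNReal.ofReal_prod_of_nonneg]
    · simp [Finsupp.prod, f]
    · exact fun j _ => mul_nonneg (by positivity) (pow_nonneg (hc j) _)
  have h2 : ∀ j, ∑' k, f j k = ENNReal.ofReal (Real.exp (c j)) := by
    intro j
    have := NormedSpace.expSeries_div_hasSum_exp (c j)
    rw [← Real.exp_eq_exp_ℝ] at this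
    rw [← this.tsum_eq, ENNReal.ofReal_tsum_of_nonneg (fun k => by have := hc j; positivity)
      this.summable]
    refine tsum_congr fun k => ?_
    simp only [f]
    congr 1
    ring
  have h3 := tendsto_prod_tsum_finsupp f (fun j => by simp [f])
  simp only [h2] at h3
  rw [h1]
  refine tendsto_nhds_unique h3 ?_
  have h4 : ∀ s : Finset ℕ+, ∏ i ∈ s, ENNReal.ofReal (Real.exp (c i)) =
      ENNReal.ofReal (Real.exp (∑ i ∈ s, c i)) := fun s => by
    rw [Real.exp_sum, ENNReal.ofReal_prod_of_nonneg fun _ _ => (Real.exp_pos _).le]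
  simp only [h4]
  exact (ENNReal.continuous_ofReal.comp Real.continuous_exp).continuousAt.tendsto.comp hs.hasSum

/-- The same factorisation once more, now over sites. -/
theorem tsum_configWeight {X : Type*} {c : X → ℕ+ → ℝ} (hc : ∀ x j, 0 ≤ c x j)
    (hs : Summable fun p : X × ℕ+ => c p.1 p.2) :
    ∑' r, ENNReal.ofReal (configWeight c r) =
      ENNReal.ofReal (Real.exp (∑' p : X × ℕ+, c p.1 p.2)) := by
  let f : X → Multiset ℕ+ → ℝ≥0∞ := fun x s => ENNReal.ofReal (clusterWeight (c x) s)
  have h1 : ∀ r, ENNReal.ofReal (configWeight c r) = r.prod f := fun r => by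
    rw [configWeight, Finsupp.prod, ENNReal.ofReal_prod_of_nonneg]
    · rfl
    · exact fun x _ => clusterWeight_nonneg (hc x) _
  have h2 : ∀ x, ∑' s, f x s = ENNReal.ofReal (Real.exp (∑' j, c x j)) := fun x =>
    tsum_clusterWeight (hc x) (hs.prod_factor x)
  have h3 := tendsto_prod_tsum_finsupp f (fun x => by simp [f])
  simp only [h2] at h3
  rw [tsum_congr h1]
  refine tendsto_nhds_unique h3 ?_
  have h4 : ∀ s : Finset X, ∏ x ∈ s, ENNReal.ofReal (Real.exp (∑' j, c x j)) =
      ENNReal.ofReal (Real.exp (∑ x ∈ s, ∑' j, c x j)) := fun s => by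
    rw [Real.exp_sum, ENNReal.ofReal_prod_of_nonneg fun _ _ => (Real.exp_pos _).le]
  simp only [h4]
  rw [hs.tsum_prod]
  exact (ENNReal.continuous_ofReal.comp Real.continuous_exp).continuousAt.tendsto.comp
    hs.prod.hasSum

/-! ### Coefficients -/

/-- The total weight of the multisets of mass `k`. -/
def clusterCoeff (c : ℕ+ → ℝ) (k : ℕ) : ℝ≥0∞ :=
  ∑' s, {s | clusterMass s = k}.indicator (fun s => ENNReal.ofReal (clusterWeight c s)) s

/-- The total weight of the configurations of mass `m`. -/
def configCoeff {X : Type*} (c : X → ℕ+ → ℝ) (m : ℕ) : ℝ≥0∞ :=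
  ∑' r, {r | configMass r = m}.indicator (fun r => ENNReal.ofReal (configWeight c r)) r

/-- Sorting by the value of `m`. This turns sums over configurations into generating series of their
coefficients. -/
theorem tsum_fiber_mul {α : Type*} (m : α → ℕ) (w : α → ℝ≥0∞) (F : ℕ → ℝ≥0∞) :
    ∑' k, (∑' a, {a | m a = k}.indicator w a) * F k = ∑' a, w a * F (m a) := by
  simp only [← ENNReal.tsum_mul_right]
  rw [ENNReal.tsum_comm]
  refine tsum_congr fun a => ?_
  rw [tsum_eq_single (m a)]
  · simp
  · intro k hk
    simp [hk.symm]

theorem tsum_clusterCoeff {c : ℕ+ → ℝ} (hc : ∀ j, 0 ≤ c j) (hs : Summable c) :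
    ∑' k, clusterCoeff c k = ENNReal.ofReal (Real.exp (∑' j, c j)) := by
  have := tsum_fiber_mul clusterMass (fun s => ENNReal.ofReal (clusterWeight c s)) 1
  simp only [Pi.one_apply, mul_one] at this
  rw [← tsum_clusterWeight hc hs, ← this]
  rfl

theorem tsum_configCoeff_mul_pow {X : Type*} {c : X → ℕ+ → ℝ} (hc : ∀ x j, 0 ≤ c x j) {z : ℝ}
    (hz : 0 ≤ z) (hs : Summable fun p : X × ℕ+ => z ^ (p.2 : ℕ) * c p.1 p.2) :
    ∑' m, configCoeff c m * ENNReal.ofReal (z ^ m) =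
      ENNReal.ofReal (Real.exp (∑' p : X × ℕ+, z ^ (p.2 : ℕ) * c p.1 p.2)) := by
  have := tsum_fiber_mul configMass (fun s => ENNReal.ofReal (configWeight c s))
    (fun m => ENNReal.ofReal (z ^ m))
  rw [← tsum_configWeight (c := fun x j => z ^ (j : ℕ) * c x j)
    (fun x j => mul_nonneg (pow_nonneg hz _) (hc x j)) hs]
  simp only [configCoeff, this]
  refine tsum_congr fun r => ?_
  rw [configWeight_pow_mul, ENNReal.ofReal_mul (pow_nonneg hz _), mul_comm]

/-- An extra part `j` raises both the power of `c j` and the factorial argument by one, and the new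
factor of the factorial is the old multiplicity plus one. -/
theorem clusterWeight_cons (c : ℕ+ → ℝ) (j : ℕ+) (s : Multiset ℕ+) :
    ((s.count j : ℝ) + 1) * clusterWeight c (j ::ₘ s) = c j * clusterWeight c s := by
  classical
  have hj : j ∈ insert j s.toFinset := Finset.mem_insert_self _ _
  rw [clusterWeight_eq_prod_of_subset c (T := insert j s.toFinset) (s := j ::ₘ s)
      (by simp), clusterWeight_eq_prod_of_subset c (T := insert j s.toFinset)
      (Finset.subset_insert _ _), ← Finset.mul_prod_erase _ _ hj, ← Finset.mul_prod_erase _ _ hj]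
  have h1 : ∀ i ∈ (insert j s.toFinset).erase j,
      (1 / (((j ::ₘ s).count i)! : ℝ)) * c i ^ (j ::ₘ s).count i =
        (1 / ((s.count i)! : ℝ)) * c i ^ s.count i := by
    intro i hi
    rw [Multiset.count_cons_of_ne (Finset.ne_of_mem_erase hi)]
  rw [Finset.prod_congr rfl h1, Multiset.count_cons_self, Nat.factorial_succ, pow_succ]
  have : ((s.count j)! : ℝ) ≠ 0 := by positivity
  have : (s.count j : ℝ) + 1 ≠ 0 := by positivity
  push_cast
  field_simp

/-- The recursion for the coefficients of the exponential of a power series. -/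
theorem mul_clusterCoeff {c : ℕ+ → ℝ} (hc : ∀ j, 0 ≤ c j) (k : ℕ) :
    (k : ℝ≥0∞) * clusterCoeff c k =
      ∑' j : ℕ+, ENNReal.ofReal ((j : ℕ) * c j) *
        if (j : ℕ) ≤ k then clusterCoeff c (k - j) else 0 := by
  classical
  -- The mass `k` of a multiset is written as the sum of `j` times the multiplicity of `j`.
  have h1 : (k : ℝ≥0∞) * clusterCoeff c k = ∑' s, ∑' j : ℕ+, ((j : ℕ) : ℝ≥0∞) * (s.count j *
      {s | clusterMass s = k}.indicator (fun s => ENNReal.ofReal (clusterWeight c s)) s) := by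
    rw [clusterCoeff, ← ENNReal.tsum_mul_left]
    refine tsum_congr fun s => ?_
    simp_rw [← mul_assoc, ENNReal.tsum_mul_right]
    by_cases h : clusterMass s = k
    · congr 1
      rw [tsum_eq_sum (s := s.toFinset)]
      · rw [← h, clusterMass_eq_sum]
        push_cast
        exact Finset.sum_congr rfl fun _ _ => mul_comm _ _
      · intro j hj
        rw [Multiset.count_eq_zero.2 (by simpa using hj)]
        simp
    · simp [h]
  rw [h1, ENNReal.tsum_comm]
  refine tsum_congr fun j => ?_
  rw [ENNReal.tsum_mul_left]
  -- Multisets without a part `j` contribute 0; the others are exactly those obtained by adding one.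
  have h2 : ∑' s : Multiset ℕ+, ((s.count j : ℝ≥0∞) *
      {s | clusterMass s = k}.indicator (fun s => ENNReal.ofReal (clusterWeight c s)) s) =
      ∑' s : Multiset ℕ+, (((j ::ₘ s).count j : ℝ≥0∞) *
      {s | clusterMass s = k}.indicator (fun s => ENNReal.ofReal (clusterWeight c s))
        (j ::ₘ s)) := by
    symm
    refine Function.Injective.tsum_eq (g := fun s : Multiset ℕ+ => j ::ₘ s)
      (f := fun s : Multiset ℕ+ => ((s.count j : ℝ≥0∞) *
      {s | clusterMass s = k}.indicator (fun s => ENNReal.ofReal (clusterWeight c s)) s))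
      (fun s t h => (Multiset.cons_inj_right j).1 h) ?_
    intro s hs
    have : s.count j ≠ 0 := by
      rintro h0
      simp [h0] at hs
    exact ⟨s.erase j, Multiset.cons_erase (Multiset.count_ne_zero.1 this)⟩
  rw [h2, ENNReal.ofReal_mul (Nat.cast_nonneg _), ENNReal.ofReal_natCast, mul_assoc]
  congr 1
  have hm : ∀ s, clusterMass (j ::ₘ s) = j + clusterMass s := fun s => by simp [clusterMass]
  have h3 : ∀ s : Multiset ℕ+, (((j ::ₘ s).count j : ℝ≥0∞) *
      {s | clusterMass s = k}.indicator (fun s => ENNReal.ofReal (clusterWeight c s))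
        (j ::ₘ s)) = ENNReal.ofReal (c j) * {s | clusterMass (j ::ₘ s) = k}.indicator
          (fun s => ENNReal.ofReal (clusterWeight c s)) s := by
    intro s
    by_cases h : clusterMass (j ::ₘ s) = k
    · rw [Set.indicator_of_mem (show (j ::ₘ s) ∈ {s | clusterMass s = k} from h),
        Set.indicator_of_mem (show s ∈ {s | clusterMass (j ::ₘ s) = k} from h),
        ← ENNReal.ofReal_mul (hc j), ← clusterWeight_cons, Multiset.count_cons_self,
        ENNReal.ofReal_mul (by positivity)]
      congr 1
      rw [← ENNReal.ofReal_natCast]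
      push_cast
      rfl
    · rw [Set.indicator_of_notMem (show (j ::ₘ s) ∉ {s | clusterMass s = k} from h),
        Set.indicator_of_notMem (show s ∉ {s | clusterMass (j ::ₘ s) = k} from h)]
      simp
  rw [tsum_congr h3, ENNReal.tsum_mul_left]
  congr 1
  split_ifs with hjk
  · rw [clusterCoeff]
    congr 1
    ext s
    congr 2
    ext s
    simp only [hm]
    omega
  · rw [ENNReal.tsum_eq_zero]
    intro s
    rw [Set.indicator_of_notMem]
    simp only [Set.mem_ofPred_eq, hm]
    omega

/-! ### Splitting off one site -/

/-- Switching off the activities at one site. -/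
def offSite {X : Type*} [DecidableEq X] (o : X) (c : X → ℕ+ → ℝ) : X → ℕ+ → ℝ :=
  fun x j => if x = o then 0 else c x j

theorem configWeight_split {X : Type*} [DecidableEq X] (o : X) (c : X → ℕ+ → ℝ)
    (r : X →₀ Multiset ℕ+) :
    configWeight c r = clusterWeight (c o) (r o) * configWeight c (r.erase o) :=
  (Finsupp.mul_prod_erase' _ _ _ fun _ => clusterWeight_zero _).symm

theorem configMass_split {X : Type*} [DecidableEq X] (o : X) (r : X →₀ Multiset ℕ+) :
    configMass r = clusterMass (r o) + configMass (r.erase o) :=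
  (Finsupp.add_sum_erase' _ _ _ fun _ => clusterMass_zero).symm

/-- Zero activity at `o` kills every configuration with a part there and leaves the others
untouched. -/
theorem configWeight_offSite {X : Type*} [DecidableEq X] (o : X) (c : X → ℕ+ → ℝ)
    (r : X →₀ Multiset ℕ+) :
    ENNReal.ofReal (configWeight (offSite o c) r) =
      {r : X →₀ Multiset ℕ+ | r o = 0}.indicator
        (fun r => ENNReal.ofReal (configWeight c r)) r := by
  by_cases h : r o = 0
  · rw [Set.indicator_of_mem (show r ∈ {r : X →₀ Multiset ℕ+ | r o = 0} from h)]
    congr 1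
    refine Finset.prod_congr rfl fun x hx => ?_
    have hxo : x ≠ o := by
      rintro rfl
      exact Finsupp.mem_support_iff.1 hx h
    have : offSite o c x = c x := by
      ext j
      simp [offSite, hxo]
    simp only [this]
  · rw [Set.indicator_of_notMem (show r ∉ {r : X →₀ Multiset ℕ+ | r o = 0} from h),
      configWeight_split o, clusterWeight_of_eq_zero (by simp [offSite]) h]
    simp

/-- A configuration is a free choice of a cluster at `o` and of a configuration empty at `o`, and
the weight is the product of the two. -/
theorem tsum_configWeight_split {X : Type*} [DecidableEq X] (o : X) {c : X → ℕ+ → ℝ}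
    (hc : ∀ x j, 0 ≤ c x j) (k m : ℕ) :
    ∑' r : X →₀ Multiset ℕ+, {r : X →₀ Multiset ℕ+ | clusterMass (r o) = k ∧
      configMass (r.erase o) = m}.indicator (fun r => ENNReal.ofReal (configWeight c r)) r =
      clusterCoeff (c o) k * configCoeff (offSite o c) m := by
  let F : Multiset ℕ+ → (X →₀ Multiset ℕ+) → ℝ≥0∞ := fun s r =>
    {s | clusterMass s = k}.indicator (fun s => ENNReal.ofReal (clusterWeight (c o) s)) s *
    {r | configMass r = m}.indicator (fun r => ENNReal.ofReal (configWeight c r)) r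
  have h1 : ∀ r : X →₀ Multiset ℕ+, {r : X →₀ Multiset ℕ+ | clusterMass (r o) = k ∧
      configMass (r.erase o) = m}.indicator (fun r => ENNReal.ofReal (configWeight c r)) r =
      F (r o) (r.erase o) := by
    intro r
    by_cases h : clusterMass (r o) = k
    · by_cases h' : configMass (r.erase o) = m
      · simp only [F, Set.indicator_apply, Set.mem_ofPred_eq, h, h', and_self, if_true]
        rw [configWeight_split o, ENNReal.ofReal_mul (clusterWeight_nonneg (hc o) _)]
      · simp [F, h']
    · simp [F, h]
  rw [tsum_congr h1, tsum_finsupp_erase o F, clusterCoeff, ← ENNReal.tsum_mul_right]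
  refine tsum_congr fun s => ?_
  rw [configCoeff, ← ENNReal.tsum_mul_left]
  refine tsum_congr fun r => ?_
  simp only [configWeight_offSite, F, Set.indicator_apply, Set.mem_ofPred_eq]
  split_ifs <;> simp

/-! ### One-sided moment generating functions -/

/-- A finite measure on the line is determined by its moment generating function on `(0, ∞)`. -/
theorem measure_ext_of_mgf_pos {μ ν : Measure ℝ} [IsFiniteMeasure μ] [IsFiniteMeasure ν]
    (hμ : ∀ t : ℝ, 0 < t → Integrable (fun x => Real.exp (t * x)) μ)
    (hν : ∀ t : ℝ, 0 < t → Integrable (fun x => Real.exp (t * x)) ν)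
    (h : ∀ t : ℝ, 0 < t → ∫ x, Real.exp (t * x) ∂μ = ∫ x, Real.exp (t * x) ∂ν) : μ = ν := by
  have hsub : ∀ {κ : Measure ℝ}, (∀ t : ℝ, 0 < t → Integrable (fun x => Real.exp (t * x)) κ) →
      {z : ℂ | 0 < z.re} ⊆ {z : ℂ | z.re ∈ interior (integrableExpSet id κ)} := by
    intro κ hκ z hz
    have : Set.Ioi (0 : ℝ) ⊆ interior (integrableExpSet id κ) :=
      interior_maximal (fun t ht => hκ t ht) isOpen_Ioi
    exact this hz
  have hconv : IsPreconnected {z : ℂ | 0 < z.re} :=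
    (convex_halfSpace_re_gt 0).isPreconnected
  -- The points 1 + 1/(n+1) accumulate at 1, which is all the identity theorem needs on the
  -- connected half-plane Re z > 0.
  have hfreq : ∃ᶠ z in 𝓝[≠] (1 : ℂ), complexMGF id μ z = complexMGF id ν z := by
    have h1 : Tendsto (fun n : ℕ => ((1 + 1 / ((n : ℝ) + 1) : ℝ) : ℂ)) atTop (𝓝[≠] (1 : ℂ)) := by
      refine tendsto_nhdsWithin_iff.2 ⟨?_, Eventually.of_forall fun n => ?_⟩
      · have h2 : Tendsto (fun n : ℕ => (1 + 1 / ((n : ℝ) + 1) : ℝ)) atTop (𝓝 (1 + 0)) :=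
          tendsto_const_nhds.add tendsto_one_div_add_atTop_nhds_zero_nat
        rw [add_zero] at h2
        have h3 := (Complex.continuous_ofReal.tendsto 1).comp h2
        simpa only [Complex.ofReal_one, Function.comp_def] using h3
      · have : (0 : ℝ) < 1 / ((n : ℝ) + 1) := by positivity
        intro h0
        have h0 : ((1 + 1 / ((n : ℝ) + 1) : ℝ) : ℂ) = ((1 : ℝ) : ℂ) := by simpa using h0
        have := Complex.ofReal_injective h0
        linarith
    refine h1.frequently (Frequently.of_forall fun n => ?_)
    rw [complexMGF_ofReal, complexMGF_ofReal]
    exact congrArg _ (h _ (by positivity))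
  have heq := (analyticOnNhd_complexMGF.mono (hsub hμ)).eqOn_of_preconnected_of_frequently_eq
    (analyticOnNhd_complexMGF.mono (hsub hν)) hconv (z₀ := 1) (by simp) hfreq
  -- Tilting by exp(x) turns the transform on the line Re z = 1 into a characteristic function,
  -- although the imaginary axis itself is out of reach. The tilt is undone at the end.
  let g : ℝ → ℝ≥0∞ := fun x => ENNReal.ofReal (Real.exp x)
  have hg : Measurable g := by fun_prop
  have hfin : ∀ {κ : Measure ℝ}, (∀ t : ℝ, 0 < t → Integrable (fun x => Real.exp (t * x)) κ) →
      IsFiniteMeasure (κ.withDensity g) := by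
    intro κ hκ
    refine isFiniteMeasure_withDensity_ofReal ?_
    simpa using (hκ 1 one_pos).2
  have hchar : ∀ (κ : Measure ℝ) (t : ℝ), charFun (κ.withDensity g) t =
      complexMGF id κ (1 + t * Complex.I) := by
    intro κ t
    rw [charFun_apply_real, integral_withDensity_eq_integral_toReal_smul hg
      (ae_of_all _ fun _ => ENNReal.ofReal_lt_top), complexMGF]
    refine integral_congr_ae (ae_of_all _ fun x => ?_)
    simp only [g, ENNReal.toReal_ofReal (Real.exp_pos x).le, id, Complex.real_smul,
      Complex.ofReal_exp, ← Complex.exp_add]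
    congr 1
    ring
  have := hfin hμ
  have := hfin hν
  have h1 : μ.withDensity g = ν.withDensity g := by
    refine Measure.ext_of_charFun (funext fun t => ?_)
    rw [hchar, hchar]
    exact heq (by simp)
  have hinv : ∀ κ : Measure ℝ, (κ.withDensity g).withDensity (fun x => (g x)⁻¹) = κ := fun κ =>
    withDensity_inv_same hg (ae_of_all _ fun x => by simp [g, Real.exp_pos])
      (ae_of_all _ fun _ => ENNReal.ofReal_ne_top)
  rw [← hinv μ, h1, hinv ν]

/-- Moment generating functions pass to weak limits. -/
theorem mgf_of_tendsto {ι : Type*} {l : Filter ι} [l.NeBot] {μ : ι → ProbabilityMeasure ℝ}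
    {ν : ProbabilityMeasure ℝ} (hν : Tendsto μ l (𝓝 ν)) {Φ : ℝ → ℝ}
    (hint : ∀ i (t : ℝ), 0 ≤ t → Integrable (fun x => Real.exp (t * x)) (μ i : Measure ℝ))
    (hlim : ∀ t : ℝ, 0 ≤ t →
      Tendsto (fun i => ∫ x, Real.exp (t * x) ∂(μ i : Measure ℝ)) l (𝓝 (Φ t)))
    {t : ℝ} (ht : 0 ≤ t) :
    Integrable (fun x => Real.exp (t * x)) (ν : Measure ℝ) ∧
      ∫ x, Real.exp (t * x) ∂(ν : Measure ℝ) = Φ t := by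
  rw [ProbabilityMeasure.tendsto_iff_forall_integral_tendsto] at hν
  have hb : ∀ (R : ℕ) (x : ℝ), ‖min (Real.exp (t * x)) (R : ℝ)‖ ≤ R := fun R x => by
    rw [Real.norm_of_nonneg (le_min (Real.exp_pos _).le (Nat.cast_nonneg _))]
    exact min_le_right _ _
  -- Weak convergence sees only bounded functions, so exp(tx) is cut off at height `R`.
  let g : ℕ → BoundedContinuousFunction ℝ ℝ := fun R =>
    BoundedContinuousFunction.ofNormedAddCommGroup (fun x => min (Real.exp (t * x)) (R : ℝ))
      (by fun_prop) R (hb R)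
  have hg : ∀ R x, g R x = min (Real.exp (t * x)) (R : ℝ) := fun R x => rfl
  have hg0 : ∀ R x, 0 ≤ g R x := fun R x => le_min (Real.exp_pos _).le (Nat.cast_nonneg _)
  have hgint : ∀ R (κ : ProbabilityMeasure ℝ), Integrable (g R) (κ : Measure ℝ) := fun R κ =>
    (g R).integrable _
  have hle : ∀ R, ∫ x, g R x ∂(ν : Measure ℝ) ≤ Φ t := fun R =>
    le_of_tendsto_of_tendsto' (hν (g R)) (hlim t ht) fun i =>
      integral_mono (hgint R _) (hint i t ht) fun x => min_le_left _ _
  have hΦ0 : 0 ≤ Φ t := ge_of_tendsto' (hlim t ht) fun i =>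
    integral_nonneg fun x => (Real.exp_pos _).le
  have hlint : ∫⁻ x, ENNReal.ofReal (Real.exp (t * x)) ∂(ν : Measure ℝ) ≤ ENNReal.ofReal (Φ t) := by
    have h1 : Tendsto (fun R : ℕ => ∫⁻ x, ENNReal.ofReal (g R x) ∂(ν : Measure ℝ)) atTop
        (𝓝 (∫⁻ x, ENNReal.ofReal (Real.exp (t * x)) ∂(ν : Measure ℝ))) := by
      refine lintegral_tendsto_of_tendsto_of_monotone
        (fun R => ((g R).continuous.measurable.ennreal_ofReal).aemeasurable)
        (ae_of_all _ fun x R S hRS => ?_) (ae_of_all _ fun x => ?_)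
      · refine ENNReal.ofReal_le_ofReal ?_
        simp only [hg]
        exact min_le_min_left _ (by exact_mod_cast hRS)
      · refine (ENNReal.continuous_ofReal.tendsto _).comp (tendsto_const_nhds.congr' ?_)
        obtain ⟨R, hR⟩ := exists_nat_ge (Real.exp (t * x))
        filter_upwards [eventually_ge_atTop R] with S hS
        rw [hg, min_eq_left]
        exact hR.trans (by exact_mod_cast hS)
    refine le_of_tendsto' h1 fun R => ?_
    rw [← ofReal_integral_eq_lintegral_ofReal (hgint R ν) (ae_of_all _ (hg0 R))]
    exact ENNReal.ofReal_le_ofReal (hle R)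
  have hνint : Integrable (fun x => Real.exp (t * x)) (ν : Measure ℝ) := by
    refine ⟨by fun_prop, ?_⟩
    rw [hasFiniteIntegral_iff_ofReal (ae_of_all _ fun x => (Real.exp_pos _).le)]
    exact hlint.trans_lt ENNReal.ofReal_lt_top
  refine ⟨hνint, le_antisymm ?_ ?_⟩
  · rw [integral_eq_lintegral_of_nonneg_ae (ae_of_all _ fun x => (Real.exp_pos _).le) (by fun_prop)]
    exact ENNReal.toReal_le_of_le_ofReal hΦ0 hlint
  -- The cut costs at most exp(2tx)/R, whose integral is bounded along the family: this is uniform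
  -- integrability.
  · have h2 : ∀ R : ℕ, 0 < R → Φ t ≤ ∫ x, Real.exp (t * x) ∂(ν : Measure ℝ) + Φ (2 * t) / R := by
      intro R hR
      have h3 : Φ t ≤ ∫ x, g R x ∂(ν : Measure ℝ) + Φ (2 * t) / R := by
        refine le_of_tendsto_of_tendsto' (hlim t ht)
          ((hν (g R)).add ((hlim (2 * t) (by linarith)).div_const (R : ℝ))) fun i => ?_
        rw [← integral_div, ← integral_add (hgint R _) ((hint i (2 * t) (by linarith)).div_const _)]
        refine integral_mono (hint i t ht)
          ((hgint R _).add ((hint i (2 * t) (by linarith)).div_const _)) fun x => ?_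
        have hR' : (0 : ℝ) < R := by exact_mod_cast hR
        have hE := Real.exp_pos (t * x)
        have h4 : Real.exp (2 * t * x) = Real.exp (t * x) * Real.exp (t * x) := by
          rw [← Real.exp_add]; ring_nf
        simp only [hg, h4]
        rcases le_total (Real.exp (t * x)) R with h5 | h5
        · rw [min_eq_left h5]
          have : 0 ≤ Real.exp (t * x) * Real.exp (t * x) / R := by positivity
          linarith
        · rw [min_eq_right h5]
          have : Real.exp (t * x) ≤ Real.exp (t * x) * Real.exp (t * x) / R := by
            rw [le_div_iff₀ hR']
            exact mul_le_mul_of_nonneg_left h5 hE.le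
          linarith
      refine h3.trans (add_le_add_left ?_ _)
      exact integral_mono (hgint R _) hνint fun x => min_le_left _ _
    have h6 : Tendsto (fun R : ℕ => ∫ x, Real.exp (t * x) ∂(ν : Measure ℝ) + Φ (2 * t) / R) atTop
        (𝓝 (∫ x, Real.exp (t * x) ∂(ν : Measure ℝ) + 0)) :=
      tendsto_const_nhds.add (tendsto_const_div_atTop_nhds_zero_nat _)
    rw [add_zero] at h6
    exact ge_of_tendsto h6 ((eventually_gt_atTop 0).mono h2)

/-- A family of laws with bounded moment generating functions that are at least `1` is tight. -/
theorem isTight_of_mgf {ι : Type*} {μ : ι → ProbabilityMeasure ℝ}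
    (hint : ∀ i (t : ℝ), 0 ≤ t → Integrable (fun x => Real.exp (t * x)) (μ i : Measure ℝ))
    (hone : ∀ i (t : ℝ), 0 ≤ t → 1 ≤ ∫ x, Real.exp (t * x) ∂(μ i : Measure ℝ))
    {C : ℝ} (hC : ∀ i, ∫ x, Real.exp (2 * x) ∂(μ i : Measure ℝ) ≤ C) :
    IsTightMeasureSet {(μ i : Measure ℝ) | i} := by
  rw [isTightMeasureSet_iff_exists_isCompact_measure_compl_le]
  intro ε hε
  have key : ∀ i (t : ℝ), 0 < t → t ≤ 1 →
      (μ i : Measure ℝ).real (Set.Icc (-t⁻¹) t⁻¹)ᶜ ≤ 2 * (t * C) + t * C := by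
    intro i t ht ht1
    have hfin : IsProbabilityMeasure (μ i : Measure ℝ) := inferInstance
    have hm : MeasurableSet (Set.Icc (-t⁻¹) t⁻¹)ᶜ := measurableSet_Icc.compl
    have hI2 := hint i 2 (by norm_num)
    have hIt := hint i t ht.le
    -- The bracket is nonnegative for every x. If x < -1/t then exp(tx) ≤ 1/2 and the first term is
    -- at least 1; if x > 1/t then t exp(2x) is at least 1.
    have hpt : ∀ x : ℝ, (Set.Icc (-t⁻¹) t⁻¹)ᶜ.indicator (fun _ => (1 : ℝ)) x ≤
        2 * (1 - Real.exp (t * x) + t * Real.exp (2 * x)) + t * Real.exp (2 * x) := by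
      intro x
      have hA : 0 ≤ 1 - Real.exp (t * x) + t * Real.exp (2 * x) := by
        rcases le_total x 0 with hx | hx
        · have : Real.exp (t * x) ≤ 1 := Real.exp_le_one_iff.2 (by nlinarith)
          have := Real.exp_pos (2 * x)
          nlinarith
        · have h1 : 1 - t * x ≤ Real.exp (-(t * x)) := by
            have := Real.add_one_le_exp (-(t * x)); linarith
          have h2 : Real.exp (t * x) * Real.exp (-(t * x)) = 1 := by
            rw [← Real.exp_add]; simp
          have h3 : Real.exp (t * x) - 1 ≤ t * (x * Real.exp (t * x)) := by
            have := Real.exp_pos (t * x)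
            nlinarith
          have h4 : Real.exp (t * x) ≤ Real.exp x := Real.exp_le_exp.2 (by nlinarith)
          have h5 : x ≤ Real.exp x := by linarith [Real.add_one_le_exp x]
          have h6 : Real.exp (2 * x) = Real.exp x * Real.exp x := by
            rw [← Real.exp_add]; ring_nf
          have h7 : x * Real.exp (t * x) ≤ Real.exp (2 * x) := by
            rw [h6]
            exact mul_le_mul h5 h4 (Real.exp_pos _).le (Real.exp_pos _).le
          have := mul_le_mul_of_nonneg_left h7 ht.le
          linarith
      have hB : 0 ≤ t * Real.exp (2 * x) := by positivity
      by_cases hx : x ∈ Set.Icc (-t⁻¹) t⁻¹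
      · rw [Set.indicator_of_notMem (show x ∉ (Set.Icc (-t⁻¹) t⁻¹)ᶜ from not_not.2 hx)]
        linarith
      · rw [Set.indicator_of_mem (show x ∈ (Set.Icc (-t⁻¹) t⁻¹)ᶜ from hx)]
        rw [Set.mem_Icc, not_and_or, not_le, not_le] at hx
        have htt : t * t⁻¹ = 1 := mul_inv_cancel₀ ht.ne'
        rcases hx with hx | hx
        · have h1 : Real.exp (t * x) ≤ Real.exp (-1) := Real.exp_le_exp.2 (by nlinarith)
          have h2 : Real.exp (-1) ≤ 1 / 2 := by
            rw [Real.exp_neg, inv_eq_one_div]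
            have := Real.add_one_le_exp 1
            exact one_div_le_one_div_of_le (by norm_num) (by linarith)
          linarith
        · have h1 : t⁻¹ ≤ Real.exp (2 * x) := by
            have := Real.add_one_le_exp (2 * x)
            have : 0 < t⁻¹ := by positivity
            linarith
          have h2 := mul_le_mul_of_nonneg_left h1 ht.le
          linarith
    have h1 : ∫ x, (Set.Icc (-t⁻¹) t⁻¹)ᶜ.indicator (fun _ => (1 : ℝ)) x ∂(μ i : Measure ℝ) ≤
        ∫ x, (2 * (1 - Real.exp (t * x) + t * Real.exp (2 * x)) + t * Real.exp (2 * x))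
          ∂(μ i : Measure ℝ) := by
      refine integral_mono ((integrable_const _).indicator hm) ?_ hpt
      exact ((((integrable_const _).sub hIt).add (hI2.const_mul t)).const_mul 2).add
        (hI2.const_mul t)
    have hI0 : Integrable (fun x => 1 - Real.exp (t * x)) (μ i : Measure ℝ) :=
      (integrable_const 1).sub hIt
    have hI1 : Integrable (fun x => 2 * (1 - Real.exp (t * x) + t * Real.exp (2 * x)))
        (μ i : Measure ℝ) := (hI0.add (hI2.const_mul t)).const_mul 2
    rw [integral_indicator_const _ hm, smul_eq_mul, mul_one, integral_add hI1 (hI2.const_mul t),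
      integral_const_mul, integral_add hI0 (hI2.const_mul t),
      integral_sub (integrable_const _) hIt, integral_const_mul] at h1
    -- The lower bound 1 on the transform is what discards the integral of 1 - exp(tx), and with it
    -- the mass near -∞.
    have h2 := hone i t ht.le
    have h3 := mul_le_mul_of_nonneg_left (hC i) ht.le
    simp only [integral_const, probReal_univ, smul_eq_mul, mul_one] at h1
    linarith
  obtain ⟨ε', hε'0, hε'⟩ : ∃ ε' : ℝ, 0 < ε' ∧ ENNReal.ofReal ε' ≤ ε := by
    rcases eq_or_ne ε ∞ with rfl | h
    · exact ⟨1, one_pos, le_top⟩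
    · exact ⟨ε.toReal, ENNReal.toReal_pos hε.ne' h, by rw [ENNReal.ofReal_toReal h]⟩
  let t : ℝ := min 1 (ε' / (3 * (|C| + 1)))
  have hC0 : 0 ≤ |C| := abs_nonneg C
  have ht : 0 < t := lt_min one_pos (by positivity)
  refine ⟨Set.Icc (-t⁻¹) t⁻¹, isCompact_Icc, ?_⟩
  rintro _ ⟨i, rfl⟩
  refine le_trans ?_ hε'
  rw [← ENNReal.ofReal_toReal (measure_ne_top (μ i : Measure ℝ) _)]
  refine ENNReal.ofReal_le_ofReal ((key i t ht (min_le_left _ _)).trans ?_)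
  have h1 : t * (3 * (|C| + 1)) ≤ ε' := by
    rw [← le_div_iff₀ (by positivity)]
    exact min_le_right _ _
  have h2 : t * C ≤ t * (|C| + 1) :=
    mul_le_mul_of_nonneg_left (by linarith [le_abs_self C]) ht.le
  linarith

/-- Continuity theorem for moment generating functions on `[0, ∞)`: existence of the limit. -/
theorem exists_limit_of_mgf {μ : ℕ → ProbabilityMeasure ℝ} {Φ : ℝ → ℝ}
    (hint : ∀ i (t : ℝ), 0 ≤ t → Integrable (fun x => Real.exp (t * x)) (μ i : Measure ℝ))
    (hone : ∀ i (t : ℝ), 0 ≤ t → 1 ≤ ∫ x, Real.exp (t * x) ∂(μ i : Measure ℝ))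
    (hlim : ∀ t : ℝ, 0 ≤ t →
      Tendsto (fun i => ∫ x, Real.exp (t * x) ∂(μ i : Measure ℝ)) atTop (𝓝 (Φ t))) :
    ∃ ν : ProbabilityMeasure ℝ, ∀ t : ℝ, 0 ≤ t →
      Integrable (fun x => Real.exp (t * x)) (ν : Measure ℝ) ∧
        ∫ x, Real.exp (t * x) ∂(ν : Measure ℝ) = Φ t := by
  obtain ⟨C, hC⟩ := (hlim 2 (by norm_num)).bddAbove_range
  have htight := isTight_of_mgf hint hone (C := C) fun i => hC ⟨i, rfl⟩
  have hcomp : IsCompact (closure {μ n | n}) :=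
    isCompact_closure_of_isTightMeasureSet (by simpa using htight)
  -- An ultrafilter finer than `atTop` plays the role of a convergent subsequence.
  let U : Ultrafilter ℕ := Ultrafilter.of atTop
  have hU : (U : Filter ℕ) ≤ atTop := Ultrafilter.of_le atTop
  obtain ⟨ν, -, hν : Tendsto _ _ _⟩ := hcomp.ultrafilter_le_nhds (U.map μ)
    (.trans (by simp) (monotone_principal subset_closure))
  exact ⟨ν, fun t ht => mgf_of_tendsto hν hint (fun t ht => (hlim t ht).mono_left hU) ht⟩

/-- Continuity theorem for moment generating functions on `[0, ∞)`: convergence. -/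
theorem tendsto_of_mgf {μ : ℕ → ProbabilityMeasure ℝ} {Φ : ℝ → ℝ}
    (hint : ∀ i (t : ℝ), 0 ≤ t → Integrable (fun x => Real.exp (t * x)) (μ i : Measure ℝ))
    (hone : ∀ i (t : ℝ), 0 ≤ t → 1 ≤ ∫ x, Real.exp (t * x) ∂(μ i : Measure ℝ))
    (hlim : ∀ t : ℝ, 0 ≤ t →
      Tendsto (fun i => ∫ x, Real.exp (t * x) ∂(μ i : Measure ℝ)) atTop (𝓝 (Φ t)))
    {ν : ProbabilityMeasure ℝ} (hν : ∀ t : ℝ, 0 ≤ t →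
      Integrable (fun x => Real.exp (t * x)) (ν : Measure ℝ) ∧
        ∫ x, Real.exp (t * x) ∂(ν : Measure ℝ) = Φ t) :
    Tendsto μ atTop (𝓝 ν) := by
  obtain ⟨C, hC⟩ := (hlim 2 (by norm_num)).bddAbove_range
  have htight := isTight_of_mgf hint hone (C := C) fun i => hC ⟨i, rfl⟩
  have hcomp : IsCompact (closure {μ n | n}) :=
    isCompact_closure_of_isTightMeasureSet (by simpa using htight)
  -- Every ultrafilter limit has the transform `Φ`, hence is `ν`; by compactness the sequence itself
  -- converges.
  refine (Filter.tendsto_iff_ultrafilter _ _ _).2 fun U hU => ?_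
  obtain ⟨ν', -, hν' : Tendsto _ _ _⟩ := hcomp.ultrafilter_le_nhds (U.map μ)
    (.trans (by simp) (monotone_principal subset_closure))
  have h1 := fun (t : ℝ) (ht : 0 ≤ t) =>
    mgf_of_tendsto hν' hint (fun t ht => (hlim t ht).mono_left hU) ht
  have h2 : (ν' : Measure ℝ) = ν := measure_ext_of_mgf_pos (fun t ht => (h1 t ht.le).1)
    (fun t ht => (hν t ht.le).1) fun t ht => (h1 t ht.le).2.trans (hν t ht.le).2.symm
  have h3 : ν' = ν := Subtype.ext h2
  rw [← h3]
  exact hν'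

/-- The laws with moment generating function `exp (b t ^ p)` on `[0, ∞)` are stable. -/
theorem isStableLaw_of_hasStableLaplace {ζ : Measure ℝ} [IsProbabilityMeasure ζ] {b p : ℝ}
    (hb : 0 < b) (hp : 1 < p) (h : HasStableLaplace ζ b p) : IsStableLaw ζ := by
  refine ⟨?_, ?_⟩
  -- For a point mass the exponent is linear in t: t = 1 and t = 2 give x = b and 2x = b 2^p,
  -- impossible for p > 1 and b > 0.
  · rintro x rfl
    have h1 := (h 1 zero_le_one).2
    have h2 := (h 2 zero_le_two).2
    simp only [integral_dirac, Real.exp_eq_exp, one_mul, Real.one_rpow, mul_one] at h1 h2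
    have h3 : (2 : ℝ) ^ (1 : ℝ) < 2 ^ p := Real.rpow_lt_rpow_of_exponent_lt one_lt_two hp
    rw [Real.rpow_one] at h3
    nlinarith
  · intro a₁ a₂ ha₁ ha₂
    have hs : 0 < a₁ ^ p + a₂ ^ p := by positivity
    -- Exponents add under convolution, and this scale satisfies c^p = a₁^p + a₂^p; no shift is
    -- needed because exp(b t^p) has no linear term.
    refine ⟨(a₁ ^ p + a₂ ^ p) ^ (1 / p), 0, by positivity, ?_⟩
    simp only [add_zero]
    have hc : 0 < (a₁ ^ p + a₂ ^ p) ^ (1 / p) := by positivity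
    have hcp : ((a₁ ^ p + a₂ ^ p) ^ (1 / p)) ^ p = a₁ ^ p + a₂ ^ p := by
      rw [← Real.rpow_mul hs.le, one_div, inv_mul_cancel₀ (by linarith), Real.rpow_one]
    have hscale : ∀ a : ℝ, 0 < a → ∀ t : ℝ, 0 < t →
        Integrable (fun x => Real.exp (t * x)) (ζ.map fun x => a * x) ∧
        ∫ x, Real.exp (t * x) ∂(ζ.map fun x => a * x) = Real.exp (b * (a ^ p * t ^ p)) := by
      intro a ha t ht
      have h1 := h (t * a) (by positivity)
      rw [integrable_map_measure (by fun_prop) (by fun_prop),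
        integral_map (by fun_prop) (by fun_prop)]
      simp only [Function.comp_def, ← mul_assoc] at h1 ⊢
      refine ⟨h1.1, ?_⟩
      rw [h1.2, Real.mul_rpow ht.le ha.le, mul_assoc, mul_comm (t ^ p)]
    have hp1 : ∀ a : ℝ, IsProbabilityMeasure (ζ.map fun x => a * x) := fun a =>
      Measure.isProbabilityMeasure_map (by fun_prop)
    have := hp1 a₁
    have := hp1 a₂
    have := hp1 ((a₁ ^ p + a₂ ^ p) ^ (1 / p))
    have hconvI : ∀ t : ℝ, 0 < t → Integrable (fun x => Real.exp (t * x))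
        (Measure.conv (ζ.map fun x => a₁ * x) (ζ.map fun x => a₂ * x)) ∧
        ∫ x, Real.exp (t * x) ∂(Measure.conv (ζ.map fun x => a₁ * x) (ζ.map fun x => a₂ * x)) =
          Real.exp (b * (a₁ ^ p * t ^ p)) * Real.exp (b * (a₂ ^ p * t ^ p)) := by
      intro t ht
      rw [Measure.conv, integrable_map_measure (by fun_prop) (by fun_prop),
        integral_map (by fun_prop) (by fun_prop)]
      simp only [Function.comp_def, mul_add, Real.exp_add]
      refine ⟨(hscale a₁ ha₁ t ht).1.mul_prod (hscale a₂ ha₂ t ht).1, ?_⟩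
      rw [integral_prod_mul (fun x => Real.exp (t * x)) (fun x => Real.exp (t * x)), (hscale a₁ ha₁ t ht).2, (hscale a₂ ha₂ t ht).2]
    refine measure_ext_of_mgf_pos (fun t ht => (hconvI t ht).1) (fun t ht => (hscale _ hc t ht).1)
      fun t ht => ?_
    rw [(hconvI t ht).2, (hscale _ hc t ht).2, hcp, ← Real.exp_add]
    ring_nf

/-! ### Asymptotics of the cluster coefficients -/

/-- Bernoulli's inequality for the exponent γ + 1 in (0, 1), applied to k/(k+1), bounds (k+1)^γ by
the increment of k^(γ+1)/(γ+1). -/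
theorem sum_rpow_le {γ : ℝ} (h1 : -1 < γ) (h2 : γ < 0) (k : ℕ) :
    ∑ j ∈ Finset.range k, ((j : ℝ) + 1) ^ γ ≤ (k : ℝ) ^ (γ + 1) / (γ + 1) := by
  have hg : 0 < γ + 1 := by linarith
  induction k with
  | zero => simp [Real.zero_rpow hg.ne']
  | succ k ih =>
    rw [Finset.sum_range_succ]
    have hk : (0 : ℝ) < (k : ℝ) + 1 := by positivity
    have hB : (1 + (-1 / ((k : ℝ) + 1))) ^ (γ + 1) ≤ 1 + (γ + 1) * (-1 / ((k : ℝ) + 1)) := by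
      refine rpow_one_add_le_one_add_mul_self ?_ hg.le (by linarith)
      rw [neg_div, neg_le_neg_iff, div_le_one hk]
      linarith [(Nat.cast_nonneg k : (0 : ℝ) ≤ k)]
    have h3 : 1 + (-1 / ((k : ℝ) + 1)) = k / ((k : ℝ) + 1) := by
      field_simp
      ring
    rw [h3, Real.div_rpow (Nat.cast_nonneg k) hk.le, div_le_iff₀ (by positivity)] at hB
    have h4 : ((k : ℝ) + 1) ^ (γ + 1) = ((k : ℝ) + 1) ^ γ * ((k : ℝ) + 1) := by
      rw [Real.rpow_add hk, Real.rpow_one]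
    have h5 : (1 + (γ + 1) * (-1 / ((k : ℝ) + 1))) * ((k : ℝ) + 1) ^ (γ + 1) =
        ((k : ℝ) + 1) ^ (γ + 1) - (γ + 1) * ((k : ℝ) + 1) ^ γ := by
      rw [h4]
      field_simp
      ring
    rw [h5] at hB
    push_cast
    rw [le_div_iff₀ hg] at ih ⊢
    nlinarith

/-- If `k * h k` is the convolution of `j ^ γ` with the summable sequence `h`, then `h k` is
asymptotic to `k ^ (γ - 1)` times the sum of `h`. -/
theorem tendsto_of_rpow_recursion {γ H : ℝ} (h1 : -1 < γ) (h2 : γ < 0) {h : ℕ → ℝ}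
    (h0 : ∀ k, 0 ≤ h k) (hH : HasSum h H)
    (hrec : ∀ k : ℕ, (k : ℝ) * h k = ∑ i ∈ Finset.range k, ((k - i : ℕ) : ℝ) ^ γ * h i) :
    Tendsto (fun k : ℕ => h k * (k : ℝ) ^ (1 - γ)) atTop (𝓝 H) := by
  have hg : 0 < γ + 1 := by linarith
  have hH0 : 0 ≤ H := hH.nonneg h0
  -- the contribution of the large indices
  have hupper : ∀ (A q : ℝ), 0 ≤ A → 0 ≤ q → (∀ i : ℕ, 0 < i → h i ≤ A * (i : ℝ) ^ (-q)) →
      ∀ k : ℕ, 0 < k → ∑ i ∈ (Finset.range k).filter (fun i => k < 2 * i),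
        ((k - i : ℕ) : ℝ) ^ γ * h i ≤ A * 2 ^ q / (γ + 1) * (k : ℝ) ^ (γ + 1 - q) := by
    intro A q hA hq hAq k hk
    have hk' : (0 : ℝ) < k := by exact_mod_cast hk
    have h3 : ∀ i ∈ (Finset.range k).filter (fun i => k < 2 * i),
        ((k - i : ℕ) : ℝ) ^ γ * h i ≤ ((k - i : ℕ) : ℝ) ^ γ * (A * ((k : ℝ) / 2) ^ (-q)) := by
      intro i hi
      simp only [Finset.mem_filter, Finset.mem_range] at hi
      refine mul_le_mul_of_nonneg_left ((hAq i (by omega)).trans ?_)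
        (Real.rpow_nonneg (Nat.cast_nonneg _) _)
      refine mul_le_mul_of_nonneg_left ?_ hA
      refine Real.rpow_le_rpow_of_nonpos (by positivity) ?_ (by linarith)
      have : (k : ℝ) < 2 * i := by exact_mod_cast hi.2
      linarith
    refine (Finset.sum_le_sum h3).trans ?_
    rw [← Finset.sum_mul]
    have h4 : ∑ i ∈ (Finset.range k).filter (fun i => k < 2 * i), ((k - i : ℕ) : ℝ) ^ γ ≤
        ∑ i ∈ Finset.range k, ((i : ℝ) + 1) ^ γ := by
      rw [← Finset.sum_range_reflect]
      refine (Finset.sum_le_sum_of_subset_of_nonneg (Finset.filter_subset _ _) fun i _ _ =>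
        Real.rpow_nonneg (Nat.cast_nonneg _) _).trans (le_of_eq ?_)
      refine Finset.sum_congr rfl fun i hi => ?_
      have hi := Finset.mem_range.1 hi
      congr 1
      have : k - i = (k - 1 - i) + 1 := by omega
      rw [this]
      push_cast
      rfl
    refine (mul_le_mul_of_nonneg_right (h4.trans (sum_rpow_le h1 h2 k)) (by positivity)).trans
      (le_of_eq ?_)
    rw [Real.div_rpow hk'.le (by norm_num), Real.rpow_neg (by norm_num : (0 : ℝ) ≤ 2),
      sub_eq_add_neg, Real.rpow_add hk' (γ + 1)]
    field_simp
  have hlow : ∀ k : ℕ, 0 < k → ∀ i ∈ (Finset.range k).filter (fun i => ¬ k < 2 * i),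
      ((k - i : ℕ) : ℝ) ^ γ ≤ 2 ^ (-γ) * (k : ℝ) ^ γ := by
    intro k hk i hi
    simp only [Finset.mem_filter, Finset.mem_range, not_lt] at hi
    have hk' : (0 : ℝ) < k := by exact_mod_cast hk
    have h3 : (k : ℝ) / 2 ≤ ((k - i : ℕ) : ℝ) := by
      have : (2 * i : ℝ) ≤ k := by exact_mod_cast hi.2
      rw [Nat.cast_sub hi.1.le]
      linarith
    refine (Real.rpow_le_rpow_of_nonpos (by positivity) h3 h2.le).trans (le_of_eq ?_)
    rw [Real.div_rpow hk'.le (by norm_num), Real.rpow_neg (by norm_num)]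
    field_simp
  have hsplit : ∀ k : ℕ, ∑ i ∈ Finset.range k, ((k - i : ℕ) : ℝ) ^ γ * h i =
      ∑ i ∈ (Finset.range k).filter (fun i => k < 2 * i), ((k - i : ℕ) : ℝ) ^ γ * h i +
      ∑ i ∈ (Finset.range k).filter (fun i => ¬ k < 2 * i), ((k - i : ℕ) : ℝ) ^ γ * h i :=
    fun k => (Finset.sum_filter_add_sum_filter_not _ _ _).symm
  have hlowsum : ∀ k : ℕ, 0 < k →
      ∑ i ∈ (Finset.range k).filter (fun i => ¬ k < 2 * i), ((k - i : ℕ) : ℝ) ^ γ * h i ≤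
        2 ^ (-γ) * (k : ℝ) ^ γ * H := by
    intro k hk
    refine (Finset.sum_le_sum fun i hi => mul_le_mul_of_nonneg_right (hlow k hk i hi) (h0 i)).trans
      ?_
    rw [← Finset.mul_sum]
    exact mul_le_mul_of_nonneg_left (sum_le_hasSum _ (fun i _ => h0 i) hH) (by positivity)
  -- first bound
  have hb1 : ∀ i : ℕ, 0 < i → h i ≤ H * (i : ℝ) ^ (-1 : ℝ) := by
    intro k hk
    have hk' : (0 : ℝ) < k := by exact_mod_cast hk
    rw [Real.rpow_neg_one, ← div_eq_mul_inv, le_div_iff₀ hk', mul_comm, hrec]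
    refine (Finset.sum_le_sum fun i hi => ?_).trans
      (sum_le_hasSum (Finset.range k) (fun i _ => h0 i) hH)
    -- Here k - i ≥ 1 and γ < 0, so every coefficient of the recursion is at most 1.
    have hi := Finset.mem_range.1 hi
    refine mul_le_of_le_one_left (h0 i) (Real.rpow_le_one_of_one_le_of_nonpos ?_ h2.le)
    exact_mod_cast (by omega : 1 ≤ k - i)
  -- second bound
  obtain ⟨A, hA0, hA⟩ : ∃ A : ℝ, 0 ≤ A ∧ ∀ i : ℕ, 0 < i → h i ≤ A * (i : ℝ) ^ (-(1 - γ)) := by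
    refine ⟨H * 2 ^ (1 : ℝ) / (γ + 1) + 2 ^ (-γ) * H, by positivity, fun k hk => ?_⟩
    have hk' : (0 : ℝ) < k := by exact_mod_cast hk
    -- Bootstrap: the rate k^(-1) makes the upper half of the convolution O(k^γ), the same order as
    -- the lower half, and dividing by k improves the rate to k^(γ-1).
    have h3 := hupper H 1 hH0 zero_le_one hb1 k hk
    have h4 := hlowsum k hk
    have h5 := hrec k
    rw [hsplit] at h5
    rw [add_sub_cancel_right] at h3
    have h6 : -(1 - γ) = γ - 1 := by ring
    rw [h6, Real.rpow_sub_one hk'.ne', ← mul_div_assoc, le_div_iff₀ hk', mul_comm, h5]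
    linarith
  -- the limit
  let F : ℕ → ℕ → ℝ := fun k i =>
    if i ∈ (Finset.range k).filter (fun i => ¬ k < 2 * i) then
      (k : ℝ) ^ (-γ) * (((k - i : ℕ) : ℝ) ^ γ * h i) else 0
  have hlimlow : Tendsto (fun k => ∑' i, F k i) atTop (𝓝 (∑' i, h i)) := by
    refine tendsto_tsum_of_dominated_convergence (bound := fun i => 2 ^ (-γ) * h i)
      (hH.summable.mul_left _) ?_ ?_
    · intro i
      have h3 : Tendsto (fun k : ℕ => (1 - (i : ℝ) / k) ^ γ * h i) atTop (𝓝 ((1 - 0) ^ γ * h i)) := by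
        refine Tendsto.mul_const _ (Tendsto.rpow_const ?_ (Or.inl (by norm_num)))
        exact tendsto_const_nhds.sub (tendsto_const_div_atTop_nhds_zero_nat _)
      rw [sub_zero, Real.one_rpow, one_mul] at h3
      refine h3.congr' ?_
      filter_upwards [eventually_gt_atTop (2 * i)] with k hk
      have hmem : i ∈ (Finset.range k).filter (fun i => ¬ k < 2 * i) := by
        simp only [Finset.mem_filter, Finset.mem_range]
        omega
      have hk' : (0 : ℝ) < k := by exact_mod_cast (by omega : 0 < k)
      simp only [F, if_pos hmem]
      have h4 : (1 - (i : ℝ) / k) = ((k - i : ℕ) : ℝ) / k := by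
        rw [Nat.cast_sub (by omega)]
        field_simp
      rw [h4, Real.div_rpow (Nat.cast_nonneg _) hk'.le, Real.rpow_neg hk'.le]
      field_simp
    · filter_upwards [eventually_gt_atTop 0] with k hk i
      have hk' : (0 : ℝ) < k := by exact_mod_cast hk
      simp only [F]
      split_ifs with hi
      · rw [Real.norm_of_nonneg (mul_nonneg (by positivity) (mul_nonneg (by positivity) (h0 i))),
          ← mul_assoc]
        refine mul_le_mul_of_nonneg_right ?_ (h0 i)
        refine (mul_le_mul_of_nonneg_left (hlow k hk i hi) (by positivity)).trans (le_of_eq ?_)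
        rw [Real.rpow_neg hk'.le γ]
        field_simp
      · rw [norm_zero]
        exact mul_nonneg (by positivity) (h0 i)
  have hlimup : Tendsto (fun k : ℕ => (k : ℝ) ^ (-γ) *
      ∑ i ∈ (Finset.range k).filter (fun i => k < 2 * i), ((k - i : ℕ) : ℝ) ^ γ * h i) atTop
      (𝓝 0) := by
    -- With the improved rate the upper half is O(k^(2γ)), negligible against k^γ.
    have h3 : Tendsto (fun k : ℕ => A * 2 ^ (1 - γ) / (γ + 1) * (k : ℝ) ^ (-(-γ))) atTop
        (𝓝 (A * 2 ^ (1 - γ) / (γ + 1) * 0)) :=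
      ((tendsto_rpow_neg_atTop (by linarith)).comp tendsto_natCast_atTop_atTop).const_mul _
    rw [mul_zero] at h3
    refine squeeze_zero' (Eventually.of_forall fun k => ?_) ?_ h3
    · exact mul_nonneg (by positivity) (Finset.sum_nonneg fun i _ =>
        mul_nonneg (by positivity) (h0 i))
    · filter_upwards [eventually_gt_atTop 0] with k hk
      have hk' : (0 : ℝ) < k := by exact_mod_cast hk
      refine (mul_le_mul_of_nonneg_left (hupper A (1 - γ) hA0 (by linarith) hA k hk)
        (by positivity)).trans (le_of_eq ?_)
      have : (k : ℝ) ^ (-(-γ)) = (k : ℝ) ^ (-γ) * (k : ℝ) ^ (γ + 1 - (1 - γ)) := by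
        rw [← Real.rpow_add hk']
        ring_nf
      rw [this]
      ring
  have hfin := hlimlow.add hlimup
  rw [hH.tsum_eq, add_zero] at hfin
  refine hfin.congr' ?_
  filter_upwards [eventually_gt_atTop 0] with k hk
  have hk' : (0 : ℝ) < k := by exact_mod_cast hk
  have h3 : ∑' i, F k i = (k : ℝ) ^ (-γ) *
      ∑ i ∈ (Finset.range k).filter (fun i => ¬ k < 2 * i), ((k - i : ℕ) : ℝ) ^ γ * h i := by
    rw [tsum_eq_sum (s := (Finset.range k).filter (fun i => ¬ k < 2 * i))
      (fun i hi => by simp only [F, if_neg hi]), Finset.mul_sum]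
    exact Finset.sum_congr rfl fun i hi => by simp only [F, if_pos hi]
  rw [h3, ← mul_add, add_comm, ← hsplit, ← hrec, sub_eq_add_neg, Real.rpow_add hk', Real.rpow_one]
  ring

theorem clusterCoeff_le {c : ℕ+ → ℝ} (hc : ∀ j, 0 ≤ c j) (hs : Summable c) (k : ℕ) :
    clusterCoeff c k ≤ ENNReal.ofReal (Real.exp (∑' j, c j)) := by
  rw [← tsum_clusterCoeff hc hs]
  exact ENNReal.le_tsum k

theorem summable_pnat_rpow {q : ℝ} (hq : q < -1) :
    Summable fun j : ℕ+ => ((j : ℕ) : ℝ) ^ q :=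
  (Real.summable_nat_rpow.2 hq).comp_injective PNat.coe_injective

/-- With c_j = j^(γ-1) one has j c_j = j^γ, so `mul_clusterCoeff` is the recursion of
`tendsto_of_rpow_recursion`; the coefficients sum to the exponential on the right. -/
theorem tendsto_clusterCoeff {γ : ℝ} (h1 : -1 < γ) (h2 : γ < 0) :
    Tendsto (fun k : ℕ => (clusterCoeff (fun j => ((j : ℕ) : ℝ) ^ (γ - 1)) k).toReal *
      (k : ℝ) ^ (1 - γ)) atTop (𝓝 (Real.exp (∑' j : ℕ+, ((j : ℕ) : ℝ) ^ (γ - 1)))) := by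
  set c : ℕ+ → ℝ := fun j => ((j : ℕ) : ℝ) ^ (γ - 1) with hcdef
  have hc : ∀ j, 0 ≤ c j := fun j => by positivity
  have hs : Summable c := summable_pnat_rpow (by linarith)
  have hfin : ∀ k, clusterCoeff c k ≠ ∞ := fun k =>
    ((clusterCoeff_le hc hs k).trans_lt ENNReal.ofReal_lt_top).ne
  refine tendsto_of_rpow_recursion h1 h2 (fun k => ENNReal.toReal_nonneg) ?_ ?_
  · have h3 := tsum_clusterCoeff hc hs
    have h4 := (ENNReal.hasSum_toReal (f := clusterCoeff c) (by rw [h3]; exact ENNReal.ofReal_ne_top))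
    rwa [← ENNReal.tsum_toReal_eq hfin, h3, ENNReal.toReal_ofReal (Real.exp_pos _).le] at h4
  · intro k
    have h3 := mul_clusterCoeff hc k
    rw [← Equiv.pnatEquivNat.symm.tsum_eq] at h3
    rw [tsum_eq_sum (s := Finset.range k)] at h3
    · have h4 := congrArg ENNReal.toReal h3
      rw [ENNReal.toReal_mul, ENNReal.toReal_natCast, ENNReal.toReal_sum] at h4
      · rw [h4, ← Finset.sum_range_reflect]
        refine Finset.sum_congr rfl fun i hi => ?_
        have hi := Finset.mem_range.1 hi
        simp only [Equiv.pnatEquivNat_symm_apply, Nat.succPNat_coe, Nat.succ_eq_add_one]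
        rw [if_pos (by omega), ENNReal.toReal_mul, ENNReal.toReal_ofReal (mul_nonneg (by positivity)
          (hc _))]
        have h5 : k - 1 - i + 1 = k - i := by omega
        have h6 : k - (k - i) = i := by omega
        simp only [hcdef, Nat.succPNat_coe, Nat.succ_eq_add_one, h5, h6]
        have h7 : (0 : ℝ) < ((k - i : ℕ) : ℝ) := by exact_mod_cast (by omega : 0 < k - i)
        rw [Real.rpow_sub_one h7.ne']
        field_simp
      · intro i _
        refine ENNReal.mul_ne_top ENNReal.ofReal_ne_top ?_
        split_ifs
        · exact hfin _
        · exact ENNReal.zero_ne_top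
    · intro i hi
      have hi : k ≤ i := by simpa using hi
      simp only [Equiv.pnatEquivNat_symm_apply, Nat.succPNat_coe, Nat.succ_eq_add_one]
      rw [if_neg (by omega), mul_zero]

/-! ### Lattice sums -/

/-- The lattice cell that contains a point. -/
def latticeFloor {d : ℕ} (y : EuclideanSpace ℝ (Fin d)) : Fin d → ℤ := fun i => ⌊y i⌋

theorem measurable_latticeFloor {d : ℕ} : Measurable (latticeFloor (d := d)) := by
  refine measurable_pi_lambda _ fun i => ?_
  exact Int.measurable_floor.comp (by fun_prop)

/-- Each lattice cell is a unit cube. Lattice sums thereby become integrals of step functions, open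
to dominated convergence. -/
theorem map_latticeFloor (d : ℕ) :
    (volume : Measure (EuclideanSpace ℝ (Fin d))).map latticeFloor = Measure.count := by
  refine Measure.ext_of_singleton fun x => ?_
  rw [Measure.map_apply measurable_latticeFloor (measurableSet_singleton x),
    Measure.count_singleton]
  have h1 : latticeFloor ⁻¹' {x} = (@WithLp.ofLp 2 (Fin d → ℝ)) ⁻¹'
      (Set.univ.pi fun i => Set.Ico (x i : ℝ) (x i + 1)) := by
    ext y
    simp only [Set.mem_preimage, Set.mem_singleton_iff, Set.mem_pi, Set.mem_univ, true_imp_iff,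
      funext_iff, latticeFloor, Int.floor_eq_iff, Set.mem_Ico]
  rw [h1, (PiLp.volume_preserving_ofLp (Fin d)).measure_preimage
    (MeasurableSet.univ_pi fun i => measurableSet_Ico).nullMeasurableSet, Real.volume_pi_Ico]
  simp

theorem integrable_comp_latticeFloor_iff {d : ℕ} (g : (Fin d → ℤ) → ℝ) :
    Integrable (fun y : EuclideanSpace ℝ (Fin d) => g (latticeFloor y)) ↔ Summable g := by
  have h1 := integrable_map_measure (μ := (volume : Measure (EuclideanSpace ℝ (Fin d))))
    (f := latticeFloor) (g := g) (measurable_of_countable g).aestronglyMeasurable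
    measurable_latticeFloor.aemeasurable
  rw [map_latticeFloor, integrable_count_iff] at h1
  rw [← summable_norm_iff, h1]
  rfl

theorem integral_comp_latticeFloor {d : ℕ} {g : (Fin d → ℤ) → ℝ} (hg : Summable g) :
    ∫ y : EuclideanSpace ℝ (Fin d), g (latticeFloor y) = ∑' x, g x := by
  have h1 := integral_map (μ := (volume : Measure (EuclideanSpace ℝ (Fin d))))
    (f := g) measurable_latticeFloor.aemeasurable
    (measurable_of_countable g).aestronglyMeasurable
  rw [← h1, map_latticeFloor, integral_countable]
  · simp
  · rw [integrable_count_iff]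
    exact hg.norm

theorem norm_sub_latticeFloor_le {d : ℕ} (y : EuclideanSpace ℝ (Fin d)) :
    ‖y - scaledSite 1 (latticeFloor y)‖ ≤ √d := by
  rw [EuclideanSpace.norm_eq]
  refine Real.sqrt_le_sqrt ?_
  refine (Finset.sum_le_card_nsmul _ _ 1 fun i _ => ?_).trans (by simp)
  simp only [scaledSite, latticeFloor, PiLp.sub_apply, div_one, Real.norm_eq_abs, sq_abs]
  have h1 := Int.floor_le (y i)
  have h2 := Int.lt_floor_add_one (y i)
  nlinarith

theorem one_le_norm_site {d : ℕ} {x : Fin d → ℤ} (hx : x ≠ 0) : 1 ≤ ‖scaledSite 1 x‖ := by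
  obtain ⟨i, hi⟩ := Function.ne_iff.1 hx
  refine le_trans ?_ (PiLp.norm_apply_le (scaledSite 1 x) i)
  simp only [scaledSite, div_one, Real.norm_eq_abs]
  exact_mod_cast Int.one_le_abs hi

theorem scaledSite_eq_smul {d : ℕ} (L : ℝ) (x : Fin d → ℤ) :
    scaledSite L x = L⁻¹ • scaledSite 1 x := by
  ext i
  simp [scaledSite, div_eq_inv_mul]

theorem norm_scaledSite_rpow {d : ℕ} {L : ℝ} (hL : 0 < L) (δ : ℝ) (x : Fin d → ℤ) :
    ‖scaledSite L x‖ ^ δ = L ^ (-δ) * ‖scaledSite 1 x‖ ^ δ := by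
  rw [scaledSite_eq_smul, norm_smul, Real.norm_of_nonneg (by positivity),
    Real.mul_rpow (by positivity) (norm_nonneg _), Real.inv_rpow hL.le, Real.rpow_neg hL.le]

theorem integrable_exp_neg_norm_rpow {d : ℕ} (hd : 0 < d) {δ a : ℝ} (hδ : 0 < δ) (ha : 0 < a) :
    Integrable fun y : EuclideanSpace ℝ (Fin d) => Real.exp (-(a * ‖y‖ ^ δ)) := by
  have : NeZero d := ⟨hd.ne'⟩
  have : Nontrivial (EuclideanSpace ℝ (Fin d)) := by
    refine Module.nontrivial_of_finrank_pos (R := ℝ) ?_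
    simpa using hd
  refine (integrable_fun_norm_addHaar volume (f := fun r : ℝ => Real.exp (-(a * r ^ δ)))).2 ?_
  have h1 := integrableOn_rpow_mul_exp_neg_mul_rpow (p := δ) (s := ((d - 1 : ℕ) : ℝ)) (b := a)
    (by linarith [(Nat.cast_nonneg (d - 1) : (0 : ℝ) ≤ _)]) hδ ha
  refine h1.congr_fun (fun x _ => ?_) measurableSet_Ioi
  simp

/-- The constant `∫ exp (-‖y‖ ^ δ) dy`. -/
def expIntegral (δ : ℝ) (d : ℕ) : ℝ :=
  ∫ y : EuclideanSpace ℝ (Fin d), Real.exp (-‖y‖ ^ δ)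

theorem expIntegral_pos {d : ℕ} (hd : 0 < d) {δ : ℝ} (hδ : 0 < δ) : 0 < expIntegral δ d := by
  refine integral_exp_pos ?_
  simpa using integrable_exp_neg_norm_rpow hd hδ one_pos

/-- Scaling by a^(1/δ) in dimension d. -/
theorem integral_exp_neg_norm_rpow {d : ℕ} {δ a : ℝ} (hδ : 0 < δ) (ha : 0 < a) :
    ∫ y : EuclideanSpace ℝ (Fin d), Real.exp (-(a * ‖y‖ ^ δ)) =
      a ^ (-(d / δ)) * expIntegral δ d := by
  have hr : 0 < a ^ (1 / δ) := by positivity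
  have h1 := Measure.integral_comp_smul_of_nonneg
    (volume : Measure (EuclideanSpace ℝ (Fin d))) (fun y => Real.exp (-‖y‖ ^ δ)) (a ^ (1 / δ))
    (hR := hr.le)
  have h2 : ∀ y : EuclideanSpace ℝ (Fin d), ‖a ^ (1 / δ) • y‖ ^ δ = a * ‖y‖ ^ δ := by
    intro y
    rw [norm_smul, Real.norm_of_nonneg hr.le, Real.mul_rpow hr.le (norm_nonneg _),
      ← Real.rpow_mul ha.le, one_div, inv_mul_cancel₀ hδ.ne', Real.rpow_one]
  simp only [h2] at h1
  rw [h1, expIntegral, smul_eq_mul, finrank_euclideanSpace_fin, ← Real.rpow_natCast,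
    ← Real.rpow_mul ha.le, ← Real.rpow_neg ha.le]
  congr 2
  ring

/-- The lattice sum `∑ exp (-a ‖x‖ ^ δ)` over the nonzero lattice points. -/
def latticeSum (δ : ℝ) (d : ℕ) (a : ℝ) : ℝ :=
  ∑' x : Fin d → ℤ, if x = 0 then 0 else Real.exp (-(a * ‖scaledSite 1 x‖ ^ δ))

/-- The step function whose integral is a rescaled lattice sum. -/
def latticeStep (δ : ℝ) {d : ℕ} (r : ℝ) (y : EuclideanSpace ℝ (Fin d)) : ℝ :=
  if latticeFloor (r⁻¹ • y) = 0 then 0 else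
    Real.exp (-‖r • scaledSite 1 (latticeFloor (r⁻¹ • y))‖ ^ δ)

theorem latticeStep_nonneg (δ : ℝ) {d : ℕ} (r : ℝ) (y : EuclideanSpace ℝ (Fin d)) :
    0 ≤ latticeStep δ r y := by
  rw [latticeStep]
  split_ifs
  · exact le_rfl
  · exact (Real.exp_pos _).le

/-- A nonzero site has norm at least 1, so a point of its cell has norm at most 1 + √d times that of
the site. Leaving out the origin is what makes this majorant uniform in the mesh `r`. -/
theorem latticeStep_le {d : ℕ} {δ r : ℝ} (hδ : 0 < δ) (hr : 0 < r)
    (y : EuclideanSpace ℝ (Fin d)) :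
    latticeStep δ r y ≤ Real.exp (-((1 + √d) ^ (-δ) * ‖y‖ ^ δ)) := by
  rw [latticeStep]
  split_ifs with h
  · exact (Real.exp_pos _).le
  · have hA : 0 < 1 + √(d : ℝ) := by positivity
    refine Real.exp_le_exp.2 (neg_le_neg ?_)
    rw [Real.rpow_neg hA.le, ← Real.inv_rpow hA.le, ← Real.mul_rpow (by positivity) (norm_nonneg _)]
    refine Real.rpow_le_rpow (by positivity) ?_ hδ.le
    rw [inv_mul_le_iff₀ hA, norm_smul, Real.norm_of_nonneg hr.le]
    have h1 := norm_sub_latticeFloor_le (r⁻¹ • y)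
    have h2 := one_le_norm_site h
    have h3 : ‖r⁻¹ • y‖ ≤ √d + ‖scaledSite 1 (latticeFloor (r⁻¹ • y))‖ := by
      have := norm_le_norm_sub_add (r⁻¹ • y) (scaledSite 1 (latticeFloor (r⁻¹ • y)))
      linarith
    rw [norm_smul, norm_inv, Real.norm_of_nonneg hr.le, inv_mul_le_iff₀ hr] at h3
    have h4 : √(d : ℝ) ≤ √d * ‖scaledSite 1 (latticeFloor (r⁻¹ • y))‖ :=
      le_mul_of_one_le_right (Real.sqrt_nonneg _) h2
    nlinarith

theorem measurable_latticeStep (δ : ℝ) {d : ℕ} (r : ℝ) :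
    Measurable (latticeStep δ (d := d) r) := by
  have h1 : Measurable fun x : Fin d → ℤ => if x = 0 then (0 : ℝ) else
    Real.exp (-‖r • scaledSite 1 x‖ ^ δ) := measurable_of_countable _
  have h2 : Measurable fun y : EuclideanSpace ℝ (Fin d) => latticeFloor (r⁻¹ • y) :=
    measurable_latticeFloor.comp (by fun_prop)
  exact h1.comp h2

theorem integrable_latticeStep {d : ℕ} (hd : 0 < d) {δ r : ℝ} (hδ : 0 < δ) (hr : 0 < r) :
    Integrable (latticeStep δ (d := d) r) := by
  refine (integrable_exp_neg_norm_rpow hd hδ (a := (1 + √d) ^ (-δ)) (by positivity)).mono'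
    (measurable_latticeStep δ r).aestronglyMeasurable (ae_of_all _ fun y => ?_)
  rw [Real.norm_of_nonneg (latticeStep_nonneg _ _ _)]
  exact latticeStep_le hδ hr y

/-- Rescaling space by the mesh a^(1/δ) turns the lattice sum into a Riemann sum for exp(-‖y‖^δ). -/
theorem latticeSum_aux {d : ℕ} (hd : 0 < d) {δ a : ℝ} (hδ : 0 < δ) (ha : 0 < a) :
    (Summable fun x : Fin d → ℤ =>
      if x = 0 then 0 else Real.exp (-(a * ‖scaledSite 1 x‖ ^ δ))) ∧
    a ^ (d / δ) * latticeSum δ d a = ∫ y, latticeStep δ (d := d) (a ^ (1 / δ)) y := by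
  set r := a ^ (1 / δ) with hrdef
  have hr : 0 < r := by positivity
  set g : (Fin d → ℤ) → ℝ := fun x =>
    if x = 0 then 0 else Real.exp (-(a * ‖scaledSite 1 x‖ ^ δ)) with hg
  have h1 : ∀ y : EuclideanSpace ℝ (Fin d), latticeStep δ r (r • y) = g (latticeFloor y) := by
    intro y
    rw [latticeStep, inv_smul_smul₀ hr.ne']
    simp only [hg]
    split_ifs
    · rfl
    · rw [norm_smul, Real.norm_of_nonneg hr.le, Real.mul_rpow hr.le (norm_nonneg _), hrdef,
        ← Real.rpow_mul ha.le, one_div, inv_mul_cancel₀ hδ.ne', Real.rpow_one]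
  have h2 : Summable g := by
    rw [← integrable_comp_latticeFloor_iff]
    refine ((integrable_latticeStep hd hδ hr).comp_smul hr.ne').congr (ae_of_all _ fun y => ?_)
    exact h1 y
  refine ⟨h2, ?_⟩
  have h3 := Measure.integral_comp_smul_of_nonneg
    (volume : Measure (EuclideanSpace ℝ (Fin d))) (latticeStep δ r) r (hR := hr.le)
  simp only [h1] at h3
  rw [integral_comp_latticeFloor h2] at h3
  rw [latticeSum, h3, smul_eq_mul, finrank_euclideanSpace_fin, ← Real.rpow_natCast, hrdef,
    ← Real.rpow_mul ha.le, ← mul_assoc, one_div_mul_eq_div, mul_inv_cancel₀ (by positivity),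
    one_mul]

theorem summable_latticeSum {d : ℕ} (hd : 0 < d) {δ a : ℝ} (hδ : 0 < δ) (ha : 0 < a) :
    Summable fun x : Fin d → ℤ =>
      if x = 0 then 0 else Real.exp (-(a * ‖scaledSite 1 x‖ ^ δ)) :=
  (latticeSum_aux hd hδ ha).1

theorem latticeSum_nonneg (δ : ℝ) (d : ℕ) (a : ℝ) : 0 ≤ latticeSum δ d a :=
  tsum_nonneg fun x => by
    split_ifs
    · exact le_rfl
    · exact (Real.exp_pos _).le

/-- Every remaining site has ‖x‖^δ ≥ 1, so half of the exponent can be given up for the factor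
exp(-a/2). This decay is what later allows positive exponential moments. -/
theorem exists_latticeSum_le {d : ℕ} (hd : 0 < d) {δ : ℝ} (hδ : 0 < δ) :
    ∃ C : ℝ, 0 ≤ C ∧ ∀ a : ℝ, 0 < a →
      a ^ (d / δ) * latticeSum δ d a ≤ C * Real.exp (-(a / 2)) := by
  set C₀ := ∫ y : EuclideanSpace ℝ (Fin d), Real.exp (-((1 + √d) ^ (-δ) * ‖y‖ ^ δ)) with hC₀
  have hC₀0 : 0 ≤ C₀ := integral_nonneg fun y => (Real.exp_pos _).le
  have h1 : ∀ a : ℝ, 0 < a → a ^ (d / δ) * latticeSum δ d a ≤ C₀ := by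
    intro a ha
    rw [(latticeSum_aux hd hδ ha).2]
    exact integral_mono (integrable_latticeStep hd hδ (by positivity))
      (integrable_exp_neg_norm_rpow hd hδ (by positivity)) fun y => latticeStep_le hδ (by positivity) y
  refine ⟨2 ^ (d / δ) * C₀, by positivity, fun a ha => ?_⟩
  have h2 : latticeSum δ d a ≤ Real.exp (-(a / 2)) * latticeSum δ d (a / 2) := by
    rw [latticeSum, latticeSum, ← tsum_mul_left]
    refine (summable_latticeSum hd hδ ha).tsum_le_tsum (fun x => ?_)
      ((summable_latticeSum hd hδ (half_pos ha)).mul_left _)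
    split_ifs with hx
    · simp
    · rw [← Real.exp_add]
      refine Real.exp_le_exp.2 ?_
      have := Real.one_le_rpow (one_le_norm_site hx) hδ.le
      nlinarith
  have h3 := h1 (a / 2) (half_pos ha)
  rw [Real.div_rpow ha.le (by norm_num), div_mul_eq_mul_div, div_le_iff₀ (by positivity)] at h3
  calc a ^ (d / δ) * latticeSum δ d a
      ≤ a ^ (d / δ) * (Real.exp (-(a / 2)) * latticeSum δ d (a / 2)) :=
        mul_le_mul_of_nonneg_left h2 (by positivity)
    _ = (a ^ (d / δ) * latticeSum δ d (a / 2)) * Real.exp (-(a / 2)) := by ring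
    _ ≤ (C₀ * 2 ^ (d / δ)) * Real.exp (-(a / 2)) :=
        mul_le_mul_of_nonneg_right h3 (Real.exp_pos _).le
    _ = _ := by ring

/-- Dominated convergence as the mesh tends to 0: at y ≠ 0 the sampled site tends to y, so it
eventually differs from the omitted origin. -/
theorem tendsto_latticeSum {d : ℕ} (hd : 0 < d) {δ : ℝ} (hδ : 0 < δ) :
    Tendsto (fun a : ℝ => a ^ (d / δ) * latticeSum δ d a) (𝓝[>] 0) (𝓝 (expIntegral δ d)) := by
  have h1 : Tendsto (fun r : ℝ => ∫ y, latticeStep δ (d := d) r y) (𝓝[>] 0)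
      (𝓝 (expIntegral δ d)) := by
    refine tendsto_integral_filter_of_dominated_convergence
      (fun y => Real.exp (-((1 + √d) ^ (-δ) * ‖y‖ ^ δ)))
      (Eventually.of_forall fun r => (measurable_latticeStep δ r).aestronglyMeasurable) ?_
      (integrable_exp_neg_norm_rpow hd hδ (by positivity)) ?_
    · filter_upwards [self_mem_nhdsWithin] with r hr
      refine ae_of_all _ fun y => ?_
      rw [Real.norm_of_nonneg (latticeStep_nonneg _ _ _)]
      exact latticeStep_le hδ hr y
    · have : NeZero d := ⟨hd.ne'⟩
      have hae : ∀ᵐ y : EuclideanSpace ℝ (Fin d), y ≠ 0 := by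
        have : Nontrivial (EuclideanSpace ℝ (Fin d)) := by
          refine Module.nontrivial_of_finrank_pos (R := ℝ) ?_
          simpa using hd
        exact Measure.ae_ne volume 0
      filter_upwards [hae] with y hy
      have h2 : Tendsto (fun r : ℝ => r • scaledSite 1 (latticeFloor (r⁻¹ • y))) (𝓝[>] 0)
          (𝓝 y) := by
        rw [tendsto_iff_norm_sub_tendsto_zero]
        have h3 : Tendsto (fun r : ℝ => r * √(d : ℝ)) (𝓝[>] 0) (𝓝 0) := by
          have : Tendsto (fun r : ℝ => r * √(d : ℝ)) (𝓝 0) (𝓝 (0 * √d)) :=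
            tendsto_id.mul_const _
          rw [zero_mul] at this
          exact this.mono_left nhdsWithin_le_nhds
        refine squeeze_zero' (Eventually.of_forall fun _ => norm_nonneg _) ?_ h3
        filter_upwards [self_mem_nhdsWithin] with r hr
        have hr : 0 < r := hr
        have h4 : r • scaledSite 1 (latticeFloor (r⁻¹ • y)) - y =
            -(r • (r⁻¹ • y - scaledSite 1 (latticeFloor (r⁻¹ • y)))) := by
          rw [smul_sub, smul_inv_smul₀ hr.ne', neg_sub]
        rw [h4, norm_neg, norm_smul, Real.norm_of_nonneg hr.le]
        exact mul_le_mul_of_nonneg_left (norm_sub_latticeFloor_le _) hr.le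
      have h5 : Tendsto (fun r : ℝ =>
          Real.exp (-‖r • scaledSite 1 (latticeFloor (r⁻¹ • y))‖ ^ δ)) (𝓝[>] 0)
          (𝓝 (Real.exp (-‖y‖ ^ δ))) :=
        (Real.continuous_exp.tendsto _).comp (h2.norm.rpow_const (Or.inr hδ.le)).neg
      refine h5.congr' ?_
      filter_upwards [h2.eventually_ne hy] with r hr
      rw [latticeStep, if_neg]
      intro h0
      rw [h0] at hr
      apply hr
      ext i
      simp [scaledSite]
  have h2 : Tendsto (fun a : ℝ => a ^ (1 / δ)) (𝓝[>] 0) (𝓝[>] 0) := by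
    refine tendsto_nhdsWithin_iff.2 ⟨?_, ?_⟩
    · have : Tendsto (fun a : ℝ => a ^ (1 / δ)) (𝓝 0) (𝓝 (0 ^ (1 / δ))) :=
        tendsto_id.rpow_const (Or.inr (by positivity))
      rw [Real.zero_rpow (by positivity)] at this
      exact this.mono_left nhdsWithin_le_nhds
    · filter_upwards [self_mem_nhdsWithin] with a ha
      exact Real.rpow_pos_of_pos ha _
  refine (h1.comp h2).congr' ?_
  filter_upwards [self_mem_nhdsWithin] with a ha
  exact (latticeSum_aux hd hδ ha).2.symm

/-! ### The constant in the limit law -/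

/-- The second-order remainder of `exp (-u)`. -/
def expDefect (u : ℝ) : ℝ := Real.exp (-u) - 1 + u

theorem expDefect_nonneg (u : ℝ) : 0 ≤ expDefect u := by
  have := Real.add_one_le_exp (-u)
  rw [expDefect]
  linarith

theorem expDefect_pos {u : ℝ} (hu : 0 < u) : 0 < expDefect u := by
  have := Real.add_one_lt_exp (x := -u) (by linarith)
  rw [expDefect]
  linarith

theorem expDefect_le_self {u : ℝ} (hu : 0 ≤ u) : expDefect u ≤ u := by
  have : Real.exp (-u) ≤ 1 := Real.exp_le_one_iff.2 (by linarith)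
  rw [expDefect]
  linarith

theorem expDefect_le_sq {u : ℝ} (hu : 0 ≤ u) : expDefect u ≤ u ^ 2 := by
  have h1 : Real.exp (-u) * Real.exp u = 1 := by rw [← Real.exp_add]; simp
  have h2 := Real.add_one_le_exp u
  have h3 := Real.exp_pos (-u)
  have h4 : Real.exp (-u) * (u + 1) ≤ 1 := by nlinarith
  rw [expDefect]
  nlinarith [pow_nonneg hu 3]

theorem continuous_expDefect : Continuous expDefect := by
  unfold expDefect
  fun_prop

/-- The density of the jump measure against which the limit law is built. -/
def levyDensity (p u : ℝ) : ℝ := u ^ (-p - 1) * expDefect u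

/-- An integrable decreasing majorant of `levyDensity p`. -/
def levyBound (p u : ℝ) : ℝ := min (u ^ (1 - p)) (u ^ (-p))

theorem levyDensity_nonneg {p u : ℝ} (hu : 0 ≤ u) : 0 ≤ levyDensity p u :=
  mul_nonneg (Real.rpow_nonneg hu _) (expDefect_nonneg u)

theorem levyDensity_le {p u : ℝ} (hu : 0 < u) : levyDensity p u ≤ levyBound p u := by
  refine le_min ?_ ?_
  · have h : u ^ (1 - p) = u ^ (-p - 1) * u ^ 2 := by
      rw [← Real.rpow_natCast u 2, ← Real.rpow_add hu]
      congr 1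
      push_cast
      ring
    rw [h]
    exact mul_le_mul_of_nonneg_left (expDefect_le_sq hu.le) (by positivity)
  · have h : u ^ (-p) = u ^ (-p - 1) * u := by
      rw [Real.rpow_sub_one hu.ne', div_mul_cancel₀ _ hu.ne']
    rw [h]
    exact mul_le_mul_of_nonneg_left (expDefect_le_self hu.le) (by positivity)

theorem levyBound_anti {p u v : ℝ} (hp : 1 ≤ p) (hu : 0 < u) (huv : u ≤ v) :
    levyBound p v ≤ levyBound p u :=
  min_le_min (Real.rpow_le_rpow_of_nonpos hu huv (by linarith))
    (Real.rpow_le_rpow_of_nonpos hu huv (by linarith))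

theorem levyBound_nonneg {p u : ℝ} (hu : 0 ≤ u) : 0 ≤ levyBound p u :=
  le_min (Real.rpow_nonneg hu _) (Real.rpow_nonneg hu _)

/-- The exponent 1 - p exceeds -1 at the origin because p < 2, and -p is below -1 at infinity
because p > 1. -/
theorem integrableOn_levyBound {p : ℝ} (hp1 : 1 < p) (hp2 : p < 2) :
    IntegrableOn (levyBound p) (Set.Ioi 0) := by
  have hm : Measurable (levyBound p) := by
    unfold levyBound
    fun_prop
  rw [← Set.Ioc_union_Ioi_eq_Ioi (zero_le_one (α := ℝ))]
  refine IntegrableOn.union ?_ ?_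
  · have h1 : IntegrableOn (fun u : ℝ => u ^ (1 - p)) (Set.Ioc 0 1) :=
      (intervalIntegral.intervalIntegrable_rpow' (a := 0) (b := 1) (by linarith)).1
    refine h1.mono' hm.aestronglyMeasurable ?_
    filter_upwards [ae_restrict_mem measurableSet_Ioc] with u hu
    rw [Real.norm_of_nonneg (levyBound_nonneg hu.1.le)]
    exact min_le_left _ _
  · have h1 : IntegrableOn (fun u : ℝ => u ^ (-p)) (Set.Ioi 1) :=
      integrableOn_Ioi_rpow_of_lt (by linarith) one_pos
    refine h1.mono' hm.aestronglyMeasurable ?_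
    filter_upwards [ae_restrict_mem measurableSet_Ioi] with u hu
    have hu : 1 < u := hu
    rw [Real.norm_of_nonneg (levyBound_nonneg (by linarith))]
    exact min_le_right _ _

theorem measurable_levyDensity (p : ℝ) : Measurable (levyDensity p) := by
  unfold levyDensity
  exact (by fun_prop : Measurable fun u : ℝ => u ^ (-p - 1)).mul continuous_expDefect.measurable

theorem integrableOn_levyDensity {p : ℝ} (hp1 : 1 < p) (hp2 : p < 2) :
    IntegrableOn (levyDensity p) (Set.Ioi 0) := by
  refine (integrableOn_levyBound hp1 hp2).mono' (measurable_levyDensity p).aestronglyMeasurable ?_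
  filter_upwards [ae_restrict_mem measurableSet_Ioi] with u hu
  have hu : 0 < u := hu
  rw [Real.norm_of_nonneg (levyDensity_nonneg hu.le)]
  exact levyDensity_le hu

theorem integral_levyDensity_pos {p : ℝ} (hp1 : 1 < p) (hp2 : p < 2) :
    0 < ∫ u in Set.Ioi 0, levyDensity p u := by
  rw [setIntegral_pos_iff_support_of_nonneg_ae ?_ (integrableOn_levyDensity hp1 hp2)]
  · have h1 : Set.Ioi (0 : ℝ) ⊆ Function.support (levyDensity p) ∩ Set.Ioi 0 := fun u hu =>
      ⟨(mul_pos (Real.rpow_pos_of_pos hu _) (expDefect_pos hu)).ne', hu⟩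
    refine lt_of_lt_of_le ?_ (measure_mono h1)
    simp
  · filter_upwards [ae_restrict_mem measurableSet_Ioi] with u hu
    exact levyDensity_nonneg (le_of_lt hu)

theorem integrableOn_rpow_mul_exp_neg {s w : ℝ} (hs : -1 < s) (hw : 0 < w) :
    IntegrableOn (fun u : ℝ => u ^ s * Real.exp (-(w * u))) (Set.Ioi 0) := by
  refine (integrableOn_rpow_mul_exp_neg_mul_rpow hs one_pos hw).congr_fun (fun u _ => ?_)
    measurableSet_Ioi
  simp

theorem integral_rpow_mul_exp_neg {s w : ℝ} (hs : -1 < s) (hw : 0 < w) :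
    ∫ u in Set.Ioi 0, u ^ s * Real.exp (-(w * u)) = w ^ (-(s + 1)) * Real.Gamma (s + 1) := by
  have h := Real.integral_rpow_mul_exp_neg_mul_Ioi (a := s + 1) (r := w) (by linarith) hw
  rw [add_sub_cancel_right] at h
  rw [h, one_div, Real.inv_rpow hw.le, Real.rpow_neg hw.le]

/-- The power u^(γ-1) is not integrable at 0, so the defect cannot be split directly. Integrating by
parts against u^γ/γ raises the exponent to γ > -1; the three terms are then separate Gamma
integrals. -/
theorem integral_rpow_mul_expDefect {γ w : ℝ} (h1 : -1 < γ) (h2 : γ < 0) (hw : 0 < w) :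
    ∫ u in Set.Ioi 0, u ^ (γ - 1) * (Real.exp (-(u * w)) * expDefect u) =
      -(Real.Gamma (1 + γ) / |γ|) *
        ((1 + w) ^ |γ| - w ^ |γ| - |γ| * w ^ (-(1 + γ))) := by
  have hw1 : 0 < w + 1 := by linarith
  let f : ℝ → ℝ := fun u => Real.exp (-(u * w)) * expDefect u
  let f' : ℝ → ℝ := fun u => -(w + 1) * Real.exp (-((w + 1) * u)) + (w + 1) * Real.exp (-(w * u)) -
    w * (u * Real.exp (-(w * u)))
  let v : ℝ → ℝ := fun u => u ^ γ / γ
  let v' : ℝ → ℝ := fun u => u ^ (γ - 1)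
  have hf : ∀ u ∈ Set.Ioi (0 : ℝ), HasDerivAt f (f' u) u := by
    intro u _
    have h3 : HasDerivAt (fun u : ℝ => Real.exp (-(u * w))) (Real.exp (-(u * w)) * -(1 * w)) u :=
      (((hasDerivAt_id u).mul_const w).neg).exp
    have h4 : HasDerivAt expDefect (Real.exp (-u) * -1 + 1) u := by
      have := (((hasDerivAt_id u).neg).exp.sub_const 1).add (hasDerivAt_id u)
      exact this
    refine (h3.mul h4).congr_deriv ?_
    simp only [f', expDefect]
    have h5 : Real.exp (-((w + 1) * u)) = Real.exp (-(w * u)) * Real.exp (-u) := by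
      rw [← Real.exp_add]; ring_nf
    rw [h5, mul_comm u w]
    ring
  have hv : ∀ u ∈ Set.Ioi (0 : ℝ), HasDerivAt v (v' u) u := by
    intro u hu
    refine ((Real.hasDerivAt_rpow_const (Or.inl (ne_of_gt hu))).div_const γ).congr_deriv ?_
    simp only [v']
    rw [mul_div_cancel_left₀ _ h2.ne]
  have hfv0 : ∀ u : ℝ, 0 < u → 0 ≤ Real.exp (-(u * w)) * expDefect u := fun u _ =>
    mul_nonneg (Real.exp_pos _).le (expDefect_nonneg u)
  have hIa := (integrableOn_rpow_mul_exp_neg h1 hw1)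
  have hIb := (integrableOn_rpow_mul_exp_neg h1 hw)
  have hIc := (integrableOn_rpow_mul_exp_neg (s := γ + 1) (by linarith) hw)
  have heq : ∀ u ∈ Set.Ioi (0 : ℝ), f' u * v u =
      (-(w + 1) * (u ^ γ * Real.exp (-((w + 1) * u))) + (w + 1) * (u ^ γ * Real.exp (-(w * u))) -
        w * (u ^ (γ + 1) * Real.exp (-(w * u)))) / γ := by
    intro u hu
    have hu : 0 < u := hu
    simp only [f', v]
    rw [Real.rpow_add_one hu.ne']
    ring
  have hIab : IntegrableOn (fun u : ℝ => -(w + 1) * (u ^ γ * Real.exp (-((w + 1) * u))) +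
      (w + 1) * (u ^ γ * Real.exp (-(w * u)))) (Set.Ioi 0) :=
    (hIa.const_mul (-(w + 1))).add (hIb.const_mul (w + 1))
  have hIabc : IntegrableOn (fun u : ℝ => (-(w + 1) * (u ^ γ * Real.exp (-((w + 1) * u))) +
      (w + 1) * (u ^ γ * Real.exp (-(w * u))) - w * (u ^ (γ + 1) * Real.exp (-(w * u)))) / γ)
      (Set.Ioi 0) := (hIab.sub (hIc.const_mul w)).div_const γ
  have hI1 : IntegrableOn (f' * v) (Set.Ioi 0) :=
    hIabc.congr_fun (fun u hu => (heq u hu).symm) measurableSet_Ioi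
  have hI2 : IntegrableOn (f * v') (Set.Ioi 0) := by
    refine (integrableOn_rpow_mul_exp_neg (s := γ + 1) (by linarith) hw).mono' ?_ ?_
    · refine Measurable.aestronglyMeasurable ?_
      have : Measurable f := by
        have := continuous_expDefect.measurable
        fun_prop
      fun_prop
    · filter_upwards [ae_restrict_mem measurableSet_Ioi] with u hu
      have hu : 0 < u := hu
      rw [Pi.mul_apply, Real.norm_of_nonneg (mul_nonneg (hfv0 u hu) (by positivity))]
      have h3 : u ^ (γ + 1) = u ^ (γ - 1) * u ^ 2 := by
        rw [← Real.rpow_natCast u 2, ← Real.rpow_add hu]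
        congr 1
        push_cast
        ring
      rw [h3, mul_comm w u]
      have h4 := mul_le_mul_of_nonneg_left (expDefect_le_sq hu.le)
        (mul_nonneg (Real.exp_pos (-(u * w))).le (Real.rpow_nonneg hu.le (γ - 1)))
      simp only [v']
      linarith
  have hbound : ∀ u : ℝ, 0 < u → ‖(f * v) u‖ ≤ |γ|⁻¹ * (u ^ (γ + 1) * Real.exp (-(w * u))) := by
    intro u hu
    have h3 : ‖v u‖ = u ^ γ * |γ|⁻¹ := by
      simp only [v]
      rw [norm_div, Real.norm_of_nonneg (by positivity), Real.norm_eq_abs, div_eq_mul_inv]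
    rw [Pi.mul_apply, norm_mul, h3, Real.norm_of_nonneg (hfv0 u hu), Real.rpow_add_one hu.ne',
      mul_comm w u]
    have h4 := mul_le_mul_of_nonneg_left (expDefect_le_self hu.le)
      (by positivity : 0 ≤ Real.exp (-(u * w)) * (u ^ γ * |γ|⁻¹))
    linarith
  have hzero : Tendsto (f * v) (𝓝[>] 0) (𝓝 0) := by
    have h3 : Tendsto (fun u : ℝ => |γ|⁻¹ * (u ^ (γ + 1) * Real.exp (-(w * u)))) (𝓝 0)
        (𝓝 (|γ|⁻¹ * (0 ^ (γ + 1) * Real.exp (-(w * 0))))) := by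
      refine Tendsto.const_mul _ (Tendsto.mul (tendsto_id.rpow_const (Or.inr (by linarith))) ?_)
      exact Continuous.tendsto (by fun_prop) 0
    rw [Real.zero_rpow (by linarith), zero_mul, mul_zero] at h3
    refine squeeze_zero_norm' ?_ (h3.mono_left nhdsWithin_le_nhds)
    filter_upwards [self_mem_nhdsWithin] with u hu
    exact hbound u hu
  have hinf : Tendsto (f * v) atTop (𝓝 0) := by
    have h3 : Tendsto (fun u : ℝ => |γ|⁻¹ * (u ^ (γ + 1) * Real.exp (-w * u))) atTop
        (𝓝 (|γ|⁻¹ * 0)) := (tendsto_rpow_mul_exp_neg_mul_atTop_nhds_zero (γ + 1) w hw).const_mul _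
    rw [mul_zero] at h3
    refine squeeze_zero_norm' ?_ h3
    filter_upwards [eventually_gt_atTop 0] with u hu
    simpa only [neg_mul] using hbound u hu
  have hparts := integral_Ioi_mul_deriv_eq_deriv_mul hf hv hI2 hI1 hzero hinf
  have hL : ∫ u in Set.Ioi 0, u ^ (γ - 1) * (Real.exp (-(u * w)) * expDefect u) =
      ∫ u in Set.Ioi 0, f u * v' u := by
    refine integral_congr_ae (ae_of_all _ fun u => ?_)
    simp only [f, v']
    ring
  rw [hL, hparts, setIntegral_congr_fun measurableSet_Ioi heq, integral_div,
    integral_sub hIab (hIc.const_mul w), integral_add (hIa.const_mul _) (hIb.const_mul _),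
    integral_const_mul, integral_const_mul, integral_const_mul, integral_rpow_mul_exp_neg h1 hw1,
    integral_rpow_mul_exp_neg h1 hw, integral_rpow_mul_exp_neg (by linarith) hw]
  have hG : Real.Gamma (γ + 1 + 1) = (γ + 1) * Real.Gamma (γ + 1) :=
    Real.Gamma_add_one (by linarith)
  rw [hG, abs_of_neg h2, add_comm 1 γ, add_comm 1 w]
  have e1 : (w + 1) ^ (-γ) = (w + 1) * (w + 1) ^ (-(γ + 1)) := by
    rw [neg_add, ← sub_eq_add_neg, Real.rpow_sub_one hw1.ne']
    field_simp
  have e2 : w ^ (-γ) = w * w ^ (-(γ + 1)) := by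
    rw [neg_add, ← sub_eq_add_neg, Real.rpow_sub_one hw.ne']
    field_simp
  have e3 : w ^ (-(γ + 1)) = w * w ^ (-(γ + 1 + 1)) := by
    have : -(γ + 1 + 1) = -(γ + 1) - 1 := by ring
    rw [this, Real.rpow_sub_one hw.ne']
    field_simp
  rw [e1, e2, e3]
  have hγ : γ ≠ 0 := h2.ne
  field_simp
  ring

/-- Fubini for u^(γ-1) exp(-u‖x‖^δ) (exp(-u) - 1 + u) on the product space: integrating in u gives a
nonzero multiple of the fluctuation integrand, integrating in x gives the Lévy density.
Nonnegativity and integrability of the latter yield the absolute convergence. -/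
theorem fluctuation_aux {d : ℕ} (hd : 0 < d) {γ δ : ℝ} (hδ : 0 < δ) (h1 : -1 < γ) (h2 : γ < 0)
    (hq1 : 1 < (d : ℝ) / δ) (hq2 : (d : ℝ) / δ < γ + 2) :
    Integrable (fluctuationIntegrand γ δ d) ∧
      fluctuationConstant γ δ d =
        expIntegral δ d * ∫ u in Set.Ioi 0, levyDensity (|γ| + d / δ) u := by
  have : NeZero d := ⟨hd.ne'⟩
  have hnt : Nontrivial (EuclideanSpace ℝ (Fin d)) := by
    refine Module.nontrivial_of_finrank_pos (R := ℝ) ?_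
    simpa using hd
  have hγ : |γ| = -γ := abs_of_neg h2
  set p := |γ| + d / δ with hp
  have hp1 : 1 < p := by rw [hp, hγ]; linarith
  have hp2 : p < 2 := by rw [hp, hγ]; linarith
  let F : EuclideanSpace ℝ (Fin d) × ℝ → ℝ := fun z =>
    z.2 ^ (γ - 1) * (Real.exp (-(z.2 * ‖z.1‖ ^ δ)) * expDefect z.2)
  have hFm : Measurable F := by
    have := continuous_expDefect.measurable
    fun_prop
  have hinner : ∀ u ∈ Set.Ioi (0 : ℝ), ∫ x, F (x, u) = expIntegral δ d * levyDensity p u := by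
    intro u hu
    have hu : 0 < u := hu
    have h3 : ∀ x, F (x, u) = (u ^ (γ - 1) * expDefect u) * Real.exp (-(u * ‖x‖ ^ δ)) := fun x => by
      simp only [F]; ring
    simp only [h3]
    rw [integral_const_mul, integral_exp_neg_norm_rpow hδ hu, levyDensity]
    have h4 : u ^ (-p - 1) = u ^ (γ - 1) * u ^ (-(d / δ)) := by
      rw [← Real.rpow_add hu, hp, hγ]
      congr 1
      ring
    rw [h4]
    ring
  have hF0 : ∀ x (u : ℝ), 0 < u → 0 ≤ F (x, u) := fun x u hu =>
    mul_nonneg (Real.rpow_nonneg hu.le _) (mul_nonneg (Real.exp_pos _).le (expDefect_nonneg _))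
  have hFint : Integrable F ((volume : Measure (EuclideanSpace ℝ (Fin d))).prod
      (volume.restrict (Set.Ioi 0))) := by
    rw [integrable_prod_iff' hFm.aestronglyMeasurable]
    constructor
    · filter_upwards [ae_restrict_mem measurableSet_Ioi] with u hu
      have h3 : ∀ x, F (x, u) = (u ^ (γ - 1) * expDefect u) * Real.exp (-(u * ‖x‖ ^ δ)) :=
        fun x => by simp only [F]; ring
      simp only [h3]
      exact (integrable_exp_neg_norm_rpow hd hδ hu).const_mul _
    · have h4 : IntegrableOn (fun u => expIntegral δ d * levyDensity p u) (Set.Ioi 0) :=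
        (integrableOn_levyDensity hp1 hp2).const_mul _
      refine h4.congr_fun (fun u hu => ?_) measurableSet_Ioi
      refine (hinner u hu).symm.trans ?_
      refine integral_congr_ae (ae_of_all _ fun x => ?_)
      exact (Real.norm_of_nonneg (hF0 x u hu)).symm
  have hae : ∀ᵐ x : EuclideanSpace ℝ (Fin d), ∫ u in Set.Ioi 0, F (x, u) =
      -(Real.Gamma (1 + γ) / |γ|) * fluctuationIntegrand γ δ d x := by
    filter_upwards [Measure.ae_ne volume (0 : EuclideanSpace ℝ (Fin d))] with x hx
    have hx' : 0 < ‖x‖ := norm_pos_iff.2 hx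
    have h3 := integral_rpow_mul_expDefect h1 h2 (w := ‖x‖ ^ δ) (by positivity)
    rw [← Real.rpow_mul hx'.le, ← Real.rpow_mul hx'.le] at h3
    simp only [F]
    rw [h3, fluctuationIntegrand, mul_neg]
  have hcpos : -(Real.Gamma (1 + γ) / |γ|) ≠ 0 := by
    have h3 : 0 < Real.Gamma (1 + γ) := Real.Gamma_pos_of_pos (by linarith)
    have h4 : 0 < |γ| := abs_pos.2 h2.ne
    exact neg_ne_zero.2 (by positivity)
  constructor
  · have h5 := hFint.integral_prod_left.congr hae
    exact (integrable_const_mul_iff (isUnit_iff_ne_zero.2 hcpos) _).1 h5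
  · rw [fluctuationConstant, ← integral_const_mul, ← integral_congr_ae hae,
      integral_integral_swap (f := fun x u => F (x, u)) hFint, setIntegral_congr_fun
      measurableSet_Ioi hinner, integral_const_mul]

/-! ### Sums over the lengths of the parts -/

/-- Cells now have length `s`, so integrals of step functions are sums times the mesh. -/
theorem map_natFloor_div {s : ℝ} (hs : 0 < s) :
    (volume.restrict (Set.Ioi (0 : ℝ))).map (fun u => ⌊u / s⌋₊) =
      ENNReal.ofReal s • Measure.count := by
  have hm : Measurable fun u : ℝ => ⌊u / s⌋₊ := Nat.measurable_floor.comp (by fun_prop)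
  refine Measure.ext_of_singleton fun n => ?_
  rw [Measure.map_apply hm (measurableSet_singleton n), Measure.smul_apply,
    Measure.count_singleton, smul_eq_mul, mul_one,
    ← Measure.restrict_congr_set Ioi_ae_eq_Ici.symm, Measure.restrict_apply (hm (measurableSet_singleton n))]
  have h1 : (fun u : ℝ => ⌊u / s⌋₊) ⁻¹' {n} ∩ Set.Ici 0 = Set.Ico (n * s) ((n + 1) * s) := by
    ext u
    simp only [Set.mem_inter_iff, Set.mem_preimage, Set.mem_singleton_iff, Set.mem_Ici, Set.mem_Ico]
    constructor
    · rintro ⟨h2, h3⟩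
      rw [Nat.floor_eq_iff (by positivity), le_div_iff₀ hs, div_lt_iff₀ hs] at h2
      exact h2
    · rintro ⟨h2, h3⟩
      have h4 : 0 ≤ u := le_trans (by positivity) h2
      refine ⟨?_, h4⟩
      rw [Nat.floor_eq_iff (by positivity), le_div_iff₀ hs, div_lt_iff₀ hs]
      exact ⟨h2, h3⟩
  rw [h1, Real.volume_Ico]
  congr 1
  ring

theorem integrableOn_comp_natFloor_iff {s : ℝ} (hs : 0 < s) (g : ℕ → ℝ) :
    IntegrableOn (fun u : ℝ => g ⌊u / s⌋₊) (Set.Ioi 0) ↔ Summable g := by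
  have hm : Measurable fun u : ℝ => ⌊u / s⌋₊ := Nat.measurable_floor.comp (by fun_prop)
  have h1 := integrable_map_measure (μ := volume.restrict (Set.Ioi (0 : ℝ)))
    (f := fun u : ℝ => ⌊u / s⌋₊) (g := g) (measurable_of_countable g).aestronglyMeasurable
    hm.aemeasurable
  rw [map_natFloor_div hs, integrable_smul_measure (by simpa using hs) ENNReal.ofReal_ne_top,
    integrable_count_iff] at h1
  rw [← summable_norm_iff, h1]
  rfl

theorem setIntegral_comp_natFloor {s : ℝ} (hs : 0 < s) {g : ℕ → ℝ} (hg : Summable g) :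
    ∫ u in Set.Ioi (0 : ℝ), g ⌊u / s⌋₊ = s * ∑' n, g n := by
  have hm : Measurable fun u : ℝ => ⌊u / s⌋₊ := Nat.measurable_floor.comp (by fun_prop)
  have h1 := integral_map (μ := volume.restrict (Set.Ioi (0 : ℝ))) (f := g) hm.aemeasurable
    (measurable_of_countable g).aestronglyMeasurable
  rw [← h1, map_natFloor_div hs, integral_smul_measure, ENNReal.toReal_ofReal hs.le,
    integral_countable]
  · simp
  · rw [integrable_count_iff]
    exact hg.norm

/-- A Riemann sum for `levyDensity` with a slowly varying weight. -/
theorem tendsto_riemann_levyDensity {ι : Type*} {l : Filter ι} [l.IsCountablyGenerated] {p : ℝ}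
    (hp1 : 1 < p) (hp2 : p < 2) {K : ℝ → ℝ} {C c₀ : ℝ} (hK0 : ∀ a, 0 < a → 0 ≤ K a)
    (hKC : ∀ a, 0 < a → K a ≤ C) (hK : Tendsto K (𝓝[>] 0) (𝓝 c₀)) {s w : ι → ℝ}
    (hs0 : ∀ᶠ i in l, 0 < s i) (hs : Tendsto s l (𝓝 0)) (hw0 : ∀ᶠ i in l, 0 < w i)
    (hws : Tendsto (fun i => w i / s i) l (𝓝 0)) :
    Tendsto (fun i => s i * ∑' n : ℕ, levyDensity p (s i * (n + 1)) * K ((n + 1) * w i)) l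
      (𝓝 (c₀ * ∫ u in Set.Ioi 0, levyDensity p u)) := by
  let g : ι → ℕ → ℝ := fun i n => levyDensity p (s i * (n + 1)) * K ((n + 1) * w i)
  have hmeas : ∀ i, Measurable fun u : ℝ => g i ⌊u / s i⌋₊ := fun i =>
    (measurable_of_countable (g i)).comp (Nat.measurable_floor.comp (by fun_prop))
  have hbound : ∀ᶠ i in l, ∀ u ∈ Set.Ioi (0 : ℝ), ‖g i ⌊u / s i⌋₊‖ ≤ levyBound p u * C := by
    filter_upwards [hs0, hw0] with i hsi hwi u hu
    have hu : 0 < u := hu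
    have hn : (0 : ℝ) < (⌊u / s i⌋₊ : ℝ) + 1 := by positivity
    have h2 := hK0 (((⌊u / s i⌋₊ : ℝ) + 1) * w i) (by positivity)
    -- The sample is the right endpoint of the cell of u, so the decreasing majorant at u dominates
    -- the value there.
    have h3 : u ≤ s i * ((⌊u / s i⌋₊ : ℝ) + 1) := by
      have := (Nat.lt_floor_add_one (u / s i)).le
      rw [div_le_iff₀ hsi] at this
      linarith
    have h4 : 0 < s i * ((⌊u / s i⌋₊ : ℝ) + 1) := by positivity
    simp only [g]
    rw [Real.norm_of_nonneg (mul_nonneg (levyDensity_nonneg h4.le) h2)]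
    exact mul_le_mul ((levyDensity_le h4).trans (levyBound_anti hp1.le hu h3))
      (hKC _ (by positivity)) h2 (levyBound_nonneg hu.le)
  have hlim : Tendsto (fun i => ∫ u in Set.Ioi (0 : ℝ), g i ⌊u / s i⌋₊) l
      (𝓝 (∫ u in Set.Ioi 0, levyDensity p u * c₀)) := by
    refine tendsto_integral_filter_of_dominated_convergence (fun u => levyBound p u * C)
      (Eventually.of_forall fun i => (hmeas i).aestronglyMeasurable) ?_
      ((integrableOn_levyBound hp1 hp2).mul_const C) ?_
    · filter_upwards [hbound] with i hi
      filter_upwards [ae_restrict_mem measurableSet_Ioi] with u hu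
      exact hi u hu
    · filter_upwards [ae_restrict_mem measurableSet_Ioi] with u hu
      have hu : 0 < u := hu
      have h2 : Tendsto (fun i => s i * ((⌊u / s i⌋₊ : ℝ) + 1)) l (𝓝 u) := by
        have h3 : Tendsto (fun i => u + s i) l (𝓝 (u + 0)) := tendsto_const_nhds.add hs
        rw [add_zero] at h3
        refine tendsto_of_tendsto_of_tendsto_of_le_of_le' tendsto_const_nhds h3 ?_ ?_
        · filter_upwards [hs0] with i hsi
          have := (Nat.lt_floor_add_one (u / s i)).le
          rw [div_le_iff₀ hsi] at this
          linarith
        · filter_upwards [hs0] with i hsi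
          have := Nat.floor_le (a := u / s i) (by positivity)
          rw [le_div_iff₀ hsi] at this
          linarith
      -- The argument of `K` is the sample, which tends to u, times w/s, which tends to 0.
      have h4 : Tendsto (fun i => ((⌊u / s i⌋₊ : ℝ) + 1) * w i) l (𝓝[>] 0) := by
        refine tendsto_nhdsWithin_iff.2 ⟨?_, ?_⟩
        · have h5 := h2.mul hws
          rw [mul_zero] at h5
          refine h5.congr' ?_
          filter_upwards [hs0] with i hsi
          field_simp
        · filter_upwards [hw0] with i hwi
          exact Set.mem_Ioi.2 (by positivity)
      refine Tendsto.mul ?_ (hK.comp h4)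
      have h6 : ContinuousAt (levyDensity p) u := by
        unfold levyDensity
        exact (Real.continuousAt_rpow_const _ _ (Or.inl hu.ne')).mul
          continuous_expDefect.continuousAt
      exact h6.tendsto.comp h2
  rw [integral_mul_const, mul_comm] at hlim
  refine hlim.congr' ?_
  filter_upwards [hs0, hbound] with i hsi hi
  refine setIntegral_comp_natFloor hsi ?_
  rw [← integrableOn_comp_natFloor_iff hsi]
  refine ((integrableOn_levyBound hp1 hp2).mul_const C).mono' (hmeas i).aestronglyMeasurable ?_
  filter_upwards [ae_restrict_mem measurableSet_Ioi] with u hu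
  exact hi u hu

theorem tsum_pnat_succ (f : ℕ → ℝ) : ∑' j : ℕ+, f j = ∑' n : ℕ, f (n + 1) := by
  rw [← Equiv.pnatEquivNat.symm.tsum_eq]
  rfl

/-- The intensity of the parts of length `j` away from the origin. -/
def offIntensity (γ δ : ℝ) (d : ℕ) (L : ℝ) (j : ℕ+) : ℝ :=
  ((j : ℕ) : ℝ) ^ (γ - 1) * latticeSum δ d ((j : ℕ) * L ^ (-δ))

theorem offIntensity_nonneg (γ δ : ℝ) (d : ℕ) (L : ℝ) (j : ℕ+) : 0 ≤ offIntensity γ δ d L j :=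
  mul_nonneg (by positivity) (latticeSum_nonneg _ _ _)

/-- The rescaled lattice sum. -/
def latticeRatio (δ : ℝ) (d : ℕ) (a : ℝ) : ℝ := a ^ (d / δ) * latticeSum δ d a

theorem latticeRatio_nonneg (δ : ℝ) (d : ℕ) {a : ℝ} (ha : 0 < a) : 0 ≤ latticeRatio δ d a :=
  mul_nonneg (by positivity) (latticeSum_nonneg _ _ _)

/-- Isolates the power law j^(-p-1), which holds up to a bounded factor as long as j is at most of
order L^δ. -/
theorem offIntensity_eq {γ δ : ℝ} {d : ℕ} (hδ : 0 < δ) (hγ : γ < 0) {L : ℝ} (hL : 0 < L) (j : ℕ+) :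
    offIntensity γ δ d L j =
      L ^ (d : ℝ) * (((j : ℕ) : ℝ) ^ (-(|γ| + d / δ) - 1) *
        latticeRatio δ d ((j : ℕ) * L ^ (-δ))) := by
  have hj : (0 : ℝ) < (j : ℕ) := by exact_mod_cast j.pos
  have hW : 0 < L ^ (-δ) := by positivity
  rw [offIntensity, latticeRatio, Real.mul_rpow hj.le hW.le, ← Real.rpow_mul hL.le]
  have h1 : L ^ (-δ * (d / δ)) = (L ^ (d : ℝ))⁻¹ := by
    rw [← Real.rpow_neg hL.le]
    congr 1
    field_simp
  have h2 : ((j : ℕ) : ℝ) ^ (γ - 1) = ((j : ℕ) : ℝ) ^ (-(|γ| + d / δ) - 1) *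
      ((j : ℕ) : ℝ) ^ ((d : ℝ) / δ) := by
    rw [← Real.rpow_add hj, abs_of_neg hγ]
    congr 1
    ring
  rw [h1, h2]
  have : L ^ (d : ℝ) ≠ 0 := by positivity
  field_simp

/-! ### Mean and cumulants of the mass off the origin for large L -/

section Limits

variable {γ δ : ℝ} {d : ℕ}

/-- The decay exp(-j L^(-δ)/2) of the lattice sum absorbs exp(sj), leaving the summable power
j^(q-p-1). -/
theorem summable_offIntensity_mul (hd : 0 < d) (hδ : 0 < δ) (hγ : γ < 0) {L s q : ℝ} (hL : 0 < L)
    (hs : s ≤ L ^ (-δ) / 2) (hq : q < |γ| + d / δ) :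
    Summable fun j : ℕ+ => offIntensity γ δ d L j * (((j : ℕ) : ℝ) ^ q * Real.exp (s * (j : ℕ))) := by
  obtain ⟨C, hC0, hC⟩ := exists_latticeSum_le hd hδ
  have h1 : Summable fun j : ℕ+ => L ^ (d : ℝ) * C * ((j : ℕ) : ℝ) ^ (-(|γ| + d / δ) - 1 + q) :=
    (summable_pnat_rpow (by linarith)).mul_left _
  refine Summable.of_nonneg_of_le (fun j => mul_nonneg (offIntensity_nonneg _ _ _ _ _)
    (by positivity)) (fun j => ?_) h1
  have hj : (0 : ℝ) < (j : ℕ) := by exact_mod_cast j.pos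
  have hW : 0 < L ^ (-δ) := by positivity
  rw [offIntensity_eq hδ hγ hL, Real.rpow_add hj]
  have h2 : latticeRatio δ d ((j : ℕ) * L ^ (-δ)) * Real.exp (s * (j : ℕ)) ≤ C := by
    refine (mul_le_mul_of_nonneg_right (hC _ (by positivity)) (Real.exp_pos _).le).trans ?_
    rw [mul_assoc, ← Real.exp_add]
    refine mul_le_of_le_one_right hC0 (Real.exp_le_one_iff.2 ?_)
    nlinarith
  have h3 : 0 ≤ L ^ (d : ℝ) * (((j : ℕ) : ℝ) ^ (-(|γ| + d / δ) - 1) * ((j : ℕ) : ℝ) ^ q) := by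
    positivity
  calc _ = L ^ (d : ℝ) * (((j : ℕ) : ℝ) ^ (-(|γ| + d / δ) - 1) * ((j : ℕ) : ℝ) ^ q) *
        (latticeRatio δ d ((j : ℕ) * L ^ (-δ)) * Real.exp (s * (j : ℕ))) := by ring
    _ ≤ L ^ (d : ℝ) * (((j : ℕ) : ℝ) ^ (-(|γ| + d / δ) - 1) * ((j : ℕ) : ℝ) ^ q) * C :=
        mul_le_mul_of_nonneg_left h2 h3
    _ = _ := by ring

theorem tendsto_rpow_neg_nhdsGT (hδ : 0 < δ) (j : ℕ+) :
    Tendsto (fun L : ℝ => ((j : ℕ) : ℝ) * L ^ (-δ)) atTop (𝓝[>] 0) := by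
  have hj : (0 : ℝ) < (j : ℕ) := by exact_mod_cast j.pos
  refine tendsto_nhdsWithin_iff.2 ⟨?_, ?_⟩
  · have := (tendsto_rpow_neg_atTop hδ).const_mul ((j : ℕ) : ℝ)
    rwa [mul_zero] at this
  · filter_upwards [eventually_gt_atTop 0] with L hL
    exact Set.mem_Ioi.2 (by positivity)

/-- Dominated convergence with the majorant C j^(-p); the limit is the transition density. -/
theorem tendsto_offMean (hd : 0 < d) (hδ : 0 < δ) (hγ : γ < 0) (hp1 : 1 < |γ| + d / δ) :
    Tendsto (fun L : ℝ => (∑' j : ℕ+, ((j : ℕ) : ℝ) * offIntensity γ δ d L j) / L ^ (d : ℝ)) atTop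
      (𝓝 (expIntegral δ d * ∑' j : ℕ+, ((j : ℕ) : ℝ) ^ (-(|γ| + d / δ)))) := by
  obtain ⟨C, hC0, hC⟩ := exists_latticeSum_le hd hδ
  set p := |γ| + d / δ with hp
  have h1 : Tendsto (fun L : ℝ => ∑' j : ℕ+, ((j : ℕ) : ℝ) ^ (-p) *
      latticeRatio δ d ((j : ℕ) * L ^ (-δ))) atTop
      (𝓝 (∑' j : ℕ+, ((j : ℕ) : ℝ) ^ (-p) * expIntegral δ d)) := by
    refine tendsto_tsum_of_dominated_convergence (bound := fun j : ℕ+ => ((j : ℕ) : ℝ) ^ (-p) * C)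
      ((summable_pnat_rpow (by linarith)).mul_right _) ?_ ?_
    · intro j
      exact ((tendsto_latticeSum hd hδ).comp (tendsto_rpow_neg_nhdsGT hδ j)).const_mul _
    · filter_upwards [eventually_gt_atTop 0] with L hL j
      have hj : (0 : ℝ) < (j : ℕ) := by exact_mod_cast j.pos
      have ha : 0 < ((j : ℕ) : ℝ) * L ^ (-δ) := by positivity
      rw [Real.norm_of_nonneg (mul_nonneg (by positivity) (latticeRatio_nonneg _ _ ha))]
      refine mul_le_mul_of_nonneg_left ((hC _ ha).trans ?_) (by positivity)
      exact mul_le_of_le_one_right hC0 (Real.exp_le_one_iff.2 (by linarith))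
  rw [tsum_mul_right, mul_comm] at h1
  refine h1.congr' ?_
  filter_upwards [eventually_gt_atTop 0] with L hL
  have hLd : L ^ (d : ℝ) ≠ 0 := by positivity
  rw [eq_div_iff hLd, mul_comm, ← tsum_mul_left]
  refine tsum_congr fun j => ?_
  have hj : (0 : ℝ) < (j : ℕ) := by exact_mod_cast j.pos
  rw [offIntensity_eq hδ hγ hL, ← hp, Real.rpow_sub_one hj.ne']
  field_simp

/-- This is the cumulant of the centred mass at -t/L^α: a Riemann sum with mesh s = t L^(-α),
weighted by the lattice ratio at j L^(-δ). -/
theorem tendsto_offIntensity_expDefect (hd : 0 < d) (hδ : 0 < δ) (hγ : γ < 0)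
    (hp1 : 1 < |γ| + d / δ) (hp2 : |γ| + d / δ < 2) {t : ℝ} (ht : 0 ≤ t) :
    Tendsto (fun L : ℝ => ∑' j : ℕ+, offIntensity γ δ d L j *
        expDefect (t * L ^ (-((d : ℝ) / (|γ| + d / δ))) * (j : ℕ))) atTop
      (𝓝 (expIntegral δ d * (∫ u in Set.Ioi 0, levyDensity (|γ| + d / δ) u) *
        t ^ (|γ| + d / δ))) := by
  obtain ⟨C, hC0, hC⟩ := exists_latticeSum_le hd hδ
  set p := |γ| + d / δ with hp
  have hp0 : 0 < p := by linarith
  have hd' : (0 : ℝ) < d := by exact_mod_cast hd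
  have hγ0 : 0 < |γ| := abs_pos.2 hγ.ne
  rcases ht.eq_or_lt with rfl | ht
  · simp [expDefect, Real.zero_rpow hp0.ne']
  set α := (d : ℝ) / p with hα
  have hα0 : 0 < α := by positivity
  -- Because pδ = |γ|δ + d > d. Parts of order L^α, which decide the fluctuations, are thus too
  -- short to feel the cutoff at L^δ.
  have hαδ : α < δ := by
    rw [hα, div_lt_iff₀ hp0, hp, mul_add, mul_div_cancel₀ _ hδ.ne']
    nlinarith
  have hs : Tendsto (fun L : ℝ => t * L ^ (-α)) atTop (𝓝 0) := by
    have := (tendsto_rpow_neg_atTop hα0).const_mul t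
    rwa [mul_zero] at this
  have hws : Tendsto (fun L : ℝ => L ^ (-δ) / (t * L ^ (-α))) atTop (𝓝 0) := by
    have h1 := (tendsto_rpow_neg_atTop (sub_pos.2 hαδ)).const_mul t⁻¹
    rw [mul_zero] at h1
    refine h1.congr' ?_
    filter_upwards [eventually_gt_atTop 0] with L hL
    have h2 : L ^ (-δ) = L ^ (-(δ - α)) * L ^ (-α) := by
      rw [← Real.rpow_add hL]; ring_nf
    have : L ^ (-α) ≠ 0 := by positivity
    rw [h2]
    field_simp
  have h1 := tendsto_riemann_levyDensity hp1 hp2 (K := latticeRatio δ d) (C := C)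
    (fun a ha => latticeRatio_nonneg _ _ ha)
    (fun a ha => (hC a ha).trans (mul_le_of_le_one_right hC0 (Real.exp_le_one_iff.2 (by linarith))))
    (tendsto_latticeSum hd hδ)
    ((eventually_gt_atTop 0).mono fun L hL => by positivity) hs
    ((eventually_gt_atTop 0).mono fun L hL => by positivity) hws
  have h2 := h1.mul_const (t ^ p)
  refine h2.congr' ?_
  filter_upwards [eventually_gt_atTop 0] with L hL
  have hsL : 0 < t * L ^ (-α) := by positivity
  have h3 : ∀ j : ℕ+, offIntensity γ δ d L j * expDefect (t * L ^ (-α) * (j : ℕ)) =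
      (fun n : ℕ => t ^ p * (t * L ^ (-α)) * (levyDensity p (t * L ^ (-α) * n) *
        latticeRatio δ d (n * L ^ (-δ)))) j := by
    intro j
    have hj : (0 : ℝ) < (j : ℕ) := by exact_mod_cast j.pos
    rw [offIntensity_eq hδ hγ hL, ← hp]
    simp only [levyDensity]
    rw [Real.mul_rpow hsL.le hj.le]
    -- The choice of α: αp = d makes s^(-p) equal to t^(-p) L^d.
    have h4 : L ^ (d : ℝ) = t ^ p * (t * L ^ (-α)) * (t * L ^ (-α)) ^ (-p - 1) := by
      rw [Real.rpow_sub_one hsL.ne', Real.mul_rpow ht.le (by positivity), ← Real.rpow_mul hL.le,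
        Real.rpow_neg ht.le]
      have h5 : -α * -p = d := by
        rw [hα]; field_simp
      rw [h5]
      have : t ^ p ≠ 0 := by positivity
      have : L ^ (-α) ≠ 0 := by positivity
      field_simp
    rw [h4]
    ring
  rw [tsum_congr h3, tsum_pnat_succ (fun n : ℕ => t ^ p * (t * L ^ (-α)) *
    (levyDensity p (t * L ^ (-α) * n) * latticeRatio δ d (n * L ^ (-δ)))), tsum_mul_left]
  push_cast
  ring

theorem exp_sub_one_sub_le {y : ℝ} (hy : 0 ≤ y) : expDefect (-y) ≤ y ^ 2 * Real.exp y := by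
  have h1 : Real.exp (-y) * Real.exp y = 1 := by rw [← Real.exp_add]; simp
  have h2 := Real.add_one_le_exp (-y)
  have h3 := Real.exp_pos y
  have h4 : Real.exp y - 1 ≤ y * Real.exp y := by nlinarith
  rw [expDefect, neg_neg]
  nlinarith

/-- With y = j L^(-δ)/4 the defect is at most y² exp(y), and the lattice decay exp(-2y) leaves y²
exp(-y). One factor y pays for L^(-δ); the other makes each term vanish, under the majorant C
j^(-p). So this cumulant is negligible against the linear Chernoff gain of order L^(d-δ). -/
theorem tendsto_offIntensity_upper (hd : 0 < d) (hδ : 0 < δ) (hγ : γ < 0)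
    (hp1 : 1 < |γ| + d / δ) :
    Tendsto (fun L : ℝ => (∑' j : ℕ+, offIntensity γ δ d L j *
        expDefect (-(L ^ (-δ) / 4 * (j : ℕ)))) / (L ^ (d : ℝ) * L ^ (-δ))) atTop (𝓝 0) := by
  obtain ⟨C, hC0, hC⟩ := exists_latticeSum_le hd hδ
  set p := |γ| + d / δ with hp
  have hterm : ∀ L : ℝ, 0 < L → ∀ j : ℕ+,
      offIntensity γ δ d L j * expDefect (-(L ^ (-δ) / 4 * (j : ℕ))) / (L ^ (d : ℝ) * L ^ (-δ)) ≤
      C * ((j : ℕ) : ℝ) ^ (-p) * ((L ^ (-δ) / 4 * (j : ℕ)) * Real.exp (-(L ^ (-δ) / 4 * (j : ℕ)))) := by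
    intro L hL j
    have hj : (0 : ℝ) < (j : ℕ) := by exact_mod_cast j.pos
    have hW : 0 < L ^ (-δ) := by positivity
    set y := L ^ (-δ) / 4 * (j : ℕ) with hy
    have hy0 : 0 < y := by positivity
    have hjW : ((j : ℕ) : ℝ) * L ^ (-δ) = 4 * y := by rw [hy]; ring
    have hKy := hC (4 * y) (by positivity)
    rw [offIntensity_eq hδ hγ hL, ← hp, hjW, Real.rpow_sub_one hj.ne', div_le_iff₀ (by positivity)]
    have h1 : latticeRatio δ d (4 * y) * expDefect (-y) ≤ C * (y ^ 2 * Real.exp (-y)) := by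
      refine (mul_le_mul hKy (exp_sub_one_sub_le hy0.le) (expDefect_nonneg _)
        (by positivity)).trans (le_of_eq ?_)
      have : Real.exp (-y) = Real.exp (-(4 * y / 2)) * Real.exp y := by
        rw [← Real.exp_add]; ring_nf
      rw [this]
      ring
    have h2 : 0 ≤ L ^ (d : ℝ) * (((j : ℕ) : ℝ) ^ (-p) / (j : ℕ)) := by positivity
    calc _ = L ^ (d : ℝ) * (((j : ℕ) : ℝ) ^ (-p) / (j : ℕ)) *
          (latticeRatio δ d (4 * y) * expDefect (-y)) := by ring
      _ ≤ L ^ (d : ℝ) * (((j : ℕ) : ℝ) ^ (-p) / (j : ℕ)) * (C * (y ^ 2 * Real.exp (-y))) :=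
          mul_le_mul_of_nonneg_left h1 h2
      _ = C * ((j : ℕ) : ℝ) ^ (-p) * (y * Real.exp (-y)) * (L ^ (d : ℝ) * (y / (j : ℕ))) := by ring
      _ ≤ C * ((j : ℕ) : ℝ) ^ (-p) * (y * Real.exp (-y)) * (L ^ (d : ℝ) * L ^ (-δ)) := by
          refine mul_le_mul_of_nonneg_left (mul_le_mul_of_nonneg_left ?_ (by positivity))
            (by positivity)
          rw [hy, mul_div_assoc, div_self hj.ne']
          linarith
  have hnn : ∀ L : ℝ, 0 < L → ∀ j : ℕ+, 0 ≤
      offIntensity γ δ d L j * expDefect (-(L ^ (-δ) / 4 * (j : ℕ))) / (L ^ (d : ℝ) * L ^ (-δ)) :=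
    fun L hL j => div_nonneg (mul_nonneg (offIntensity_nonneg _ _ _ _ _) (expDefect_nonneg _))
      (by positivity)
  have h1 : Tendsto (fun L : ℝ => ∑' j : ℕ+, offIntensity γ δ d L j *
      expDefect (-(L ^ (-δ) / 4 * (j : ℕ))) / (L ^ (d : ℝ) * L ^ (-δ))) atTop
      (𝓝 (∑' _ : ℕ+, (0 : ℝ))) := by
    refine tendsto_tsum_of_dominated_convergence (bound := fun j : ℕ+ => C * ((j : ℕ) : ℝ) ^ (-p))
      ((summable_pnat_rpow (by linarith)).mul_left _) ?_ ?_
    · intro j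
      have h2 : Tendsto (fun L : ℝ => L ^ (-δ) / 4 * (j : ℕ)) atTop (𝓝 0) := by
        have := ((tendsto_rpow_neg_atTop hδ).div_const 4).mul_const ((j : ℕ) : ℝ)
        simpa using this
      have h3 : Tendsto (fun L : ℝ => C * ((j : ℕ) : ℝ) ^ (-p) * ((L ^ (-δ) / 4 * (j : ℕ)) *
          Real.exp (-(L ^ (-δ) / 4 * (j : ℕ))))) atTop (𝓝 0) := by
        have := (h2.mul ((Real.continuous_exp.tendsto _).comp h2.neg)).const_mul
          (C * ((j : ℕ) : ℝ) ^ (-p))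
        simpa using this
      refine squeeze_zero' ?_ ?_ h3
      · filter_upwards [eventually_gt_atTop 0] with L hL using hnn L hL j
      · filter_upwards [eventually_gt_atTop 0] with L hL using hterm L hL j
    · filter_upwards [eventually_gt_atTop 0] with L hL j
      rw [Real.norm_of_nonneg (hnn L hL j)]
      refine (hterm L hL j).trans (mul_le_of_le_one_right (by positivity) ?_)
      have h2 := Real.add_one_le_exp (L ^ (-δ) / 4 * (j : ℕ))
      rw [Real.exp_neg, ← div_eq_mul_inv, div_le_one (Real.exp_pos _)]
      linarith
  rw [tsum_zero] at h1
  refine h1.congr fun L => ?_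
  rw [tsum_div_const]

end Limits

/-! ### The law of the occupation number of the origin -/

/-- The activity of the parts of length `j` at the site `x`. -/
def siteActivity {d : ℕ} (V : EuclideanSpace ℝ (Fin d) → ℝ) (θ : ℕ+ → ℝ) (L : ℝ) (x : Fin d → ℤ)
    (j : ℕ+) : ℝ :=
  θ j / (j : ℕ) * Real.exp (-((j : ℕ) : ℝ) * V (scaledSite L x))

section General

variable {d : ℕ} {V : EuclideanSpace ℝ (Fin d) → ℝ} {θ : ℕ+ → ℝ} {L : ℝ}

theorem siteActivity_pos (hθ : ∀ j, 0 < θ j) (x : Fin d → ℤ) (j : ℕ+) :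
    0 < siteActivity V θ L x j := by
  have hj : (0 : ℝ) < (j : ℕ) := by exact_mod_cast j.pos
  have := hθ j
  rw [siteActivity]
  positivity

/-- The product structure of the model: k particles at the origin leave n - k for the other sites.
-/
theorem tsum_weight_fiber (hθ : ∀ j, 0 < θ j) (n k : ℕ) :
    ∑' lam : SpatialPartition d n, {lam : SpatialPartition d n | occupation 0 lam = k}.indicator
      (fun lam => ENNReal.ofReal (weight V θ L lam)) lam =
      if k ≤ n then clusterCoeff (siteActivity V θ L 0) k *
        configCoeff (offSite 0 (siteActivity V θ L)) (n - k) else 0 := by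
  let G : ((Fin d → ℤ) →₀ Multiset ℕ+) → ℝ≥0∞ :=
    {r : (Fin d → ℤ) →₀ Multiset ℕ+ | clusterMass (r 0) = k}.indicator
      fun r => ENNReal.ofReal (configWeight (siteActivity V θ L) r)
  have h1 : ∑' lam : SpatialPartition d n,
      {lam : SpatialPartition d n | occupation 0 lam = k}.indicator
      (fun lam => ENNReal.ofReal (weight V θ L lam)) lam =
      ∑' r, {r : (Fin d → ℤ) →₀ Multiset ℕ+ | configMass r = n}.indicator G r :=
    tsum_subtype {r : (Fin d → ℤ) →₀ Multiset ℕ+ | configMass r = n} G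
  rw [h1]
  split_ifs with hk
  · rw [← tsum_configWeight_split 0 (fun x j => (siteActivity_pos hθ x j).le)]
    refine tsum_congr fun r => ?_
    simp only [G, Set.indicator_indicator]
    congr 1
    ext r
    simp only [Set.mem_inter_iff, Set.mem_ofPred_eq]
    have := configMass_split 0 r
    omega
  · rw [ENNReal.tsum_eq_zero]
    intro r
    simp only [G, Set.indicator_indicator]
    rw [Set.indicator_of_notMem]
    simp only [Set.mem_inter_iff, Set.mem_ofPred_eq]
    have := configMass_split 0 r
    omega

theorem partitionFunction_eq (hθ : ∀ j, 0 < θ j) (n : ℕ) :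
    partitionFunction V θ L n = ∑ k ∈ Finset.range (n + 1),
      clusterCoeff (siteActivity V θ L 0) k *
        configCoeff (offSite 0 (siteActivity V θ L)) (n - k) := by
  have h1 := tsum_fiber_mul (fun lam : SpatialPartition d n => occupation 0 lam)
    (fun lam => ENNReal.ofReal (weight V θ L lam)) 1
  simp only [Pi.one_apply, mul_one] at h1
  rw [partitionFunction, ← h1, tsum_congr (fun k => tsum_weight_fiber hθ n k),
    tsum_eq_sum (s := Finset.range (n + 1))]
  · refine Finset.sum_congr rfl fun k hk => if_pos ?_
    have := Finset.mem_range.1 hk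
    omega
  · intro k hk
    refine if_neg ?_
    simp only [Finset.mem_range] at hk
    omega

theorem partitionFunction_ne_zero (hθ : ∀ j, 0 < θ j) (n : ℕ) :
    partitionFunction V θ L n ≠ 0 := by
  -- n parts of size 1 at the origin, a configuration of positive weight.
  let lam : SpatialPartition d n := ⟨Finsupp.single 0 (Multiset.replicate n 1), by
    rw [Finsupp.sum_single_index] <;> simp⟩
  intro h0
  have h1 := ENNReal.tsum_eq_zero.1 h0 lam
  rw [ENNReal.ofReal_eq_zero] at h1
  exact absurd (configWeight_pos (fun x j => siteActivity_pos (V := V) (L := L) hθ x j) lam.1)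
    (not_lt.2 h1)

theorem clusterMass_eq_zero {s : Multiset ℕ+} (h : clusterMass s = 0) : s = 0 := by
  by_contra h0
  obtain ⟨j, hj⟩ := Multiset.exists_mem_of_ne_zero h0
  have h1 : (j : ℕ) ≤ clusterMass s :=
    Multiset.single_le_sum (fun _ _ => Nat.zero_le _) _ (Multiset.mem_map_of_mem _ hj)
  have := j.pos
  omega

theorem configMass_eq_zero {X : Type*} {r : X →₀ Multiset ℕ+} (h : configMass r = 0) : r = 0 := by
  ext1 x
  by_contra h0
  have h1 : clusterMass (r x) ≤ configMass r :=
    Finset.single_le_sum (f := fun x => clusterMass (r x)) (fun _ _ => Nat.zero_le _)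
      (Finsupp.mem_support_iff.2 h0)
  exact h0 (clusterMass_eq_zero (by omega))

/-- Holds for every `L`. It is needed for n = 0, where the system length is 0 and the summability
estimates, which ask for L > 0, do not apply. -/
theorem partitionFunction_zero_ne_top : partitionFunction V θ L 0 ≠ ∞ := by
  have : Subsingleton (SpatialPartition d 0) := ⟨fun a b => Subtype.ext
    ((configMass_eq_zero a.2).trans (configMass_eq_zero b.2).symm)⟩
  let e : SpatialPartition d 0 := ⟨0, by simp⟩
  rw [partitionFunction, tsum_eq_single e fun b hb => absurd (Subsingleton.elim b e) hb]
  exact ENNReal.ofReal_ne_top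

theorem isProbabilityMeasure_canonicalMeasure (hθ : ∀ j, 0 < θ j) {n : ℕ}
    (hfin : partitionFunction V θ L n ≠ ∞) :
    IsProbabilityMeasure (canonicalMeasure V θ L n) := by
  constructor
  rw [canonicalMeasure, Measure.smul_apply, Measure.sum_apply _ MeasurableSet.univ]
  simp only [Measure.smul_apply, measure_univ, smul_eq_mul, mul_one]
  exact ENNReal.inv_mul_cancel (partitionFunction_ne_zero hθ n) hfin

theorem canonicalMeasure_fiber (hθ : ∀ j, 0 < θ j) (n k : ℕ) :
    canonicalMeasure V θ L n {lam | occupation 0 lam = k} =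
      (partitionFunction V θ L n)⁻¹ * if k ≤ n then clusterCoeff (siteActivity V θ L 0) k *
        configCoeff (offSite 0 (siteActivity V θ L)) (n - k) else 0 := by
  have hm : MeasurableSet {lam : SpatialPartition d n | occupation 0 lam = k} :=
    MeasurableSpace.measurableSet_top
  rw [canonicalMeasure, Measure.smul_apply, Measure.sum_apply _ hm, smul_eq_mul,
    ← tsum_weight_fiber hθ]
  congr 1
  refine tsum_congr fun lam => ?_
  rw [Measure.smul_apply, Measure.dirac_apply' _ hm, smul_eq_mul]
  by_cases h : occupation 0 lam = k
  · simp [h]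
  · simp [h]

/-- Averages of functions of the occupation number of the origin. -/
theorem integral_occupation (hθ : ∀ j, 0 < θ j) {n : ℕ}
    (hfin : partitionFunction V θ L n ≠ ∞) {f : ℕ → ℝ} {C : ℝ} (hf : ∀ k, |f k| ≤ C) :
    ∫ lam, f (occupation 0 lam) ∂(canonicalMeasure V θ L n) =
      (∑ k ∈ Finset.range (n + 1), (clusterCoeff (siteActivity V θ L 0) k *
        configCoeff (offSite 0 (siteActivity V θ L)) (n - k)).toReal * f k) /
      ∑ k ∈ Finset.range (n + 1), (clusterCoeff (siteActivity V θ L 0) k *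
        configCoeff (offSite 0 (siteActivity V θ L)) (n - k)).toReal := by
  have := isProbabilityMeasure_canonicalMeasure hθ hfin
  have hocc : Measurable (occupation (d := d) (n := n) 0) := measurable_from_top
  have : IsProbabilityMeasure ((canonicalMeasure V θ L n).map (occupation 0)) :=
    Measure.isProbabilityMeasure_map hocc.aemeasurable
  rw [← integral_map hocc.aemeasurable (measurable_of_countable f).aestronglyMeasurable,
    integral_countable (Integrable.of_bound (measurable_of_countable f).aestronglyMeasurable C
      (ae_of_all _ hf))]
  have h1 : ∀ k, ((canonicalMeasure V θ L n).map (occupation 0)).real {k} • f k =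
      (partitionFunction V θ L n).toReal⁻¹ * if k ≤ n then
        (clusterCoeff (siteActivity V θ L 0) k *
          configCoeff (offSite 0 (siteActivity V θ L)) (n - k)).toReal * f k else 0 := by
    intro k
    rw [measureReal_def, Measure.map_apply hocc (measurableSet_singleton k)]
    have : occupation 0 ⁻¹' {k} = {lam : SpatialPartition d n | occupation 0 lam = k} := rfl
    rw [this, canonicalMeasure_fiber hθ, ENNReal.toReal_mul, ENNReal.toReal_inv, smul_eq_mul]
    split_ifs
    · ring
    · simp
  have hterm : ∀ k ∈ Finset.range (n + 1), clusterCoeff (siteActivity V θ L 0) k *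
        configCoeff (offSite 0 (siteActivity V θ L)) (n - k) ≠ ∞ := by
    rw [partitionFunction_eq hθ] at hfin
    intro k hk
    exact (ENNReal.sum_lt_top.1 (lt_top_iff_ne_top.2 hfin) k hk).ne
  rw [tsum_congr h1, tsum_mul_left, tsum_eq_sum (s := Finset.range (n + 1)),
    partitionFunction_eq hθ, ENNReal.toReal_sum hterm, inv_mul_eq_div]
  · congr 1
    refine Finset.sum_congr rfl fun k hk => if_pos ?_
    have := Finset.mem_range.1 hk
    omega
  · intro k hk
    refine if_neg ?_
    simp only [Finset.mem_range] at hk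
    omega

end General

/-! ### The law of the mass away from the origin -/

/-- The law on `ℕ` with weights proportional to the coefficients `configCoeff c`. -/
def massLaw {X : Type*} (c : X → ℕ+ → ℝ) : Measure ℕ :=
  Measure.sum fun m => (configCoeff c m *
    ENNReal.ofReal (Real.exp (-∑' p : X × ℕ+, c p.1 p.2))) • Measure.dirac m

theorem lintegral_massLaw {X : Type*} (c : X → ℕ+ → ℝ) (f : ℕ → ℝ≥0∞) :
    ∫⁻ m, f m ∂(massLaw c) = ∑' m, configCoeff c m *
      ENNReal.ofReal (Real.exp (-∑' p : X × ℕ+, c p.1 p.2)) * f m := by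
  rw [massLaw, lintegral_sum_measure]
  simp [lintegral_smul_measure]

/-- The compound Poisson generating function; it is the only route by which moments of the mass are
computed. -/
theorem lintegral_pow_massLaw {X : Type*} {c : X → ℕ+ → ℝ} (hc : ∀ x j, 0 ≤ c x j) {z : ℝ}
    (hz : 0 ≤ z) (hs : Summable fun p : X × ℕ+ => z ^ (p.2 : ℕ) * c p.1 p.2) :
    ∫⁻ m, ENNReal.ofReal (z ^ m) ∂(massLaw c) = ENNReal.ofReal (Real.exp
      (∑' p : X × ℕ+, z ^ (p.2 : ℕ) * c p.1 p.2 - ∑' p : X × ℕ+, c p.1 p.2)) := by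
  rw [lintegral_massLaw, sub_eq_add_neg, Real.exp_add, ENNReal.ofReal_mul (Real.exp_pos _).le,
    ← tsum_configCoeff_mul_pow hc hz hs, ← ENNReal.tsum_mul_right]
  exact tsum_congr fun m => by ring

theorem isProbabilityMeasure_massLaw {X : Type*} {c : X → ℕ+ → ℝ} (hc : ∀ x j, 0 ≤ c x j)
    (hs : Summable fun p : X × ℕ+ => c p.1 p.2) : IsProbabilityMeasure (massLaw c) := by
  constructor
  have h1 := lintegral_pow_massLaw hc zero_le_one (by simpa using hs)
  simpa using h1

theorem configCoeff_ne_top {X : Type*} {c : X → ℕ+ → ℝ} (hc : ∀ x j, 0 ≤ c x j)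
    (hs : Summable fun p : X × ℕ+ => c p.1 p.2) (m : ℕ) : configCoeff c m ≠ ∞ := by
  have h1 := tsum_configCoeff_mul_pow hc zero_le_one (by simpa using hs)
  simp only [one_pow, ENNReal.ofReal_one, mul_one, one_mul] at h1
  exact ((ENNReal.le_tsum m).trans_lt (h1 ▸ ENNReal.ofReal_lt_top)).ne

/-- The change of variable k = n - m, which reads a sum over occupations of the origin as an
integral over the mass elsewhere. -/
theorem integral_massLaw_eq_sum {X : Type*} {c : X → ℕ+ → ℝ} (hc : ∀ x j, 0 ≤ c x j)
    (hs : Summable fun p : X × ℕ+ => c p.1 p.2) (n : ℕ) (f : ℕ → ℝ) :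
    ∫ m, (if m ≤ n then f (n - m) else 0) ∂(massLaw c) =
      Real.exp (-∑' p : X × ℕ+, c p.1 p.2) *
        ∑ k ∈ Finset.range (n + 1), (configCoeff c (n - k)).toReal * f k := by
  rw [massLaw, integral_sum_dirac fun m => ENNReal.mul_ne_top (configCoeff_ne_top hc hs m)
    ENNReal.ofReal_ne_top, tsum_eq_sum (s := Finset.range (n + 1)), ← Finset.sum_range_reflect,
    Finset.mul_sum]
  · refine Finset.sum_congr rfl fun k hk => ?_
    have hk := Finset.mem_range.1 hk
    have h1 : n + 1 - 1 - k = n - k := by omega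
    have h2 : n - (n - k) = k := by omega
    rw [h1, if_pos (by omega), h2, ENNReal.toReal_mul, ENNReal.toReal_ofReal (Real.exp_pos _).le,
      smul_eq_mul]
    ring
  · intro m hm
    rw [if_neg, smul_zero]
    simp only [Finset.mem_range] at hm
    omega

/-! ### Power-law potential and activities -/

/-- The potential `‖x‖ ^ δ`. -/
def normPotential (δ : ℝ) (d : ℕ) (x : EuclideanSpace ℝ (Fin d)) : ℝ := ‖x‖ ^ δ

/-- The parameters `j ^ γ`. -/
def powerWeight (γ : ℝ) (j : ℕ+) : ℝ := ((j : ℕ) : ℝ) ^ γ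

theorem powerWeight_pos (γ : ℝ) (j : ℕ+) : 0 < powerWeight γ j := by
  have hj : (0 : ℝ) < (j : ℕ) := by exact_mod_cast j.pos
  exact Real.rpow_pos_of_pos hj _

section Model

variable {γ δ : ℝ} {d : ℕ}

theorem siteActivity_zero (hδ : 0 < δ) (L : ℝ) :
    siteActivity (normPotential δ d) (powerWeight γ) L 0 =
      fun j : ℕ+ => ((j : ℕ) : ℝ) ^ (γ - 1) := by
  ext j
  have hj : (0 : ℝ) < (j : ℕ) := by exact_mod_cast j.pos
  have h0 : scaledSite L (0 : Fin d → ℤ) = 0 := by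
    ext i
    simp [scaledSite]
  simp [siteActivity, h0, normPotential, Real.zero_rpow hδ.ne', powerWeight,
    Real.rpow_sub_one hj.ne']

/-- The activities away from the origin. -/
def offActivity (γ δ : ℝ) (d : ℕ) (L : ℝ) : (Fin d → ℤ) → ℕ+ → ℝ :=
  offSite 0 (siteActivity (normPotential δ d) (powerWeight γ) L)

theorem offActivity_eq {L : ℝ} (hL : 0 < L) (x : Fin d → ℤ) (j : ℕ+) :
    offActivity γ δ d L x j = ((j : ℕ) : ℝ) ^ (γ - 1) *
      if x = 0 then 0 else Real.exp (-((j : ℕ) * L ^ (-δ) * ‖scaledSite 1 x‖ ^ δ)) := by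
  have hj : (0 : ℝ) < (j : ℕ) := by exact_mod_cast j.pos
  rw [offActivity, offSite]
  split_ifs with hx
  · simp
  · rw [siteActivity, normPotential, norm_scaledSite_rpow hL, powerWeight,
      Real.rpow_sub_one hj.ne', neg_mul, mul_assoc]

theorem offActivity_nonneg (L : ℝ) (x : Fin d → ℤ) (j : ℕ+) : 0 ≤ offActivity γ δ d L x j := by
  rw [offActivity, offSite]
  split_ifs
  · exact le_rfl
  · exact (siteActivity_pos (powerWeight_pos γ) x j).le

theorem hasSum_offActivity (hd : 0 < d) (hδ : 0 < δ) {L : ℝ} (hL : 0 < L) (j : ℕ+) :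
    HasSum (fun x => offActivity γ δ d L x j) (offIntensity γ δ d L j) := by
  have hj : (0 : ℝ) < (j : ℕ) := by exact_mod_cast j.pos
  simp only [offActivity_eq hL]
  exact (summable_latticeSum hd hδ (by positivity)).hasSum.mul_left _

/-- Terms are nonnegative, so sites may be summed first for each part size. -/
theorem hasSum_pow_mul_offActivity (hd : 0 < d) (hδ : 0 < δ) (hγ : γ < 0) {L s : ℝ} (hL : 0 < L)
    (hs : s ≤ L ^ (-δ) / 2) :
    HasSum (fun p : (Fin d → ℤ) × ℕ+ => Real.exp s ^ (p.2 : ℕ) * offActivity γ δ d L p.1 p.2)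
      (∑' j : ℕ+, offIntensity γ δ d L j * Real.exp (s * (j : ℕ))) := by
  have hp : 0 < |γ| + d / δ := by
    have := abs_pos.2 hγ.ne
    positivity
  have hexp : ∀ j : ℕ+, Real.exp s ^ (j : ℕ) = Real.exp (s * (j : ℕ)) := fun j => by
    rw [← Real.exp_nat_mul, mul_comm]
  have h1 : ∀ j : ℕ+, HasSum (fun x => Real.exp s ^ (j : ℕ) * offActivity γ δ d L x j)
      (offIntensity γ δ d L j * Real.exp (s * (j : ℕ))) := fun j => by
    rw [mul_comm, ← hexp]
    exact (hasSum_offActivity hd hδ hL j).mul_left _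
  let f : ℕ+ × (Fin d → ℤ) → ℝ := fun p => Real.exp s ^ (p.1 : ℕ) * offActivity γ δ d L p.2 p.1
  have hf : Summable f := by
    refine (summable_prod_of_nonneg fun p => mul_nonneg (by positivity)
      (offActivity_nonneg _ _ _)).2 ⟨fun j => (h1 j).summable, ?_⟩
    have h2 : (fun j : ℕ+ => ∑' x, f (j, x)) =
        fun j => offIntensity γ δ d L j * Real.exp (s * (j : ℕ)) :=
      funext fun j => (h1 j).tsum_eq
    rw [h2]
    simpa using summable_offIntensity_mul (q := 0) hd hδ hγ hL hs hp
  have h3 : ∑' p, f p = ∑' j : ℕ+, offIntensity γ δ d L j * Real.exp (s * (j : ℕ)) := by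
    rw [hf.tsum_prod]
    exact tsum_congr fun j => (h1 j).tsum_eq
  have h4 : HasSum (f ∘ Equiv.prodComm (Fin d → ℤ) ℕ+) (∑' p, f p) :=
    (Equiv.prodComm (Fin d → ℤ) ℕ+).hasSum_iff.2 hf.hasSum
  rw [h3] at h4
  exact h4

theorem hasSum_offActivity_prod (hd : 0 < d) (hδ : 0 < δ) (hγ : γ < 0) {L : ℝ} (hL : 0 < L) :
    HasSum (fun p : (Fin d → ℤ) × ℕ+ => offActivity γ δ d L p.1 p.2)
      (∑' j : ℕ+, offIntensity γ δ d L j) := by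
  simpa using hasSum_pow_mul_offActivity (s := 0) hd hδ hγ hL (by positivity)

/-- The mean mass away from the origin. -/
def offMean (γ δ : ℝ) (d : ℕ) (L : ℝ) : ℝ := ∑' j : ℕ+, ((j : ℕ) : ℝ) * offIntensity γ δ d L j

theorem summable_offMean (hd : 0 < d) (hδ : 0 < δ) (hγ : γ < 0) (hp : 1 < |γ| + d / δ) {L : ℝ}
    (hL : 0 < L) : Summable fun j : ℕ+ => ((j : ℕ) : ℝ) * offIntensity γ δ d L j := by
  have h := summable_offIntensity_mul (q := 1) (s := 0) hd hδ hγ hL (by positivity) hp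
  simpa [mul_comm] using h

/-- The exponential moments of the centred mass away from the origin. -/
theorem integral_exp_massLaw (hd : 0 < d) (hδ : 0 < δ) (hγ : γ < 0) (hp : 1 < |γ| + d / δ)
    {L s : ℝ} (hL : 0 < L) (hs : s ≤ L ^ (-δ) / 2) :
    Integrable (fun m : ℕ => Real.exp (s * (m - offMean γ δ d L))) (massLaw (offActivity γ δ d L)) ∧
      ∫ m : ℕ, Real.exp (s * (m - offMean γ δ d L)) ∂(massLaw (offActivity γ δ d L)) =
        Real.exp (∑' j : ℕ+, offIntensity γ δ d L j * expDefect (-(s * (j : ℕ)))) := by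
  have h0 := hasSum_offActivity_prod hd hδ hγ hL
  have h1 := hasSum_pow_mul_offActivity hd hδ hγ hL hs
  have h2 := lintegral_pow_massLaw (c := offActivity γ δ d L) (fun x j => offActivity_nonneg L x j)
    (Real.exp_pos s).le h1.summable
  have hp0 : 0 < |γ| + d / δ := by linarith
  have hS1 : Summable fun j : ℕ+ => offIntensity γ δ d L j * Real.exp (s * (j : ℕ)) := by
    simpa using summable_offIntensity_mul (q := 0) hd hδ hγ hL hs hp0
  have hS0 : Summable fun j : ℕ+ => offIntensity γ δ d L j := by
    simpa using summable_offIntensity_mul (q := 0) (s := 0) hd hδ hγ hL (by positivity) hp0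
  have hSm := summable_offMean hd hδ hγ hp hL
  have hexp : ∀ m : ℕ, Real.exp (s * (m - offMean γ δ d L)) =
      Real.exp (-(s * offMean γ δ d L)) * Real.exp s ^ m := fun m => by
    rw [← Real.exp_nat_mul, ← Real.exp_add]
    ring_nf
  have hval : ∑' j : ℕ+, offIntensity γ δ d L j * expDefect (-(s * (j : ℕ))) =
      -(s * offMean γ δ d L) + (∑' j : ℕ+, offIntensity γ δ d L j * Real.exp (s * (j : ℕ)) -
        ∑' j : ℕ+, offIntensity γ δ d L j) := by
    rw [offMean, ← tsum_mul_left, ← tsum_neg, ← hS1.tsum_sub hS0,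
      ← (hSm.mul_left s).neg.tsum_add (hS1.sub hS0)]
    refine tsum_congr fun j => ?_
    rw [expDefect, neg_neg]
    ring
  rw [h0.tsum_eq, h1.tsum_eq] at h2
  have hint : Integrable (fun m : ℕ => Real.exp s ^ m) (massLaw (offActivity γ δ d L)) := by
    refine ⟨(measurable_of_countable _).aestronglyMeasurable, ?_⟩
    rw [hasFiniteIntegral_iff_ofReal (ae_of_all _ fun m => by positivity), h2]
    exact ENNReal.ofReal_lt_top
  simp only [hexp]
  refine ⟨hint.const_mul _, ?_⟩
  rw [integral_const_mul, integral_eq_lintegral_of_nonneg_ae (ae_of_all _ fun m => by positivity)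
    hint.1, h2, ENNReal.toReal_ofReal (Real.exp_pos _).le, ← Real.exp_add, hval]

/-! ### Critical quantities -/

theorem lintegral_exp_neg_normPotential (hd : 0 < d) (hδ : 0 < δ) (j : ℕ+) :
    ∫⁻ x : EuclideanSpace ℝ (Fin d), ENNReal.ofReal
      (Real.exp (-((j : ℕ) : ℝ) * normPotential δ d x)) =
      ENNReal.ofReal (((j : ℕ) : ℝ) ^ (-(d / δ)) * expIntegral δ d) := by
  have hj : (0 : ℝ) < (j : ℕ) := by exact_mod_cast j.pos
  rw [← integral_exp_neg_norm_rpow hδ hj, ofReal_integral_eq_lintegral_ofReal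
    (integrable_exp_neg_norm_rpow hd hδ hj) (ae_of_all _ fun _ => (Real.exp_pos _).le)]
  simp [normPotential]

theorem density_eq (hd : 0 < d) (hδ : 0 < δ) (hγ : γ < 0) (z : ℝ≥0∞) :
    density (normPotential δ d) (powerWeight γ) z =
      ∑' j : ℕ+, ENNReal.ofReal (expIntegral δ d * ((j : ℕ) : ℝ) ^ (-(|γ| + d / δ))) *
        z ^ (j : ℕ) := by
  refine tsum_congr fun j => ?_
  have hj : (0 : ℝ) < (j : ℕ) := by exact_mod_cast j.pos
  rw [lintegral_exp_neg_normPotential hd hδ, mul_right_comm, ← ENNReal.ofReal_mul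
    (powerWeight_pos γ j).le, powerWeight, ← mul_assoc, ← Real.rpow_add hj, abs_of_neg hγ]
  congr 2
  rw [mul_comm]
  congr 2
  ring

theorem density_one (hd : 0 < d) (hδ : 0 < δ) (hγ : γ < 0) (hp : 1 < |γ| + d / δ) :
    density (normPotential δ d) (powerWeight γ) 1 =
      ENNReal.ofReal (expIntegral δ d * ∑' j : ℕ+, ((j : ℕ) : ℝ) ^ (-(|γ| + d / δ))) := by
  have h0 := (expIntegral_pos hd hδ).le
  rw [density_eq hd hδ hγ, ← tsum_mul_left, ENNReal.ofReal_tsum_of_nonneg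
    (fun j => by positivity) ((summable_pnat_rpow (by linarith)).mul_left _)]
  simp

/-- The coefficients are a constant times j^(-p) with p > 1: the series converges at 1, while for y
> 1 the terms y^j j^(-p) are unbounded. -/
theorem criticalFugacity_eq (hd : 0 < d) (hδ : 0 < δ) (hγ : γ < 0) (hp : 1 < |γ| + d / δ) :
    criticalFugacity (normPotential δ d) (powerWeight γ) = 1 := by
  refine le_antisymm (sSup_le fun z hz => ?_) (le_sSup ?_)
  · by_contra h1
    rw [not_le] at h1
    -- A finite y is interposed because z may be ∞.
    obtain ⟨y, hy1, hyz⟩ := ENNReal.lt_iff_exists_nnreal_btwn.1 h1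
    have hy1' : (1 : ℝ) < y := by exact_mod_cast hy1
    have h2 : density (normPotential δ d) (powerWeight γ) y < ∞ := by
      refine lt_of_le_of_lt (ENNReal.tsum_le_tsum fun j => ?_) hz
      gcongr
    rw [density_eq hd hδ hγ] at h2
    have h0 := expIntegral_pos hd hδ
    have h3 : ∀ j : ℕ+, ENNReal.ofReal (expIntegral δ d * ((j : ℕ) : ℝ) ^ (-(|γ| + d / δ))) *
        (y : ℝ≥0∞) ^ (j : ℕ) = ENNReal.ofReal (expIntegral δ d *
          ((j : ℕ) : ℝ) ^ (-(|γ| + d / δ)) * (y : ℝ) ^ (j : ℕ)) := fun j => by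
      rw [← ENNReal.ofReal_coe_nnreal, ← ENNReal.ofReal_pow y.coe_nonneg,
        ← ENNReal.ofReal_mul (by positivity)]
    rw [tsum_congr h3] at h2
    have h4 := ENNReal.summable_toReal h2.ne
    have h5 : Tendsto (fun n : ℕ => (ENNReal.ofReal (expIntegral δ d *
        (((n.succPNat : ℕ+) : ℕ) : ℝ) ^ (-(|γ| + d / δ)) * (y : ℝ) ^ ((n.succPNat : ℕ+) : ℕ))).toReal)
        atTop (𝓝 0) := by
      have := (Equiv.pnatEquivNat.symm.summable_iff.2 h4).tendsto_atTop_zero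
      exact this
    have h6 : Tendsto (fun n : ℕ => (y : ℝ) ^ (n : ℕ) / ((n : ℝ) ^ ((|γ| + d / δ)))) atTop atTop := by
      have h7 := tendsto_exp_mul_div_rpow_atTop (|γ| + d / δ) (Real.log y) (Real.log_pos hy1')
      refine (h7.comp tendsto_natCast_atTop_atTop).congr fun n => ?_
      simp only [Function.comp]
      rw [mul_comm, Real.exp_nat_mul, Real.exp_log (by linarith)]
    have h8 : Tendsto (fun n : ℕ => expIntegral δ d *
        ((y : ℝ) ^ (n + 1) / (((n + 1 : ℕ) : ℝ) ^ ((|γ| + d / δ))))) atTop atTop :=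
      (h6.comp (tendsto_add_atTop_nat 1)).const_mul_atTop h0
    refine not_tendsto_atTop_of_tendsto_nhds h5 (h8.congr fun n => ?_)
    rw [ENNReal.toReal_ofReal (by positivity), Nat.succPNat_coe, Real.rpow_neg (by positivity)]
    simp only [Nat.succ_eq_add_one]
    ring
  · rw [Set.mem_ofPred_eq, density_one hd hδ hγ hp]
    exact ENNReal.ofReal_lt_top

theorem criticalDensity_eq (hd : 0 < d) (hδ : 0 < δ) (hγ : γ < 0) (hp : 1 < |γ| + d / δ) :
    criticalDensity (normPotential δ d) (powerWeight γ) =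
      ENNReal.ofReal (expIntegral δ d * ∑' j : ℕ+, ((j : ℕ) : ℝ) ^ (-(|γ| + d / δ))) := by
  rw [criticalDensity, criticalFugacity_eq hd hδ hγ hp, density_one hd hδ hγ hp]

theorem lintegral_natCast_poissonMeasure (r : ℝ≥0) :
    ∫⁻ n : ℕ, (n : ℝ≥0∞) ∂(poissonMeasure r) = r := by
  rw [lintegral_countable']
  simp only [poissonMeasure_singleton]
  rw [tsum_eq_zero_add' ENNReal.summable]
  have h1 : ∀ n : ℕ, ((n + 1 : ℕ) : ℝ≥0∞) *
      ENNReal.ofReal (Real.exp (-r) * r ^ (n + 1) / (n + 1)!) =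
      (r : ℝ≥0∞) * ENNReal.ofReal (Real.exp (-r) * r ^ n / n !) := by
    intro n
    rw [← ENNReal.ofReal_natCast, ← ENNReal.ofReal_coe_nnreal, ← ENNReal.ofReal_mul (by positivity),
      ← ENNReal.ofReal_mul (by positivity), Nat.factorial_succ]
    congr 1
    push_cast
    field_simp
    ring
  have h2 := hasSum_one_poissonMeasure r
  rw [tsum_congr h1, ENNReal.tsum_mul_left, ← ENNReal.ofReal_tsum_of_nonneg
    (fun n => by positivity) h2.summable, h2.tsum_eq]
  simp

theorem lintegral_particlesOffOrigin (P : Measure ((Fin d → ℤ) × ℕ+ → ℕ)) :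
    ∫⁻ R, particlesOffOrigin R ∂P = ∑' x : {x : Fin d → ℤ // x ≠ 0}, ∑' j : ℕ+,
      ((j : ℕ) : ℝ≥0∞) * ∫⁻ R, (R (x.1, j) : ℝ≥0∞) ∂P := by
  have hmeas₀ : ∀ p : (Fin d → ℤ) × ℕ+, Measurable fun R : (Fin d → ℤ) × ℕ+ → ℕ =>
      (R p : ℝ≥0∞) := fun p =>
    (measurable_of_countable fun n : ℕ => (n : ℝ≥0∞)).comp (measurable_pi_apply p)
  have hmeas : ∀ (x : Fin d → ℤ) (j : ℕ+), Measurable fun R : (Fin d → ℤ) × ℕ+ → ℕ =>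
      ((j : ℕ) : ℝ≥0∞) * (R (x, j) : ℝ≥0∞) := fun x j => (hmeas₀ (x, j)).const_mul _
  have hmeas' : ∀ x : Fin d → ℤ, Measurable fun R : (Fin d → ℤ) × ℕ+ → ℕ =>
      ∑' j : ℕ+, ((j : ℕ) : ℝ≥0∞) * (R (x, j) : ℝ≥0∞) := fun x =>
    Measurable.tsum fun j => hmeas x j
  unfold particlesOffOrigin
  rw [lintegral_tsum fun x : {x : Fin d → ℤ // x ≠ 0} => (hmeas' x.1).aemeasurable]
  refine tsum_congr fun x => ?_
  rw [lintegral_tsum fun j => (hmeas x.1 j).aemeasurable]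
  exact tsum_congr fun j => lintegral_const_mul _ (hmeas₀ (x.1, j))

theorem lintegral_grandCanonicalMeasure (V : EuclideanSpace ℝ (Fin d) → ℝ) (θ : ℕ+ → ℝ) (L : ℝ)
    (x : Fin d → ℤ) (j : ℕ+) :
    ∫⁻ R, (R (x, j) : ℝ≥0∞) ∂(grandCanonicalMeasure V θ L 1) =
      ENNReal.ofReal (siteActivity V θ L x j) := by
  have h1 := (measurePreserving_eval_infinitePi (fun p : (Fin d → ℤ) × ℕ+ =>
    poissonMeasure (Real.toNNReal (θ p.2 / (p.2 : ℕ) * (((1 : ℝ≥0) : ℝ)) ^ (p.2 : ℕ) *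
      Real.exp (-((p.2 : ℕ) : ℝ) * V (scaledSite L p.1))))) (x, j)).lintegral_comp
    (f := fun n : ℕ => (n : ℝ≥0∞)) (measurable_of_countable _)
  rw [lintegral_natCast_poissonMeasure] at h1
  refine h1.trans ?_
  simp [siteActivity, ENNReal.ofReal]

/-- Only the Poisson means and Tonelli's theorem enter; this is where the centring of the statement
is matched with the mean of `massLaw`. -/
theorem criticalDensityAt_eq (hd : 0 < d) (hδ : 0 < δ) (hγ : γ < 0) (hp : 1 < |γ| + d / δ) {L : ℝ}
    (hL : 0 < L) :
    criticalDensityAt (normPotential δ d) (powerWeight γ) L = (1 / L ^ d) * offMean γ δ d L := by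
  rw [criticalDensityAt, criticalFugacity_eq hd hδ hγ hp]
  congr 1
  rw [ENNReal.toNNReal_one]
  have h2 := (lintegral_particlesOffOrigin (grandCanonicalMeasure (normPotential δ d) (powerWeight γ)
    L 1)).trans (tsum_congr fun x => tsum_congr fun j => by
    rw [lintegral_grandCanonicalMeasure, ← ENNReal.ofReal_natCast, ← ENNReal.ofReal_mul (Nat.cast_nonneg _)])
  have h3 : ∑' x : {x : Fin d → ℤ // x ≠ 0}, ∑' j : ℕ+,
      ENNReal.ofReal ((j : ℕ) * siteActivity (normPotential δ d) (powerWeight γ) L x.1 j) =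
      ∑' x : Fin d → ℤ, ∑' j : ℕ+, ENNReal.ofReal ((j : ℕ) * offActivity γ δ d L x j) := by
    refine (tsum_subtype {x : Fin d → ℤ | x ≠ 0} (fun x => ∑' j : ℕ+, ENNReal.ofReal
      ((j : ℕ) * siteActivity (normPotential δ d) (powerWeight γ) L x j))).trans ?_
    refine tsum_congr fun x => ?_
    by_cases hx : x = 0
    · simp [hx, offActivity, offSite]
    · simp [hx, offActivity, offSite]
  have h4 : ∀ j : ℕ+, ∑' x : Fin d → ℤ, ENNReal.ofReal ((j : ℕ) * offActivity γ δ d L x j) =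
      ENNReal.ofReal ((j : ℕ) * offIntensity γ δ d L j) := by
    intro j
    have h5 := (hasSum_offActivity (γ := γ) hd hδ hL j).mul_left ((j : ℕ) : ℝ)
    rw [← h5.tsum_eq, ENNReal.ofReal_tsum_of_nonneg
      (fun x => mul_nonneg (by positivity) (offActivity_nonneg _ _ _)) h5.summable]
  rw [h2, h3, ENNReal.tsum_comm, tsum_congr h4, ← ENNReal.ofReal_tsum_of_nonneg
    (fun j => mul_nonneg (by positivity) (offIntensity_nonneg _ _ _ _ _))
    (summable_offMean hd hδ hγ hp hL), ENNReal.toReal_ofReal]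
  · rfl
  · exact tsum_nonneg fun j => mul_nonneg (by positivity) (offIntensity_nonneg _ _ _ _ _)

end Model

/-! ### Comparison of the canonical law with the law of the mass away from the origin -/

/-- The ratio is (h_k k^(1-γ)/H) times (k/(κΛ))^(γ-1), and both factors are near 1 in the window.
The width 2η leaves one η for the deviation of the mean and one for that of the mass. -/
theorem eventually_rpow_ratio {γ H κ : ℝ} (hH : 0 < H) (hκ : 0 < κ) {h : ℕ → ℝ}
    (hlim : Tendsto (fun k : ℕ => h k * (k : ℝ) ^ (1 - γ)) atTop (𝓝 H)) {ε : ℝ} (hε : 0 < ε) :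
    ∃ η : ℝ, 0 < η ∧ η ≤ κ / 4 ∧ ∀ᶠ Λ : ℝ in atTop, ∀ k : ℕ, |(k : ℝ) - κ * Λ| ≤ 2 * (η * Λ) →
      |h k / (H * (κ * Λ) ^ (γ - 1)) - 1| ≤ ε := by
  have hcont : ContinuousAt (fun z : ℝ × ℝ => z.1 * z.2 ^ (γ - 1)) (1, 1) := by
    refine continuousAt_fst.mul (continuousAt_snd.rpow_const (Or.inl ?_))
    norm_num
  obtain ⟨r, hr0, hr⟩ := Metric.continuousAt_iff.1 hcont ε hε
  have hψ : Tendsto (fun k : ℕ => h k * (k : ℝ) ^ (1 - γ) / H) atTop (𝓝 1) := by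
    have := hlim.div_const H
    rwa [div_self hH.ne'] at this
  obtain ⟨k₀, hk₀⟩ := Metric.tendsto_atTop.1 hψ r hr0
  -- The bound κ/4 keeps k above κΛ/2, and κr/4 puts k/(κΛ) within r of 1.
  refine ⟨min (κ / 4) (κ * r / 4), by positivity, min_le_left _ _, ?_⟩
  filter_upwards [eventually_ge_atTop (2 * ((k₀ : ℝ) + 1) / κ)] with Λ hΛ k hk
  have hΛ1 : 2 * ((k₀ : ℝ) + 1) ≤ Λ * κ := by rwa [div_le_iff₀ hκ] at hΛ
  have hΛ0 : 0 < Λ := by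
    by_contra h0
    have h1 : Λ * κ ≤ 0 := mul_nonpos_of_nonpos_of_nonneg (not_lt.1 h0) hκ.le
    have : (0 : ℝ) ≤ k₀ := Nat.cast_nonneg _
    linarith
  have hκΛ : 0 < κ * Λ := by positivity
  have hη1 : 2 * (min (κ / 4) (κ * r / 4) * Λ) ≤ κ * Λ / 2 := by
    have := mul_le_mul_of_nonneg_right (min_le_left (κ / 4) (κ * r / 4)) hΛ0.le
    linarith
  have hη2 : 2 * (min (κ / 4) (κ * r / 4) * Λ) ≤ κ * Λ * r / 2 := by
    have := mul_le_mul_of_nonneg_right (min_le_right (κ / 4) (κ * r / 4)) hΛ0.le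
    linarith
  have hkpos : (k₀ : ℝ) + 1 ≤ k := by
    have := (abs_le.1 (hk.trans hη1)).1
    linarith
  have hk0 : (0 : ℝ) < k := by
    have : (0 : ℝ) ≤ k₀ := Nat.cast_nonneg _
    linarith
  have hkk : k₀ ≤ k := by
    have : (k₀ : ℝ) ≤ k := by linarith
    exact_mod_cast this
  have h1 := hk₀ k hkk
  have h2 : dist ((k : ℝ) / (κ * Λ)) 1 < r := by
    rw [Real.dist_eq, div_sub_one hκΛ.ne', abs_div, abs_of_pos hκΛ, div_lt_iff₀ hκΛ]
    have : 0 < κ * Λ * r := by positivity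
    linarith [hk.trans hη2]
  have h3 := hr (x := (h k * (k : ℝ) ^ (1 - γ) / H, (k : ℝ) / (κ * Λ))) (by
    rw [Prod.dist_eq]
    exact max_lt h1 h2)
  simp only [Real.one_rpow, mul_one, Real.dist_eq] at h3
  have h4 : h k * (k : ℝ) ^ (1 - γ) / H * ((k : ℝ) / (κ * Λ)) ^ (γ - 1) =
      h k / (H * (κ * Λ) ^ (γ - 1)) := by
    rw [Real.div_rpow hk0.le hκΛ.le]
    have h5 : (k : ℝ) ^ (1 - γ) * (k : ℝ) ^ (γ - 1) = 1 := by
      rw [← Real.rpow_add hk0]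
      simp
    have h6 : (κ * Λ) ^ (γ - 1) ≠ 0 := by positivity
    field_simp
    linear_combination h k * h5
  rw [h4] at h3
  exact h3.le

/-- A constant bound on the weights when the mass off the origin is too small; it covers the lower
tail. -/
theorem exists_rpow_ratio_le {γ H κ : ℝ} (hγ : γ < 1) (hH : 0 < H) (hκ : 0 < κ) {h : ℕ → ℝ}
    (hlim : Tendsto (fun k : ℕ => h k * (k : ℝ) ^ (1 - γ)) atTop (𝓝 H)) :
    ∃ C : ℝ, 0 ≤ C ∧ ∀ Λ : ℝ, 0 < Λ → ∀ k : ℕ, κ * Λ / 2 ≤ k →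
      h k / (H * (κ * Λ) ^ (γ - 1)) ≤ C := by
  obtain ⟨B, hB⟩ := hlim.bddAbove_range
  refine ⟨|B| * 2 ^ (1 - γ) / H, by positivity, fun Λ hΛ k hk => ?_⟩
  have hκΛ : 0 < κ * Λ := by positivity
  have hk0 : (0 : ℝ) < k := by linarith
  have h1 : h k * (k : ℝ) ^ (1 - γ) ≤ |B| := (hB ⟨k, rfl⟩).trans (le_abs_self B)
  have h2 : (κ * Λ / 2) ^ (1 - γ) ≤ (k : ℝ) ^ (1 - γ) :=
    Real.rpow_le_rpow (by positivity) hk (by linarith)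
  rw [Real.div_rpow hκΛ.le (by norm_num), div_le_iff₀ (by positivity)] at h2
  have h3 : (κ * Λ) ^ (γ - 1) = ((κ * Λ) ^ (1 - γ))⁻¹ := by
    rw [← Real.rpow_neg hκΛ.le]
    ring_nf
  have h4 : 0 < (κ * Λ) ^ (1 - γ) := by positivity
  rw [h3, div_le_div_iff₀ (by positivity) hH]
  rcases le_total (h k) 0 with h5 | h5
  · refine (mul_nonpos_of_nonpos_of_nonneg h5 hH.le).trans (by positivity)
  · have h6 : h k * (κ * Λ) ^ (1 - γ) ≤ |B| * 2 ^ (1 - γ) := by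
      refine (mul_le_mul_of_nonneg_left h2 h5).trans ?_
      rw [← mul_assoc]
      exact mul_le_mul_of_nonneg_right h1 (by positivity)
    have h7 : |B| * 2 ^ (1 - γ) * (H * ((κ * Λ) ^ (1 - γ))⁻¹) =
        |B| * 2 ^ (1 - γ) * H / (κ * Λ) ^ (1 - γ) := by ring
    rw [h7, le_div_iff₀ h4]
    nlinarith

/-- Pointwise bound for the normalised weight, split according to the size of `m - M`. -/
theorem abs_ratio_sub_one_le {γ H κ ρ C ε η Λ W s M : ℝ} {h : ℕ → ℝ} {N m : ℕ}
    (h0 : ∀ k, 0 ≤ h k) (hle : ∀ k, h k ≤ H) (hH : 0 < H) (hκ : 0 < κ) (hε : 0 ≤ ε) (hC0 : 0 ≤ C)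
    (hηκ : η ≤ κ / 4) (hΛ0 : 0 < Λ) (hW0 : 0 < W) (hs : 0 < s)
    (hM : |M - (ρ - κ) * Λ| ≤ η * Λ) (hN : (N : ℝ) = ρ * Λ)
    (hC : ∀ k : ℕ, κ * Λ / 2 ≤ k → h k / (H * (κ * Λ) ^ (γ - 1)) ≤ C)
    (hη : ∀ k : ℕ, |(k : ℝ) - κ * Λ| ≤ 2 * (η * Λ) →
      |h k / (H * (κ * Λ) ^ (γ - 1)) - 1| ≤ ε / 2) :
    |(if m ≤ N then h (N - m) else 0) / (H * (κ * Λ) ^ (γ - 1)) - 1| ≤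
      ε / 2 + (C + 1) * (Real.exp (-(η * (Λ * W))) * Real.exp (-(W * (m - M)))) +
      (1 + (κ * Λ) ^ (1 - γ)) * (Real.exp (-(s * (η * Λ))) * Real.exp (s * (m - M))) := by
  have hκΛ : 0 < κ * Λ := by positivity
  have hq : 0 < (κ * Λ) ^ (1 - γ) := by positivity
  have hD : 0 < H * (κ * Λ) ^ (γ - 1) := by positivity
  have hT1 : 0 ≤ (C + 1) * (Real.exp (-(η * (Λ * W))) * Real.exp (-(W * (m - M)))) := by
    positivity
  have hT2 : 0 ≤ (1 + (κ * Λ) ^ (1 - γ)) * (Real.exp (-(s * (η * Λ))) *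
      Real.exp (s * (m - M))) := by positivity
  have hηΛ : η * Λ ≤ κ / 4 * Λ := mul_le_mul_of_nonneg_right hηκ hΛ0.le
  have hM1 : M - (ρ * Λ - κ * Λ) ≤ η * Λ := by
    rw [← sub_mul]
    exact (abs_le.1 hM).2
  have hM2 : -(η * Λ) ≤ M - (ρ * Λ - κ * Λ) := by
    rw [← sub_mul]
    exact (abs_le.1 hM).1
  have hNm : (m : ℝ) < ρ * Λ → m ≤ N ∧ ((N - m : ℕ) : ℝ) = ρ * Λ - m := by
    intro hm
    rw [← hN] at hm
    have hm' : m ≤ N := by exact_mod_cast hm.le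
    exact ⟨hm', by rw [Nat.cast_sub hm', hN]⟩
  -- Three regimes: m near M, where the ratio is nearly 1; m far below, where it is bounded; m far
  -- above, where only h ≤ H is left. In each far regime an exponential factor at least 1 stands in
  -- for the indicator.
  by_cases hup : m - M ≤ η * Λ
  · obtain ⟨hm1, hm2⟩ := hNm (by linarith)
    rw [if_pos hm1]
    by_cases hlow : M - m ≤ η * Λ
    · have := hη (N - m) (by
        rw [hm2, abs_le]
        constructor <;> linarith)
      linarith
    · rw [not_le] at hlow
      have h1 : (1 : ℝ) ≤ Real.exp (-(η * (Λ * W))) * Real.exp (-(W * (m - M))) := by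
        rw [← Real.exp_add]
        refine Real.one_le_exp ?_
        have := mul_le_mul_of_nonneg_left hlow.le hW0.le
        linarith
      have h2 := hC (N - m) (by rw [hm2]; linarith)
      have h3 : 0 ≤ h (N - m) / (H * (κ * Λ) ^ (γ - 1)) := div_nonneg (h0 _) hD.le
      have h4 := le_mul_of_one_le_right (by linarith : 0 ≤ C + 1) h1
      rw [abs_le]
      constructor <;> linarith
  · rw [not_le] at hup
    have h1 : (1 : ℝ) ≤ Real.exp (-(s * (η * Λ))) * Real.exp (s * (m - M)) := by
      rw [← Real.exp_add]
      refine Real.one_le_exp ?_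
      have := mul_le_mul_of_nonneg_left hup.le hs.le
      linarith
    have h3 : (κ * Λ) ^ (1 - γ) * (H * (κ * Λ) ^ (γ - 1)) = H := by
      have : 1 - γ + (γ - 1) = 0 := by ring
      rw [mul_left_comm, ← Real.rpow_add hκΛ, this, Real.rpow_zero, mul_one]
    have h6 : 0 ≤ (if m ≤ N then h (N - m) else 0) ∧
        (if m ≤ N then h (N - m) else 0) ≤ H := by
      split_ifs
      · exact ⟨h0 _, hle _⟩
      · exact ⟨le_rfl, hH.le⟩
    have h2 : (if m ≤ N then h (N - m) else 0) / (H * (κ * Λ) ^ (γ - 1)) ≤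
        (κ * Λ) ^ (1 - γ) := by
      rw [div_le_iff₀ hD, h3]
      exact h6.2
    have h4 := div_nonneg h6.1 hD.le
    have h5 := le_mul_of_one_le_right (by linarith : 0 ≤ 1 + (κ * Λ) ^ (1 - γ)) h1
    rw [abs_le]
    constructor <;> linarith

/-! ### Tail errors and convergence of the weights in mean -/

section Tails

variable {γ δ : ℝ} {d : ℕ}

/-- The error terms that control the two tails of the mass away from the origin. -/
theorem tendsto_tail_errors (hd : 0 < d) (hδ : 0 < δ) (hγ : γ < 0) (hdδ : δ < d)
    (hp1 : 1 < |γ| + d / δ) (hp2 : |γ| + d / δ < 2) {η κ : ℝ} (hη : 0 < η) (hκ : 0 < κ) (C : ℝ) :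
    Tendsto (fun L : ℝ => C * (Real.exp (-(η * (L ^ (d : ℝ) * L ^ (-((d : ℝ) / (|γ| + d / δ)))))) *
        Real.exp (∑' j : ℕ+, offIntensity γ δ d L j *
          expDefect (L ^ (-((d : ℝ) / (|γ| + d / δ))) * (j : ℕ)))) +
      (1 + (κ * L ^ (d : ℝ)) ^ (1 - γ)) * (Real.exp (-(L ^ (-δ) / 4 * (η * L ^ (d : ℝ)))) *
        Real.exp (∑' j : ℕ+, offIntensity γ δ d L j * expDefect (-(L ^ (-δ) / 4 * (j : ℕ))))))
      atTop (𝓝 0) := by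
  set p := |γ| + d / δ with hp
  have hd' : (0 : ℝ) < d := by exact_mod_cast hd
  have hα : (d : ℝ) / p < d := div_lt_self hd' hp1
  have hsplit : ∀ L a : ℝ, 0 < L → L ^ (d : ℝ) * L ^ (-a) = L ^ ((d : ℝ) - a) := fun L a hL => by
    rw [← Real.rpow_add hL, sub_eq_add_neg]
  have h1 : Tendsto (fun L : ℝ => C * (Real.exp (-(η * (L ^ (d : ℝ) * L ^ (-((d : ℝ) / p))))) *
        Real.exp (∑' j : ℕ+, offIntensity γ δ d L j *
          expDefect (L ^ (-((d : ℝ) / p)) * (j : ℕ))))) atTop (𝓝 0) := by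
    -- At t = 1 the cumulant converges, so the lower tail keeps the whole gain exp(-η L^(d-α)).
    have h2 := (Real.continuous_exp.tendsto _).comp
      (tendsto_offIntensity_expDefect hd hδ hγ hp1 hp2 (t := 1) zero_le_one)
    have h3 : Tendsto (fun L : ℝ => Real.exp (-(η * (L ^ (d : ℝ) * L ^ (-((d : ℝ) / p)))))) atTop
        (𝓝 0) := by
      refine Real.tendsto_exp_neg_atTop_nhds_zero.comp ?_
      refine ((tendsto_rpow_atTop (sub_pos.2 hα)).const_mul_atTop hη).congr' ?_
      filter_upwards [eventually_gt_atTop 0] with L hL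
      rw [hsplit L _ hL]
    have h4 := (h3.mul h2).const_mul C
    simp only [zero_mul, mul_zero, one_mul, Function.comp_def] at h4
    exact h4
  have h5 : Tendsto (fun L : ℝ => (1 + (κ * L ^ (d : ℝ)) ^ (1 - γ)) *
      (Real.exp (-(L ^ (-δ) / 4 * (η * L ^ (d : ℝ)))) *
        Real.exp (∑' j : ℕ+, offIntensity γ δ d L j * expDefect (-(L ^ (-δ) / 4 * (j : ℕ))))))
      atTop (𝓝 0) := by
    have hq : 0 < (d : ℝ) - δ := by linarith
    have hb : 0 < η / 8 := by linarith
    -- In the variable y = L^(d-δ), which tends to ∞ as δ < d, the polynomial weight (κ L^d)^(1-γ)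
    -- is a power of y.
    have h6 : Tendsto (fun y : ℝ => Real.exp (-(η / 8) * y) + κ ^ (1 - γ) *
        (y ^ (d * (1 - γ) / (d - δ)) * Real.exp (-(η / 8) * y))) atTop (𝓝 0) := by
      have h7 := tendsto_rpow_mul_exp_neg_mul_atTop_nhds_zero 0 (η / 8) hb
      have h8 := (tendsto_rpow_mul_exp_neg_mul_atTop_nhds_zero (d * (1 - γ) / (d - δ)) (η / 8)
        hb).const_mul (κ ^ (1 - γ))
      have h9 := h7.add h8
      simpa using h9
    have h10 := h6.comp (tendsto_rpow_atTop hq)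
    refine squeeze_zero' ?_ ?_ h10
    · filter_upwards [eventually_gt_atTop 0] with L hL
      positivity
    -- The cumulant is eventually at most half of the gain (η/4) L^(d-δ).
    · have h11 := (tendsto_offIntensity_upper hd hδ hγ hp1).eventually (ge_mem_nhds hb)
      filter_upwards [eventually_gt_atTop 0, h11] with L hL hS
      have hLd : 0 < L ^ (d : ℝ) * L ^ (-δ) := by positivity
      rw [div_le_iff₀ hLd, hsplit L _ hL] at hS
      have h12 : Real.exp (-(L ^ (-δ) / 4 * (η * L ^ (d : ℝ)))) *
          Real.exp (∑' j : ℕ+, offIntensity γ δ d L j * expDefect (-(L ^ (-δ) / 4 * (j : ℕ)))) ≤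
          Real.exp (-(η / 8) * L ^ ((d : ℝ) - δ)) := by
        rw [← Real.exp_add]
        refine Real.exp_le_exp.2 ?_
        have h13 : L ^ (-δ) / 4 * (η * L ^ (d : ℝ)) = η / 4 * L ^ ((d : ℝ) - δ) := by
          rw [← hsplit L _ hL]; ring
        rw [h13]
        linarith
      have h14 : (κ * L ^ (d : ℝ)) ^ (1 - γ) =
          κ ^ (1 - γ) * (L ^ ((d : ℝ) - δ)) ^ (d * (1 - γ) / (d - δ)) := by
        rw [Real.mul_rpow hκ.le (by positivity), ← Real.rpow_mul hL.le, ← Real.rpow_mul hL.le,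
          mul_div_cancel₀ _ hq.ne']
      refine (mul_le_mul_of_nonneg_left h12 (by positivity)).trans (le_of_eq ?_)
      rw [h14]
      simp only [Function.comp]
      ring
  have := h1.add h5
  rwa [add_zero] at this

/-- The normalised weights of the origin converge to `1` in mean. -/
theorem tendsto_integral_abs_ratio (hd : 0 < d) (hδ : 0 < δ) (hγ : γ < 0) (hdδ : δ < d)
    (hp1 : 1 < |γ| + d / δ) (hp2 : |γ| + d / δ < 2) {h : ℕ → ℝ} {H κ ρ : ℝ} (h0 : ∀ k, 0 ≤ h k)
    (hle : ∀ k, h k ≤ H) (hH : 0 < H)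
    (hlim : Tendsto (fun k : ℕ => h k * (k : ℝ) ^ (1 - γ)) atTop (𝓝 H)) (hκ : 0 < κ)
    (hρ : ρ = κ + expIntegral δ d * ∑' j : ℕ+, ((j : ℕ) : ℝ) ^ (-(|γ| + d / δ)))
    {L : ℕ → ℝ} {N : ℕ → ℕ} (hL0 : ∀ n, 0 < L n) (hL : Tendsto L atTop atTop)
    (hN : ∀ n, (N n : ℝ) = ρ * L n ^ (d : ℝ)) :
    Tendsto (fun n => ∫ m : ℕ, |(if m ≤ N n then h (N n - m) else 0) /
      (H * (κ * L n ^ (d : ℝ)) ^ (γ - 1)) - 1| ∂(massLaw (offActivity γ δ d (L n)))) atTop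
      (𝓝 0) := by
  have hd' : (0 : ℝ) < d := by exact_mod_cast hd
  obtain ⟨C, hC0, hC⟩ := exists_rpow_ratio_le (by linarith : γ < 1) hH hκ hlim
  rw [Metric.tendsto_nhds]
  intro ε hε
  obtain ⟨η, hη0, hηκ, hη⟩ := eventually_rpow_ratio hH hκ hlim (half_pos hε)
  have hΛ : Tendsto (fun n => L n ^ (d : ℝ)) atTop atTop := (tendsto_rpow_atTop hd').comp hL
  have herr := ((tendsto_tail_errors hd hδ hγ hdδ hp1 hp2 hη0 hκ (C + 1)).comp hL).eventually
    (gt_mem_nhds (half_pos hε))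
  have hmean := ((tendsto_offMean hd hδ hγ hp1).comp hL).eventually
    (Metric.ball_mem_nhds _ hη0)
  filter_upwards [hΛ.eventually hη, herr, hmean] with n hn1 hn2 hn3
  have hLn := hL0 n
  have hprob : IsProbabilityMeasure (massLaw (offActivity γ δ d (L n))) :=
    isProbabilityMeasure_massLaw (fun x j => offActivity_nonneg _ x j)
      (hasSum_offActivity_prod hd hδ hγ hLn).summable
  set P := massLaw (offActivity γ δ d (L n)) with hP
  set Λ := L n ^ (d : ℝ) with hΛdef
  have hΛ0 : 0 < Λ := by positivity
  set W := L n ^ (-((d : ℝ) / (|γ| + d / δ))) with hW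
  have hW0 : 0 < W := by positivity
  set M := offMean γ δ d (L n) with hM
  have hM1 : |M - (ρ - κ) * Λ| ≤ η * Λ := by
    have h1 : |M / Λ - (ρ - κ)| < η := by
      have : ρ - κ = expIntegral δ d * ∑' j : ℕ+, ((j : ℕ) : ℝ) ^ (-(|γ| + d / δ)) := by
        rw [hρ]; ring
      rw [this]
      exact hn3
    have h2 : M - (ρ - κ) * Λ = (M / Λ - (ρ - κ)) * Λ := by
      field_simp
    rw [h2, abs_mul, abs_of_pos hΛ0]
    exact mul_le_mul_of_nonneg_right h1.le hΛ0.le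
  have hM2 := abs_le.1 hM1
  have hD : 0 < H * (κ * Λ) ^ (γ - 1) := by positivity
  -- The lower tail is tested at the fluctuation scale L^(-α). The upper tail uses L^(-δ)/4, inside
  -- the range where the exponential moment is known to be finite.
  have hI1 := integral_exp_massLaw hd hδ hγ hp1 hLn (s := -W)
    (by have : 0 < L n ^ (-δ) := by positivity
        linarith)
  have hI2 := integral_exp_massLaw hd hδ hγ hp1 hLn (s := L n ^ (-δ) / 4)
    (by have : 0 < L n ^ (-δ) := by positivity
        linarith)
  rw [← hP, ← hM] at hI1 hI2
  simp only [neg_mul, neg_neg] at hI1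
  have hs0 : 0 < L n ^ (-δ) / 4 := by positivity
  have hpt : ∀ m : ℕ, |(if m ≤ N n then h (N n - m) else 0) / (H * (κ * Λ) ^ (γ - 1)) - 1| ≤
      ε / 2 + (C + 1) * (Real.exp (-(η * (Λ * W))) * Real.exp (-(W * (m - M)))) +
      (1 + (κ * Λ) ^ (1 - γ)) * (Real.exp (-(L n ^ (-δ) / 4 * (η * Λ))) *
        Real.exp (L n ^ (-δ) / 4 * (m - M))) := fun m =>
    abs_ratio_sub_one_le h0 hle hH hκ hε.le hC0 hηκ hΛ0 hW0 hs0 hM1 (hN n) (hC Λ hΛ0) hn1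
  have hJ1 : Integrable (fun m : ℕ => (C + 1) * (Real.exp (-(η * (Λ * W))) *
      Real.exp (-(W * (m - M))))) P := (hI1.1.const_mul _).const_mul _
  have hJ2 : Integrable (fun m : ℕ => (1 + (κ * Λ) ^ (1 - γ)) *
      (Real.exp (-(L n ^ (-δ) / 4 * (η * Λ))) * Real.exp (L n ^ (-δ) / 4 * (m - M)))) P :=
    (hI2.1.const_mul _).const_mul _
  have hJ01 : Integrable (fun m : ℕ => ε / 2 + (C + 1) * (Real.exp (-(η * (Λ * W))) *
      Real.exp (-(W * (m - M))))) P := (integrable_const _).add hJ1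
  have hfin : ∫ m : ℕ, |(if m ≤ N n then h (N n - m) else 0) / (H * (κ * Λ) ^ (γ - 1)) - 1| ∂P ≤
      ε / 2 + ((C + 1) * (Real.exp (-(η * (Λ * W))) *
        Real.exp (∑' j : ℕ+, offIntensity γ δ d (L n) j * expDefect (W * (j : ℕ)))) +
      (1 + (κ * Λ) ^ (1 - γ)) * (Real.exp (-(L n ^ (-δ) / 4 * (η * Λ))) *
        Real.exp (∑' j : ℕ+, offIntensity γ δ d (L n) j *
          expDefect (-(L n ^ (-δ) / 4 * (j : ℕ)))))) := by
    refine (integral_mono_of_nonneg (ae_of_all _ fun m => abs_nonneg _) (hJ01.add hJ2)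
      (ae_of_all _ hpt)).trans (le_of_eq ?_)
    rw [integral_add' hJ01 hJ2, integral_add (integrable_const _) hJ1, integral_const_mul,
      integral_const_mul, integral_const_mul, integral_const_mul, hI1.2, hI2.2, integral_const,
      probReal_univ, one_smul, add_assoc]
  rw [dist_zero_right, Real.norm_of_nonneg (integral_nonneg fun m => abs_nonneg _)]
  refine hfin.trans_lt ?_
  have hn2' := hn2
  simp only [Function.comp] at hn2'
  linarith

end Tails

/-- Reweighting by densities that converge to `1` in mean does not change weak limits. -/
theorem tendsto_reweighted {P : ℕ → Measure ℕ} [∀ n, IsProbabilityMeasure (P n)] {Y F : ℕ → ℕ → ℝ}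
    {C I : ℝ} (hY : ∀ n, Integrable (Y n) (P n)) (hF : ∀ n m, |F n m| ≤ C)
    (hY1 : Tendsto (fun n => ∫ m, |Y n m - 1| ∂(P n)) atTop (𝓝 0))
    (hI : Tendsto (fun n => ∫ m, F n m ∂(P n)) atTop (𝓝 I)) :
    Tendsto (fun n => (∫ m, Y n m * F n m ∂(P n)) / ∫ m, Y n m ∂(P n)) atTop (𝓝 I) := by
  have hFi : ∀ n, Integrable (F n) (P n) := fun n =>
    Integrable.of_bound (measurable_of_countable _).aestronglyMeasurable C (ae_of_all _ (hF n))
  have hYF : ∀ n, Integrable (fun m => Y n m * F n m) (P n) := fun n =>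
    (hY n).mul_bdd (measurable_of_countable _).aestronglyMeasurable (ae_of_all _ (hF n))
  have hYi : ∀ n, Integrable (fun m => |Y n m - 1|) (P n) := fun n =>
    ((hY n).sub (integrable_const 1)).abs
  have h1 : Tendsto (fun n => ∫ m, Y n m ∂(P n)) atTop (𝓝 1) := by
    rw [tendsto_iff_norm_sub_tendsto_zero]
    refine squeeze_zero (fun n => norm_nonneg _) (fun n => ?_) hY1
    have h2 : ∫ m, Y n m ∂(P n) - 1 = ∫ m, (Y n m - 1) ∂(P n) := by
      rw [integral_sub (hY n) (integrable_const _)]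
      simp
    rw [h2]
    exact norm_integral_le_integral_norm _
  have h3 : Tendsto (fun n => ∫ m, Y n m * F n m ∂(P n)) atTop (𝓝 I) := by
    have h4 : Tendsto (fun n => ∫ m, Y n m * F n m ∂(P n) - ∫ m, F n m ∂(P n)) atTop (𝓝 0) := by
      have h5 := hY1.mul_const C
      rw [zero_mul] at h5
      refine squeeze_zero_norm (fun n => ?_) h5
      rw [← integral_sub (hYF n) (hFi n), ← integral_mul_const]
      refine (norm_integral_le_integral_norm _).trans ?_
      refine integral_mono_of_nonneg (ae_of_all _ fun m => norm_nonneg _) ((hYi n).mul_const C)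
        (ae_of_all _ fun m => ?_)
      have h6 : Y n m * F n m - F n m = (Y n m - 1) * F n m := by ring
      simp only [h6, norm_mul, Real.norm_eq_abs]
      exact mul_le_mul_of_nonneg_left (hF n m) (abs_nonneg _)
    have := h4.add hI
    simpa using this
  have := h3.div h1 one_ne_zero
  rwa [div_one] at this

/-! ### Limit theorem -/

section Fluctuations

variable {γ δ : ℝ} {d : ℕ}

theorem isProbabilityMeasure_offMassLaw (hd : 0 < d) (hδ : 0 < δ) (hγ : γ < 0) {L : ℝ}
    (hL : 0 < L) : IsProbabilityMeasure (massLaw (offActivity γ δ d L)) :=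
  isProbabilityMeasure_massLaw (fun x j => offActivity_nonneg L x j)
    (hasSum_offActivity_prod hd hδ hγ hL).summable

/-- The law of the rescaled fluctuation of the mass away from the origin, with the sign reversed. -/
def fluctuationLaw (γ δ : ℝ) (d : ℕ) (L : ℝ) : Measure ℝ :=
  (massLaw (offActivity γ δ d L)).map fun m : ℕ =>
    (offMean γ δ d L - m) * L ^ (-((d : ℝ) / (|γ| + d / δ)))

theorem isProbabilityMeasure_fluctuationLaw (hd : 0 < d) (hδ : 0 < δ) (hγ : γ < 0) {L : ℝ}
    (hL : 0 < L) : IsProbabilityMeasure (fluctuationLaw γ δ d L) := by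
  have := isProbabilityMeasure_offMassLaw hd hδ hγ hL
  exact Measure.isProbabilityMeasure_map (measurable_of_countable _).aemeasurable

theorem mgf_fluctuationLaw (hd : 0 < d) (hδ : 0 < δ) (hγ : γ < 0) (hp : 1 < |γ| + d / δ)
    {L t : ℝ} (hL : 0 < L) (ht : 0 ≤ t) :
    Integrable (fun x => Real.exp (t * x)) (fluctuationLaw γ δ d L) ∧
      ∫ x, Real.exp (t * x) ∂(fluctuationLaw γ δ d L) =
        Real.exp (∑' j : ℕ+, offIntensity γ δ d L j *
          expDefect (t * L ^ (-((d : ℝ) / (|γ| + d / δ))) * (j : ℕ))) := by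
  have hm : AEMeasurable (fun m : ℕ => (offMean γ δ d L - m) * L ^ (-((d : ℝ) / (|γ| + d / δ))))
      (massLaw (offActivity γ δ d L)) := (measurable_of_countable _).aemeasurable
  have he : AEStronglyMeasurable (fun x : ℝ => Real.exp (t * x)) (fluctuationLaw γ δ d L) := by
    fun_prop
  have hW : 0 < L ^ (-((d : ℝ) / (|γ| + d / δ))) := by positivity
  have h1 := integral_exp_massLaw hd hδ hγ hp hL
    (s := -(t * L ^ (-((d : ℝ) / (|γ| + d / δ)))))
    (by have : 0 < L ^ (-δ) := by positivity
        have := mul_nonneg ht hW.le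
        linarith)
  have h2 : ∀ m : ℕ, Real.exp (-(t * L ^ (-((d : ℝ) / (|γ| + d / δ)))) *
      (m - offMean γ δ d L)) =
      Real.exp (t * ((offMean γ δ d L - m) * L ^ (-((d : ℝ) / (|γ| + d / δ))))) := fun m => by
    congr 1
    ring
  simp only [h2] at h1
  simp only [neg_mul, neg_neg] at h1
  rw [fluctuationLaw] at he ⊢
  rw [integrable_map_measure he hm, integral_map hm he]
  exact h1

theorem one_le_mgf_fluctuationLaw (hd : 0 < d) (hδ : 0 < δ) (hγ : γ < 0) (hp : 1 < |γ| + d / δ)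
    {L t : ℝ} (hL : 0 < L) (ht : 0 ≤ t) :
    1 ≤ ∫ x, Real.exp (t * x) ∂(fluctuationLaw γ δ d L) := by
  rw [(mgf_fluctuationLaw hd hδ hγ hp hL ht).2]
  exact Real.one_le_exp (tsum_nonneg fun j =>
    mul_nonneg (offIntensity_nonneg _ _ _ _ _) (expDefect_nonneg _))

theorem tendsto_mgf_fluctuationLaw (hd : 0 < d) (hδ : 0 < δ) (hγ : γ < 0)
    (hp1 : 1 < |γ| + d / δ) (hp2 : |γ| + d / δ < 2) {L : ℕ → ℝ} (hL0 : ∀ n, 0 < L n)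
    (hL : Tendsto L atTop atTop) {t : ℝ} (ht : 0 ≤ t) :
    Tendsto (fun n => ∫ x, Real.exp (t * x) ∂(fluctuationLaw γ δ d (L n))) atTop
      (𝓝 (Real.exp (expIntegral δ d * (∫ u in Set.Ioi 0, levyDensity (|γ| + d / δ) u) *
        t ^ (|γ| + d / δ)))) := by
  simp only [fun n => (mgf_fluctuationLaw hd hδ hγ hp1 (hL0 n) ht).2]
  exact (Real.continuous_exp.tendsto _).comp
    ((tendsto_offIntensity_expDefect hd hδ hγ hp1 hp2 ht).comp hL)

theorem summable_siteActivity_zero (hδ : 0 < δ) (hγ : γ < 0) (L : ℝ) :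
    Summable (siteActivity (normPotential δ d) (powerWeight γ) L 0) := by
  rw [siteActivity_zero hδ]
  exact summable_pnat_rpow (by linarith)

theorem partitionFunction_ne_top (hd : 0 < d) (hδ : 0 < δ) (hγ : γ < 0) {L : ℝ} (hL : 0 < L)
    (n : ℕ) : partitionFunction (normPotential δ d) (powerWeight γ) L n ≠ ∞ := by
  rw [partitionFunction_eq (powerWeight_pos γ)]
  refine ENNReal.sum_ne_top.2 fun k _ => ENNReal.mul_ne_top ?_ ?_
  · exact ((clusterCoeff_le (fun j => (siteActivity_pos (powerWeight_pos γ) 0 j).le)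
      (summable_siteActivity_zero hδ hγ L) k).trans_lt ENNReal.ofReal_lt_top).ne
  · exact configCoeff_ne_top (fun x j => offActivity_nonneg L x j)
      (hasSum_offActivity_prod hd hδ hγ hL).summable _

/-- The law of the occupation of the origin is a reweighting of the law of the mass away from it. -/
theorem integral_occupation_eq_reweighted (hd : 0 < d) (hδ : 0 < δ) (hγ : γ < 0) {L : ℝ}
    (hL : 0 < L) {n : ℕ} {D C : ℝ} (hD : D ≠ 0) {g F : ℕ → ℝ} (hg : ∀ k, |g k| ≤ C)
    (hF : ∀ m ≤ n, F m = g (n - m)) :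
    ∫ lam, g (occupation 0 lam)
        ∂(canonicalMeasure (normPotential δ d) (powerWeight γ) L n) =
      (∫ m : ℕ, (if m ≤ n then
          (clusterCoeff (fun j : ℕ+ => ((j : ℕ) : ℝ) ^ (γ - 1)) (n - m)).toReal else 0) / D * F m
        ∂(massLaw (offActivity γ δ d L))) /
      ∫ m : ℕ, (if m ≤ n then
          (clusterCoeff (fun j : ℕ+ => ((j : ℕ) : ℝ) ^ (γ - 1)) (n - m)).toReal else 0) / D
        ∂(massLaw (offActivity γ δ d L)) := by
  set h : ℕ → ℝ := fun k => (clusterCoeff (fun j : ℕ+ => ((j : ℕ) : ℝ) ^ (γ - 1)) k).toReal with hh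
  have hc : ∀ x j, 0 ≤ offActivity γ δ d L x j := fun x j => offActivity_nonneg L x j
  have hs := (hasSum_offActivity_prod hd hδ hγ hL).summable
  have h1 : ∀ m : ℕ, (if m ≤ n then h (n - m) else 0) / D * F m =
      D⁻¹ * if m ≤ n then h (n - m) * g (n - m) else 0 := fun m => by
    split_ifs with hm
    · rw [hF m hm]; ring
    · simp
  have h2 : ∀ m : ℕ, (if m ≤ n then h (n - m) else 0) / D =
      D⁻¹ * if m ≤ n then h (n - m) else 0 := fun m => by ring
  have h3 := integral_massLaw_eq_sum hc hs n fun k => h k * g k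
  have h4 := integral_massLaw_eq_sum hc hs n h
  rw [integral_occupation (powerWeight_pos γ) (partitionFunction_ne_top hd hδ hγ hL n) hg,
    siteActivity_zero hδ]
  change _ = (∫ m : ℕ, (if m ≤ n then h (n - m) else 0) / D * F m ∂_) /
    ∫ m : ℕ, (if m ≤ n then h (n - m) else 0) / D ∂_
  simp only [h1]
  simp only [h2]
  rw [integral_const_mul, integral_const_mul, h3, h4,
    mul_div_mul_left _ _ (inv_ne_zero hD), mul_div_mul_left _ _ (Real.exp_pos _).ne']
  simp only [ENNReal.toReal_mul]
  congr 1
  · exact Finset.sum_congr rfl fun k _ => by rw [hh, offActivity]; ring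
  · exact Finset.sum_congr rfl fun k _ => by rw [hh, offActivity]; ring

/-- Combines `integral_occupation_eq_reweighted` with the convergence of the weights in mean: the
occupation inherits the weak limit of the unweighted fluctuations. -/
theorem tendsto_integral_occupation (hd : 0 < d) (hδ : 0 < δ) (hγ1 : -1 < γ) (hγ : γ < 0)
    (hdδ : δ < d) (hp1 : 1 < |γ| + d / δ) (hp2 : |γ| + d / δ < 2) {κ ρ : ℝ} (hκ : 0 < κ)
    (hρ : ρ = κ + expIntegral δ d * ∑' j : ℕ+, ((j : ℕ) : ℝ) ^ (-(|γ| + d / δ)))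
    {L : ℕ → ℝ} {N : ℕ → ℕ} (hL0 : ∀ n, 0 < L n) (hL : Tendsto L atTop atTop)
    (hN : ∀ n, (N n : ℝ) = ρ * L n ^ (d : ℝ)) {f : BoundedContinuousFunction ℝ ℝ} {I : ℝ}
    (hI : Tendsto (fun n => ∫ x, f x ∂(fluctuationLaw γ δ d (L n))) atTop (𝓝 I)) :
    Tendsto (fun n => ∫ lam, f (((occupation 0 lam : ℝ) -
        (ρ * L n ^ (d : ℝ) - offMean γ δ d (L n))) * L n ^ (-((d : ℝ) / (|γ| + d / δ))))
      ∂(canonicalMeasure (normPotential δ d) (powerWeight γ) (L n) (N n))) atTop (𝓝 I) := by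
  have hs : Summable fun j : ℕ+ => ((j : ℕ) : ℝ) ^ (γ - 1) := summable_pnat_rpow (by linarith)
  set H := Real.exp (∑' j : ℕ+, ((j : ℕ) : ℝ) ^ (γ - 1)) with hH
  have hle : ∀ k, (clusterCoeff (fun j : ℕ+ => ((j : ℕ) : ℝ) ^ (γ - 1)) k).toReal ≤ H := fun k =>
    ENNReal.toReal_le_of_le_ofReal (Real.exp_pos _).le
      (clusterCoeff_le (fun j => by positivity) hs k)
  have hH0 : 0 < H := Real.exp_pos _
  have hD : ∀ n, 0 < H * (κ * L n ^ (d : ℝ)) ^ (γ - 1) := fun n => by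
    have := hL0 n
    positivity
  have hprob : ∀ n, IsProbabilityMeasure (massLaw (offActivity γ δ d (L n))) := fun n =>
    isProbabilityMeasure_offMassLaw hd hδ hγ (hL0 n)
  have hbound : ∀ x, |f x| ≤ ‖f‖ := fun x => f.norm_coe_le_norm x
  have hY := tendsto_integral_abs_ratio hd hδ hγ hdδ hp1 hp2
    (h := fun k => (clusterCoeff (fun j : ℕ+ => ((j : ℕ) : ℝ) ^ (γ - 1)) k).toReal)
    (fun k => ENNReal.toReal_nonneg) hle hH0 (tendsto_clusterCoeff hγ1 hγ) hκ hρ hL0 hL hN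
  have hI' : Tendsto (fun n => ∫ m : ℕ, f ((offMean γ δ d (L n) - m) *
      L n ^ (-((d : ℝ) / (|γ| + d / δ)))) ∂(massLaw (offActivity γ δ d (L n)))) atTop (𝓝 I) := by
    refine hI.congr fun n => ?_
    rw [fluctuationLaw, integral_map (measurable_of_countable _).aemeasurable
      f.continuous.aestronglyMeasurable]
  refine (tendsto_reweighted (fun n => ?_) (fun n m => hbound _) hY hI').congr fun n => ?_
  · refine Integrable.of_bound (C := H / (H * (κ * L n ^ (d : ℝ)) ^ (γ - 1)))
      (measurable_of_countable _).aestronglyMeasurable (ae_of_all _ fun m => ?_)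
    rw [norm_div, Real.norm_of_nonneg (hD n).le]
    refine div_le_div_of_nonneg_right ?_ (hD n).le
    split_ifs
    · rw [Real.norm_of_nonneg ENNReal.toReal_nonneg]
      exact hle _
    · simpa using hH0.le
  · refine (integral_occupation_eq_reweighted hd hδ hγ (hL0 n) (hD n).ne'
      (g := fun k : ℕ => f (((k : ℝ) - (ρ * L n ^ (d : ℝ) - offMean γ δ d (L n))) *
        L n ^ (-((d : ℝ) / (|γ| + d / δ))))) (fun k => hbound _) fun m hm => ?_).symm
    -- The occupation is N - m and ρ L^d = N, so its centred value is the mean of the mass minus m.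
    rw [Nat.cast_sub hm, hN n]
    congr 2
    ring

end Fluctuations

/-! ### The length attached to n, and the main theorem -/

theorem systemLength_pos {d : ℕ} {ρ : ℝ} (hρ : 0 < ρ) {n : ℕ} (hn : 0 < n) :
    0 < systemLength d ρ n := by
  have : (0 : ℝ) < n := by exact_mod_cast hn
  rw [systemLength]
  positivity

theorem mul_systemLength_pow {d : ℕ} (hd : 0 < d) {ρ : ℝ} (hρ : 0 < ρ) (n : ℕ) :
    ρ * systemLength d ρ n ^ d = n := by
  have hd' : (d : ℝ) ≠ 0 := by exact_mod_cast hd.ne'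
  rw [systemLength, ← Real.rpow_natCast, ← Real.rpow_mul (by positivity), one_div_mul_cancel hd',
    Real.rpow_one, mul_div_cancel₀ _ hρ.ne']

theorem tendsto_systemLength {d : ℕ} (hd : 0 < d) {ρ : ℝ} (hρ : 0 < ρ) :
    Tendsto (systemLength d ρ) atTop atTop := by
  have hd' : (0 : ℝ) < d := by exact_mod_cast hd
  exact (tendsto_rpow_atTop (by positivity)).comp
    (tendsto_natCast_atTop_atTop.atTop_div_const hρ)

end RandomPartition

end

open RandomPartition in
theorem theorem5p5 (d : ℕ) (γ δ ρ : ℝ)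
    (V : EuclideanSpace ℝ (Fin d) → ℝ) (θ : ℕ+ → ℝ)
    (hV : ∀ x, V x = ‖x‖ ^ δ)
    (hθ : ∀ j : ℕ+, θ j = ((j : ℕ) : ℝ) ^ γ)
    (hδ : 0 < δ) (hγ : γ < 0)
    (h_lower : 1 < (d : ℝ) / δ) (h_upper : (d : ℝ) / δ < γ + 2)
    (hρ : criticalDensity V θ < ENNReal.ofReal ρ) :
    -- the constant in the limit law is well defined and positive
    Integrable (fluctuationIntegrand γ δ d) ∧
    0 < fluctuationConstant γ δ d ∧
    -- the limit law exists
    (∃ ζ : Measure ℝ, IsProbabilityMeasure ζ ∧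
      HasStableLaplace ζ (fluctuationConstant γ δ d) (|γ| + (d : ℝ) / δ)) ∧
    -- it is stable, and the rescaled occupation of the origin converges to it in distribution
    ∀ (ζ : Measure ℝ) [IsProbabilityMeasure ζ],
      HasStableLaplace ζ (fluctuationConstant γ δ d) (|γ| + (d : ℝ) / δ) →
        IsStableLaw ζ ∧
        ∃ _ : ∀ n : ℕ, IsProbabilityMeasure (canonicalMeasure V θ (systemLength d ρ n) n),
          TendstoInDistribution
            (fun (n : ℕ) (lam : SpatialPartition d n) =>
              ((occupation 0 lam : ℝ) -
                  (ρ - criticalDensityAt V θ (systemLength d ρ n)) * systemLength d ρ n ^ d) /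
                systemLength d ρ n ^ (δ / (1 - δ * γ / d)))
            atTop (fun z : ℝ => z)
            (fun n => canonicalMeasure V θ (systemLength d ρ n) n) ζ := by
  obtain rfl : V = normPotential δ d := funext hV
  obtain rfl : θ = powerWeight γ := funext hθ
  have hdδ : δ < d := by rwa [lt_div_iff₀ hδ, one_mul] at h_lower
  have hd' : (0 : ℝ) < d := hδ.trans hdδ
  have hd : 0 < d := by exact_mod_cast hd'
  have hγ1 : -1 < γ := by linarith
  have habs : |γ| = -γ := abs_of_neg hγ
  have hp1 : 1 < |γ| + d / δ := by linarith
  have hp2 : |γ| + d / δ < 2 := by linarith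
  have hα : δ / (1 - δ * γ / d) = d / (|γ| + d / δ) := by
    have h1 : 0 < d - δ * γ := by nlinarith
    have h2 : 1 - δ * γ / d = (d - δ * γ) / d := by field_simp
    have h3 : |γ| + d / δ = (d - δ * γ) / δ := by rw [habs]; field_simp; ring
    rw [h2, h3]
    field_simp
  obtain ⟨hint, hb⟩ := fluctuation_aux hd hδ hγ1 hγ h_lower h_upper
  have hbpos : 0 < fluctuationConstant γ δ d := by
    rw [hb]
    exact mul_pos (expIntegral_pos hd hδ) (integral_levyDensity_pos hp1 hp2)
  rw [criticalDensity_eq hd hδ hγ hp1] at hρ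
  have hρ0 : 0 < ρ := ENNReal.ofReal_pos.1 (bot_le.trans_lt hρ)
  have hκ := sub_pos.2 ((ENNReal.ofReal_lt_ofReal_iff hρ0).1 hρ)
  -- The sequence is shifted by one because the length vanishes at n = 0; the limit is unaffected.
  have hL0 : ∀ n : ℕ, 0 < systemLength d ρ (n + 1) := fun n => systemLength_pos hρ0 n.succ_pos
  have hL : Tendsto (fun n : ℕ => systemLength d ρ (n + 1)) atTop atTop :=
    (tendsto_systemLength hd hρ0).comp (tendsto_add_atTop_nat 1)
  have hN : ∀ n : ℕ, ((n + 1 : ℕ) : ℝ) = ρ * systemLength d ρ (n + 1) ^ (d : ℝ) := fun n => by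
    rw [Real.rpow_natCast, mul_systemLength_pow hd hρ0]
  let μ : ℕ → ProbabilityMeasure ℝ := fun n =>
    ⟨fluctuationLaw γ δ d (systemLength d ρ (n + 1)),
      isProbabilityMeasure_fluctuationLaw hd hδ hγ (hL0 n)⟩
  have hμint : ∀ n (t : ℝ), 0 ≤ t → Integrable (fun x => Real.exp (t * x)) (μ n : Measure ℝ) :=
    fun n t ht => (mgf_fluctuationLaw hd hδ hγ hp1 (hL0 n) ht).1
  have hμone : ∀ n (t : ℝ), 0 ≤ t → 1 ≤ ∫ x, Real.exp (t * x) ∂(μ n : Measure ℝ) :=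
    fun n t ht => one_le_mgf_fluctuationLaw hd hδ hγ hp1 (hL0 n) ht
  have hμlim : ∀ t : ℝ, 0 ≤ t → Tendsto (fun n => ∫ x, Real.exp (t * x) ∂(μ n : Measure ℝ)) atTop
      (𝓝 (Real.exp (fluctuationConstant γ δ d * t ^ (|γ| + (d : ℝ) / δ)))) := fun t ht => by
    rw [hb]
    exact tendsto_mgf_fluctuationLaw hd hδ hγ hp1 hp2 hL0 hL ht
  refine ⟨hint, hbpos, ?_, fun ζ hζ hlap => ⟨isStableLaw_of_hasStableLaplace hbpos hp1 hlap, ?_⟩⟩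
  · obtain ⟨ν, hν⟩ := exists_limit_of_mgf hμint hμone hμlim
    exact ⟨ν, inferInstance, hν⟩
  · have hprob : ∀ n : ℕ, IsProbabilityMeasure (canonicalMeasure (normPotential δ d)
        (powerWeight γ) (systemLength d ρ n) n) := fun n => by
      refine isProbabilityMeasure_canonicalMeasure (powerWeight_pos γ) ?_
      rcases n.eq_zero_or_pos with rfl | hn
      · exact partitionFunction_zero_ne_top
      · exact partitionFunction_ne_top hd hδ hγ (systemLength_pos hρ0 hn) n
    have hmeas : ∀ (n : ℕ) (g : SpatialPartition d n → ℝ), Measurable g := fun n g _ _ =>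
      MeasurableSpace.measurableSet_top
    have hζlim := tendsto_of_mgf (ν := ⟨ζ, hζ⟩) hμint hμone hμlim hlap
    refine ⟨hprob, ⟨fun n => (hmeas n _).aemeasurable, aemeasurable_id, ?_⟩⟩
    refine (tendsto_add_atTop_iff_nat 1).1 ?_
    refine ProbabilityMeasure.tendsto_iff_forall_integral_tendsto.2 fun f => ?_
    have h1 := tendsto_integral_occupation hd hδ hγ1 hγ hdδ hp1 hp2 hκ (sub_add_cancel _ _).symm
      hL0 hL hN (ProbabilityMeasure.tendsto_iff_forall_integral_tendsto.1 hζlim f)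
    simp only [ProbabilityMeasure.coe_mk, Measure.map_id'] at h1 ⊢
    refine h1.congr fun n => ?_
    rw [integral_map (hmeas _ _).aemeasurable f.continuous.aestronglyMeasurable]
    refine integral_congr_ae (ae_of_all _ fun lam => ?_)
    have hLn := hL0 n
    have h2 : (ρ - criticalDensityAt (normPotential δ d) (powerWeight γ)
        (systemLength d ρ (n + 1))) * systemLength d ρ (n + 1) ^ d =
        ρ * systemLength d ρ (n + 1) ^ (d : ℝ) - offMean γ δ d (systemLength d ρ (n + 1)) := by
      rw [criticalDensityAt_eq hd hδ hγ hp1 hLn, Real.rpow_natCast]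
      field_simp
    simp only [h2, hα, Real.rpow_neg hLn.le, ← div_eq_mul_inv]
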